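/- Let $\mathbf k$ be a commutative $\mathbb Q$-algebra. **The set $\mathrm{PENT}(2,\mathbf k)$.** Let $\mathfrak t^0_{4,2}(\mathbf k)$ be the (degree-)completed Lie $\mathbf k$-algebra with generators $t^{12},t^{13}$ and $t(a)^{ij}$ ($i\ne j$ in $\{2,3,4\}$, $a\in\mathbb Z/2\mathbb Z$) and relations $$t(a)^{ij}=t(-a)^{ji},\quad [t(a)^{ij},t(a+b)^{il}+t(b)^{jl}]=0,\quad [t^{1i}+t^{1j}+\textstyle\sum_c t(c)^{ij},t(a)^{ij}]=0,$$ $$[t^{1i},t^{1j}+\textstyle\sum_c t(c)^{ij}]=0,\quad [t^{1i},t(a)^{jl}]=0$$ for all $a,b\in\mathbb Z/2\mathbb Z$ and distinct $i,j,l\in\{2,3,4\}$, as far as they involve the generators above only (that is, not $t^{14}$). For a power series $h=h(e^0,e^1,e^{-1})$ with coefficients in $\mathbf k$ in non-commuting variables put, in the completed universal enveloping algebra of $\mathfrak t^0_{4,2}(\mathbf k)$, $$h^{1,2,3}=h(t^{12},t(0)^{23},t(1)^{23}),\qquad h^{1,2,34}=h(t^{12},t(0)^{23}+t(0)^{24},t(1)^{23}+t(1)^{24}),$$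 $$h^{12,3,4}=h(t^{13}+\textstyle\sum_c t(c)^{23},t(0)^{34},t(1)^{34}),$$ $$h^{1,23,4}=h(t^{12}+t^{13}+\textstyle\sum_c t(c)^{23},\,t(0)^{24}+t(0)^{34},\,t(1)^{24}+t(1)^{34}),$$ and $g^{2,3,4}=g(t(0)^{23},t(0)^{34})$ for a series $g=g(e^0,e^1)$. Let $\delta(h)=h(e^0,e^1,0)$. Then $\mathrm{PENT}(2,\mathbf k)$ is the set of group-like series $h$ (constant term $1$ and $\Delta h=h\otimes h$, where $\Delta e^a=e^a\otimes1+1\otimes e^a$) such that $(\delta(h),h)$ satisfies the mixed pentagon equation $$h^{1,2,34}\,h^{12,3,4}=\delta(h)^{2,3,4}\,h^{1,23,4}\,h^{1,2,3}.$$ **The pairing.** For $u$ in the free algebra $\mathbb Q\langle e_0,e_1,e_{-1}\rangle$, let $\langle h,u\rangle\in\mathbf k$ be $\mathbb Q$-linear in $u$, with $\langle h,e_{a_1}\cdots e_{a_k}\rangle$ the coefficient of $e^{a_k}\cdots e^{a_1}$ in $h$. **The confluence relations $\mathcal I_{\rm CF}$.** Let $\sqcup\!\!\sqcup$ denote the shuffle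 product. For $S=\{0,1\}$ or $\{0,1,-1\}$ let $\mathcal A(S)=\mathbb Q\langle e_a\mid a\in S\rangle$, let $\mathcal A^0(S)$ be the span of the words (including the empty one) which neither begin with $e_0$ nor end with $e_1$, and let $\mathrm{reg}:\mathcal A(S)\to\mathcal A^0(S)$ be the unique homomorphism for the shuffle product which is the identity on $\mathcal A^0(S)$ and kills $e_0$ and $e_1$. Let $\mathrm{dist}:\mathcal A(\{0,1\})\to\mathcal A(\{0,1,-1\})$ be the algebra homomorphism with $e_0\mapsto 2e_0$, $e_1\mapsto e_1+e_{-1}$, and $\varrho$ the automorphism of $\mathcal A(\{0,1\})$ with $e_0\mapsto e_0-e_1$, $e_1\mapsto -e_1$. For indices $\kappa=(k_1,\dots,k_d)$ of positive integers ($d\ge0$) put $\theta(\emptyset)=1$ and $$\theta(k_1,\dots,k_d)=-\sum_{j=1}^d \big(e_1e_0^{k_j-1}\cdots e_1e_0^{k_1-1}\big)\mathbin{\sqcup\!\!\sqcup}\theta(k_{j+1},\dots,k_d)\quad(d>0),\qquad \theta'=\mathrm{dist}\circ\mathrm{reg}\circ\theta,$$ $$\theta_1(\kappa)=\theta'(\kappa)+2\sum_{m\ge1,\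 \kappa=(\kappa',\{1\}^{2m})} e_{-1}e_0^{2m-1}\mathbin{\sqcup\!\!\sqcup}\theta'(\kappa'),$$ $$w^\star(\emptyset)=1,\quad w^\star(k_1,\dots,k_d)=-e_1e_0^{k_1-1}(e_0-e_1)e_0^{k_2-1}\cdots(e_0-e_1)e_0^{k_d-1}\quad(d>0).$$ The elements $\varrho(w^\star(\kappa))$ form a basis of $\mathcal C=\mathbb Q\oplus e_1\mathcal A(\{0,1\})$; let $\wp:\mathcal C\to\mathcal A^0(\{0,1,-1\})$ be the linear map with $\wp(\varrho(w^\star(\kappa)))=\theta_1(\kappa)$. Let $\mathcal B\subset\mathbb Q\langle e_0,e_{-1},e_z,e_{-z^2}\rangle$ be the span of the words (including the empty one) which neither begin with $e_0$ nor end with $e_z$, let $\mathcal B'\subset\mathcal B$ be the span of those without $e_{-1}$, and let $\mathcal B''$ and $\mathcal B'''$ be the subspaces of $\mathcal B'$ spanned by the empty word and the words beginning with $e_z$, respectively by the words without $e_z$. The shuffle product induces an isomorphism $\mathcal B''\otimes\mathcal B'''\simeq\mathcal B'$. Define $\mathrm{reg}_{z\to0}:\mathcal B\to\mathcal A^0(\{0,1,-1\})$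 as the substitution $e_{-1}\mapsto0$ from $\mathcal B$ to $\mathcal B'$, followed by the linear map with $$u\mathbin{\sqcup\!\!\sqcup}v\ \mapsto\ \mathrm{dist}(\bar u)\mathbin{\sqcup\!\!\sqcup}\wp(\epsilon(v))\qquad(u\in\mathcal B'',\ v\in\mathcal B'''),$$ where $u\mapsto\bar u$ is the homomorphism with $e_0,e_{-z^2}\mapsto e_0$, $e_z\mapsto e_1$, and $\epsilon$ the homomorphism with $e_0\mapsto e_0$, $e_{-z^2}\mapsto e_1$. For $c\in\{0,1,-1\}$ let $\partial_c:\mathcal B\to\mathcal B$ be the linear map with $$\partial_c(e_{a_1}\cdots e_{a_k})=\sum_{i=1}^k\big(\mathrm{ord}_{z=c}(a_i-a_{i+1})-\mathrm{ord}_{z=c}(a_i-a_{i-1})\big)e_{a_1}\cdots\widehat{e_{a_i}}\cdots e_{a_k},$$ where $a_0=0$, $a_{k+1}=z$ and $\mathrm{ord}_{z=c}(0)=0$, and put $$\varphi(u)=\sum_{l\ge0}\ \sum_{c_1,\dots,c_l\in\{0,1,-1\}}\mathrm{reg}_{z\to0}(\partial_{c_1}\cdots\partial_{c_l}u)\mathbin{\sqcup\!\!\sqcup}\mathrm{reg}(e_{c_1}\cdots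 e_{c_l})\qquad(u\in\mathcal B).$$ Finally let $u\mapsto u|_{z\to1}$ be the homomorphism with $e_0\mapsto e_0$, $e_{-1},e_{-z^2}\mapsto e_{-1}$, $e_z\mapsto e_1$. The set of level two confluence relations is $$\mathcal I_{\rm CF}=\{u|_{z\to1}-\varphi(u)\mid u\in\mathcal B\}.$$ **Theorem.** If $h\in\mathrm{PENT}(2,\mathbf k)$, then $\langle h,u\rangle=0$ for every $u\in\mathcal I_{\rm CF}$. -/

import Mathlib

open scoped TensorProduct

noncomputable section

namespace Confluence

/-! ### Words, free algebras and the shuffle product -/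

/-- The free `ℚ`-algebra generated by formal symbols `e_x`, `x ∈ X`. -/
abbrev Alg (X : Type) : Type := FreeAlgebra ℚ X

/-- The generator `e_x`. -/
abbrev e {X : Type} (x : X) : Alg X := FreeAlgebra.ι ℚ x

/-- The monomial `e_{a₁} ⋯ e_{aₖ}` of a word `[a₁, …, aₖ]`. -/
def word {X : Type} (w : List X) : Alg X := (w.map e).prod

/-- The monomials form a basis of the free algebra. -/
def wordBasis (X : Type) : Module.Basis (List X) ℚ (Alg X) :=
  (FreeAlgebra.basisFreeMonoid ℚ X).reindex FreeMonoid.toList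

theorem wordBasis_apply {X : Type} (w : List X) : wordBasis X w = word w := by
  have h : FreeAlgebra.equivMonoidAlgebraFreeMonoid (R := ℚ) (word w)
      = MonoidAlgebra.single (FreeMonoid.ofList w) 1 := by
    induction w with
    | nil => simp [word]; rfl
    | cons a w ih =>
      have : word (a :: w) = e a * word w := by simp [word]
      rw [this, map_mul, ih]
      simp [e, FreeAlgebra.equivMonoidAlgebraFreeMonoid, MonoidAlgebra.single_mul_single]
  rw [← AlgEquiv.eq_symm_apply] at h
  rw [h]
  simp [wordBasis, FreeAlgebra.basisFreeMonoid]

/-- The linear map on the free algebra with prescribed values on the monomials. -/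
def linExt {X : Type} {M : Type*} [AddCommGroup M] [Module ℚ M] (f : List X → M) :
    Alg X →ₗ[ℚ] M :=
  (wordBasis X).constr ℚ f

theorem linExt_word {X : Type} {M : Type*} [AddCommGroup M] [Module ℚ M] (f : List X → M)
    (w : List X) : linExt f (word w) = f w := by
  rw [← wordBasis_apply, linExt, Module.Basis.constr_basis]

/-- The list (with multiplicity) of all shuffles of two words. -/
def shuffles {X : Type} : List X → List X → List (List X)
  | [], v => [v]
  | a :: u, [] => [a :: u]
  | a :: u, b :: v =>
      (shuffles u (b :: v)).map (a :: ·) ++ (shuffles (a :: u) v).map (b :: ·)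
termination_by u v => u.length + v.length

/-- The shuffle product, as a bilinear map on the free algebra. -/
def sh {X : Type} : Alg X →ₗ[ℚ] Alg X →ₗ[ℚ] Alg X :=
  linExt fun u => linExt fun v => ((shuffles u v).map word).sum

/-! ### Regularization of words -/

/-- The linear map
`w ↦ ∑ (-1)^i (w' ш e_x^i)`, the sum being over all `i` and `w'` with `w = w' e_x^i`. -/
def regRight {X : Type} [DecidableEq X] (x : X) : Alg X →ₗ[ℚ] Alg X :=
  linExt fun w => ∑ i ∈ Finset.range (w.length + 1),
    if w.drop (w.length - i) = List.replicate i x then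
      (-1 : ℚ) ^ i • sh (word (w.take (w.length - i))) (word (List.replicate i x))
    else 0

/-- The linear map
`w ↦ ∑ (-1)^i (w' ш e_x^i)`, the sum being over all `i` and `w'` with `w = e_x^i w'`. -/
def regLeft {X : Type} [DecidableEq X] (x : X) : Alg X →ₗ[ℚ] Alg X :=
  linExt fun w => ∑ i ∈ Finset.range (w.length + 1),
    if w.take i = List.replicate i x then
      (-1 : ℚ) ^ i • sh (word (w.drop i)) (word (List.replicate i x))
    else 0

/-- The shuffle regularization with respect to the letters `x₀` (at the beginning of words)
and `x₁ ≠ x₀` (at the end of words): the unique homomorphism for the shuffle product which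
kills `e_{x₀}` and `e_{x₁}` and fixes the words which neither begin with `x₀` nor end with
`x₁` (as well as the empty word), written out explicitly: stripping a final `x₁` off words is a
locally nilpotent derivation `∂` of the shuffle product with `∂ e_{x₁} = 1`, and
`regRight x₁ = ∑ (-1)^i e_{x₁}^i ш ∂^i` is the projection to its kernel along `e_{x₁}`; similarly
for `x₀`. -/
def regSh {X : Type} [DecidableEq X] (x₀ x₁ : X) : Alg X →ₗ[ℚ] Alg X :=
  regLeft x₀ ∘ₗ regRight x₁

/-! ### The alphabets -/

/-- The alphabet `{0, 1}`. -/
inductive L01 : Type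
  | zero
  | one
deriving DecidableEq

/-- The alphabet `{0, 1, -1}`. -/
inductive L3 : Type
  | zero
  | one
  | negOne
deriving DecidableEq

/-- The alphabet `{0, -1, z, -z²}`. -/
inductive LZ : Type
  | zero
  | negOne
  | z
  | negZSq
deriving DecidableEq

instance : Fintype L01 := ⟨{.zero, .one}, fun x => by cases x <;> decide⟩

instance : Fintype L3 := ⟨{.zero, .one, .negOne}, fun x => by cases x <;> decide⟩

/-- The regularization on `ℚ⟨e₀, e₁⟩`. -/
def reg01 : Alg L01 →ₗ[ℚ] Alg L01 := regSh L01.zero L01.one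

/-- The regularization on `ℚ⟨e₀, e₁, e₋₁⟩`. -/
def reg3 : Alg L3 →ₗ[ℚ] Alg L3 := regSh L3.zero L3.one

/-- The algebra homomorphism `dist` with `e₀ ↦ 2 e₀` and `e₁ ↦ e₁ + e₋₁`. -/
def dist : Alg L01 →ₐ[ℚ] Alg L3 :=
  FreeAlgebra.lift ℚ fun
    | .zero => 2 * e L3.zero
    | .one => e L3.one + e L3.negOne

/-- The automorphism `ϱ` with `e₀ ↦ e₀ - e₁` and `e₁ ↦ -e₁`. -/
def varrho : Alg L01 →ₐ[ℚ] Alg L01 :=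
  FreeAlgebra.lift ℚ fun
    | .zero => e L01.zero - e L01.one
    | .one => -e L01.one

/-! ### The map `℘` -/

/-- The word `e₁ e₀^{k₁-1} ⋯ e₁ e₀^{k_d-1}`. -/
def zWord (k : List ℕ+) : List L01 :=
  k.flatMap fun n => L01.one :: List.replicate (n - 1 : ℕ) L01.zero

/-- `θ(k₁, …, k_d) = -∑_{j=1}^{d} e₁ e₀^{k_j-1} ⋯ e₁ e₀^{k₁-1} ш θ(k_{j+1}, …, k_d)` for `d > 0`,
and `θ(∅) = 1`. -/
def theta : List ℕ+ → Alg L01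
  | [] => 1
  | k :: ks => -∑ j : Fin (ks.length + 1),
      sh (word (zWord ((k :: ks).take (j + 1)).reverse)) (theta ((k :: ks).drop (j + 1)))
termination_by k => k.length
decreasing_by simp

/-- `θ'(k) = dist (reg θ(k))`. -/
def theta' (k : List ℕ+) : Alg L3 := dist (reg01 (theta k))

/-- `θ₁(k) = θ'(k) + 2 ∑ e₋₁ e₀^{2m-1} ш θ'(k')`, the sum being over the `m ≥ 1` and `k'` such that
`k` is `k'` followed by `2m` ones. -/
def theta1 (k : List ℕ+) : Alg L3 :=
  theta' k + 2 * ∑ m ∈ Finset.Icc 1 k.length,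
    if k = k.take (k.length - 2 * m) ++ List.replicate (2 * m) 1 then
      sh (word (L3.negOne :: List.replicate (2 * m - 1) L3.zero))
        (theta' (k.take (k.length - 2 * m)))
    else 0

/-- `w⋆(k₁, …, k_d) = -e₁ e₀^{k₁-1} (e₀ - e₁) e₀^{k₂-1} ⋯ (e₀ - e₁) e₀^{k_d-1}`, `w⋆(∅) = 1`. -/
def wstar : List ℕ+ → Alg L01
  | [] => 1
  | k :: ks => -(e L01.one * e L01.zero ^ (k - 1 : ℕ) *
      (ks.map fun n : ℕ+ => (e L01.zero - e L01.one) * e L01.zero ^ (n - 1 : ℕ)).prod)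

/-- The substitution rewriting a polynomial in `e₀, e₁` as a polynomial in `x = e₀ - e₁` and
`y = e₀`, the new variables `x` and `y` being again denoted by `e₀` and `e₁`. -/
def toXY : Alg L01 →ₐ[ℚ] Alg L01 :=
  FreeAlgebra.lift ℚ fun
    | .zero => e L01.one
    | .one => e L01.one - e L01.zero

/-- The index `(k₁, …, k_d)` of a word `x^{k₁-1} y x^{k₂-1} y ⋯ y x^{k_d-1}`, where the letters
`x` and `y` are denoted by `0` and `1`. -/
def indexOfXY : List L01 → List ℕ+
  | [] => [1]
  | .one :: w => 1 :: indexOfXY w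
  | .zero :: w => (indexOfXY w).modifyHead (· + 1)

/-- The linear map `℘` on `𝒞 = ℚ ⊕ e₁ ℚ⟨e₀, e₁⟩` with `℘(ϱ(w⋆(k))) = θ₁(k)` for every index `k`
(see `wp_varrho_wstar`; the `ϱ(w⋆(k)) = e₁ x^{k₁-1} y x^{k₂-1} ⋯ y x^{k_d-1}`, with `x = e₀ - e₁`
and `y = e₀`, form a basis of `𝒞`).
The words which begin with `0` lie outside of `𝒞`, and get the irrelevant value `0`. -/
def wp : Alg L01 →ₗ[ℚ] Alg L3 :=
  linExt fun
    | [] => 1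
    | .zero :: _ => 0
    | .one :: w => linExt (fun v => theta1 (indexOfXY v)) (toXY (word w))

/-! ### The regularization at `z → 0` -/

/-- The homomorphism with `e₋₁ ↦ 0` which fixes the other generators. -/
def killNegOne : Alg LZ →ₐ[ℚ] Alg LZ :=
  FreeAlgebra.lift ℚ fun
    | .negOne => 0
    | a => e a

/-- The inverse of the shuffle isomorphism `u ⊗ v ↦ u ш v` from `ℬ'' ⊗ ℬ'''` to `ℬ'`, where `ℬ''`
is spanned by the words which begin with `z` and the empty word, and `ℬ'''` by the words
without `z`. On a word without `z` it is `v ↦ 1 ⊗ v`, and on a word `a₁ ⋯ a_p z u'`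
with `aᵢ ≠ z` it is
`∑_{i=0}^{p} (-1)^{p-i} e_z (e_{a_p} ⋯ e_{a_{i+1}} ш u') ⊗ e_{a₁} ⋯ e_{a_i}`. -/
def unshuffleZ : Alg LZ →ₗ[ℚ] Alg LZ ⊗[ℚ] Alg LZ :=
  linExt fun w =>
    let v := w.takeWhile (· ≠ LZ.z)
    match w.dropWhile (· ≠ LZ.z) with
    | [] => 1 ⊗ₜ word v
    | _ :: u' => ∑ i ∈ Finset.range (v.length + 1), (-1 : ℚ) ^ (v.length - i) •
        ((e LZ.z * sh (word (v.drop i).reverse) (word u')) ⊗ₜ[ℚ] word (v.take i))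

/-- The homomorphism on `ℚ⟨e₀, e_z, e_{-z²}⟩` with `e₀, e_{-z²} ↦ e₀` and `e_z ↦ e₁`
(the value at `e₋₁` is irrelevant). -/
def regBar : Alg LZ →ₐ[ℚ] Alg L01 :=
  FreeAlgebra.lift ℚ fun
    | .zero => e L01.zero
    | .negZSq => e L01.zero
    | .z => e L01.one
    | .negOne => 0

/-- The homomorphism on `ℚ⟨e₀, e_{-z²}⟩` with `e₀ ↦ e₀` and `e_{-z²} ↦ e₁`
(the values at `e₋₁` and `e_z` are irrelevant). -/
def eps : Alg LZ →ₐ[ℚ] Alg L01 :=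
  FreeAlgebra.lift ℚ fun
    | .zero => e L01.zero
    | .negZSq => e L01.one
    | .z => 0
    | .negOne => 0

/-- The map `reg_{z → 0}`: kill `e₋₁`, apply the inverse of the shuffle isomorphism
`ℬ'' ⊗ ℬ''' → ℬ'`, and then `u ⊗ v ↦ dist (regBar u) ш ℘ (eps v)`. -/
def regZ : Alg LZ →ₗ[ℚ] Alg L3 :=
  TensorProduct.lift (sh.compl₁₂ dist.toLinearMap wp)
    ∘ₗ TensorProduct.map regBar.toLinearMap eps.toLinearMap
    ∘ₗ unshuffleZ ∘ₗ killNegOne.toLinearMap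

/-! ### Confluence relations -/

/-- The letters `0, -1, z, -z²` as polynomials in `z`. -/
def LZ.toPoly : LZ → Polynomial ℚ
  | .zero => 0
  | .negOne => -1
  | .z => Polynomial.X
  | .negZSq => -Polynomial.X ^ 2

/-- The letters `0, 1, -1` as numbers. -/
def L3.toRat : L3 → ℚ
  | .zero => 0
  | .one => 1
  | .negOne => -1

/-- `ord_{z=c}(p)`, with the convention `ord_{z=c}(0) = 0`. -/
def ordAt (c : L3) (p : Polynomial ℚ) : ℕ := p.rootMultiplicity c.toRat

/-- The map `∂_c`, with
`∂_c(e_{a₁} ⋯ e_{aₖ}) = ∑ᵢ (ord_{z=c}(aᵢ - aᵢ₊₁) - ord_{z=c}(aᵢ - aᵢ₋₁)) e_{a₁} ⋯ ê_{aᵢ} ⋯ e_{aₖ}`,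
where `a₀ = 0` and `aₖ₊₁ = z`. -/
def partialAt (c : L3) : Alg LZ →ₗ[ℚ] Alg LZ :=
  linExt fun w =>
    let a : ℕ → Polynomial ℚ := fun i => ((LZ.zero :: (w ++ [LZ.z])).getD i LZ.zero).toPoly
    ∑ i ∈ Finset.Icc 1 w.length,
      ((ordAt c (a i - a (i + 1)) : ℚ) - (ordAt c (a i - a (i - 1)) : ℚ)) •
        word (w.eraseIdx (i - 1))

/-- The map `φ`, with
`φ(u) = ∑_l ∑_{c₁, …, c_l} reg_{z → 0}(∂_{c₁} ⋯ ∂_{c_l} u) ш reg(e_{c₁} ⋯ e_{c_l})`. The operators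
`∂_c` lower the length of words by one and vanish at `1`, so only the terms with `l` at most the
length of the word contribute. -/
def phi : Alg LZ →ₗ[ℚ] Alg L3 :=
  linExt fun w => ∑ l ∈ Finset.range (w.length + 1), ∑ c : Fin l → L3,
    sh (regZ ((List.ofFn c).foldr (fun a u => partialAt a u) (word w)))
      (reg3 (word (List.ofFn c)))

/-- The homomorphism `u ↦ u|_{z → 1}`. -/
def atOne : Alg LZ →ₐ[ℚ] Alg L3 :=
  FreeAlgebra.lift ℚ fun
    | .zero => e L3.zero
    | .negOne => e L3.negOne
    | .negZSq => e L3.negOne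
    | .z => e L3.one

/-- The space `ℬ` spanned by the words in `0, -1, z, -z²` which neither begin with `0` nor end
with `z` (including the empty word). -/
def spaceB : Submodule ℚ (Alg LZ) :=
  Submodule.span ℚ {x | ∃ w : List LZ, w.head? ≠ some LZ.zero ∧ w.getLast? ≠ some LZ.z ∧ x = word w}

/-- The set `I_CF = {u|_{z → 1} - φ(u) | u ∈ ℬ}` of level two confluence relations. -/
def ICF : Set (Alg L3) := {x | ∃ u ∈ spaceB, x = atOne u - phi u}

/-! ### Group-like power series -/

/-- Non-commutative formal power series over `k` in variables indexed by `X`, given by the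
coefficients of the words. -/
abbrev NCSeries (k : Type*) (X : Type) : Type _ := List X → k

/-- All the ways to distribute the letters of a word to two subwords, i.e. the terms of the
expansion of `Δ(e^{a₁}) ⋯ Δ(e^{aₙ})` with `Δ(e^a) = e^a ⊗ 1 + 1 ⊗ e^a`. -/
def unshuffles {X : Type} : List X → List (List X × List X)
  | [] => [([], [])]
  | a :: w => (unshuffles w).map (fun p => (a :: p.1, p.2)) ++
      (unshuffles w).map (fun p => (p.1, a :: p.2))

/-- The coefficient of `u ⊗ v` in `Δ(h)`, for the continuous coproduct `Δ` on power series
with `Δ(e^a) = e^a ⊗ 1 + 1 ⊗ e^a`. -/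
def coprodCoeff {k : Type*} [CommRing k] {X : Type} [DecidableEq X] [Fintype X]
    (h : NCSeries k X) (u v : List X) : k :=
  ∑ w : Fin (u.length + v.length) → X,
    ((unshuffles (List.ofFn w)).count (u, v) : k) * h (List.ofFn w)

/-- A power series is group-like if its constant term is `1` and `Δ(h) = h ⊗ h`. -/
def IsGroupLike {k : Type*} [CommRing k] {X : Type} [DecidableEq X] [Fintype X]
    (h : NCSeries k X) : Prop :=
  h [] = 1 ∧ ∀ u v : List X, coprodCoeff h u v = h u * h v

/-- The pairing with `⟨h, e_{a₁} ⋯ e_{aₖ}⟩` the coefficient of `e^{aₖ} ⋯ e^{a₁}` in `h`. -/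
def pairing {k : Type*} [CommRing k] [Algebra ℚ k] {X : Type} (h : NCSeries k X) :
    Alg X →ₗ[ℚ] k :=
  linExt fun w => h w.reverse

/-! ### The Lie algebra `𝔱⁰_{4,N}` and its completed enveloping algebra -/

/-- The indices `2, 3, 4`. -/
inductive Strand : Type
  | two
  | three
  | four
deriving DecidableEq

/-- The generators `t^{1j}` (`j ≠ 4`) and `t(a)^{ij}` (`i ≠ j`) of `𝔱⁰_{4,N}`. -/
inductive Gen (N : ℕ) : Type
  | t1 (j : Strand) (hj : j ≠ .four)
  | t (a : ZMod N) (i j : Strand) (hij : i ≠ j)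

/-- The defining relations of `𝔱⁰_{4,N}`, as elements of the free Lie algebra. -/
inductive Relator (k : Type*) [CommRing k] (N : ℕ) [NeZero N] : FreeLieAlgebra k (Gen N) → Prop
  | symm (a : ZMod N) (i j : Strand) (hij : i ≠ j) :
      Relator k N (FreeLieAlgebra.of k (Gen.t a i j hij) - FreeLieAlgebra.of k (Gen.t (-a) j i hij.symm))
  | triangle (a b : ZMod N) (i j l : Strand) (hij : i ≠ j) (hil : i ≠ l) (hjl : j ≠ l) :
      Relator k N ⁅FreeLieAlgebra.of k (Gen.t a i j hij),
        FreeLieAlgebra.of k (Gen.t (a + b) i l hil) + FreeLieAlgebra.of k (Gen.t b j l hjl)⁆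
  | central (a : ZMod N) (i j : Strand) (hi : i ≠ .four) (hj : j ≠ .four) (hij : i ≠ j) :
      Relator k N ⁅FreeLieAlgebra.of k (Gen.t1 (N := N) i hi) + FreeLieAlgebra.of k (Gen.t1 j hj)
        + ∑ c : ZMod N, FreeLieAlgebra.of k (Gen.t c i j hij), FreeLieAlgebra.of k (Gen.t a i j hij)⁆
  | pole (i j : Strand) (hi : i ≠ .four) (hj : j ≠ .four) (hij : i ≠ j) :
      Relator k N ⁅FreeLieAlgebra.of k (Gen.t1 (N := N) i hi),
        FreeLieAlgebra.of k (Gen.t1 j hj) + ∑ c : ZMod N, FreeLieAlgebra.of k (Gen.t c i j hij)⁆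
  | disjoint (a : ZMod N) (i j l : Strand) (hi : i ≠ .four) (hij : i ≠ j) (hil : i ≠ l)
      (hjl : j ≠ l) :
      Relator k N ⁅FreeLieAlgebra.of k (Gen.t1 (N := N) i hi), FreeLieAlgebra.of k (Gen.t a j l hjl)⁆

/-- The ideal generated by the defining relations. -/
abbrev relIdeal (k : Type*) [CommRing k] (N : ℕ) [NeZero N] :
    LieIdeal k (FreeLieAlgebra k (Gen N)) :=
  LieSubmodule.lieSpan k (FreeLieAlgebra k (Gen N)) {x | Relator k N x}

/-- The (uncompleted) Lie algebra `𝔱⁰_{4,N}` over `k`. -/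
abbrev T4 (k : Type*) [CommRing k] (N : ℕ) [NeZero N] : Type _ :=
  FreeLieAlgebra k (Gen N) ⧸ relIdeal k N

/-- The universal enveloping algebra of `𝔱⁰_{4,N}`. -/
abbrev UT4 (k : Type*) [CommRing k] (N : ℕ) [NeZero N] : Type _ :=
  UniversalEnvelopingAlgebra k (T4 k N)

/-- The relation `x₁ ⋯ x_m = 0` for `x₁, …, x_m ∈ 𝔱⁰_{4,N}`, generating the `m`-th power of the
augmentation ideal. -/
inductive TruncRel (k : Type*) [CommRing k] (N : ℕ) [NeZero N] (m : ℕ) :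
    UT4 k N → UT4 k N → Prop
  | mk (x : Fin m → T4 k N) :
      TruncRel k N m (List.ofFn fun i => UniversalEnvelopingAlgebra.ι k (x i)).prod 0

/-- The quotient of `U𝔱⁰_{4,N}` by the `m`-th power of the augmentation ideal. -/
abbrev UTrunc (k : Type*) [CommRing k] (N : ℕ) [NeZero N] (m : ℕ) : Type _ :=
  RingQuot (TruncRel k N m)

/-- The quotient map. -/
def toTrunc (k : Type*) [CommRing k] (N : ℕ) [NeZero N] (m : ℕ) : UT4 k N →ₐ[k] UTrunc k N m :=
  RingQuot.mkAlgHom k (TruncRel k N m)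

/-- The products of at least `m` elements of `𝔱⁰_{4,N}` vanish in `UTrunc k N m`. -/
theorem toTrunc_prod_eq_zero (k : Type*) [CommRing k] (N : ℕ) [NeZero N] (m : ℕ)
    (x : Fin m → T4 k N) :
    (List.ofFn fun i => toTrunc k N m (UniversalEnvelopingAlgebra.ι k (x i))).prod = 0 := by
  have h := RingQuot.mkAlgHom_rel k (TruncRel.mk (k := k) (N := N) x)
  rw [map_zero, map_list_prod, List.map_ofFn] at h
  exact h

/-- The transition map. -/
def transition (k : Type*) [CommRing k] (N : ℕ) [NeZero N] (m : ℕ) :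
    UTrunc k N (m + 1) →ₐ[k] UTrunc k N m :=
  RingQuot.liftAlgHom k ⟨toTrunc k N m, by
    rintro _ _ ⟨x⟩
    rw [List.ofFn_succ', List.concat_eq_append, List.prod_append, map_mul, map_list_prod,
      List.map_ofFn, map_zero]
    have h := toTrunc_prod_eq_zero k N m (fun i => x i.castSucc)
    simp only [Function.comp_def]
    rw [h, zero_mul]⟩

theorem transition_toTrunc (k : Type*) [CommRing k] (N : ℕ) [NeZero N] (m : ℕ) (x : UT4 k N) :
    transition k N m (toTrunc k N (m + 1) x) = toTrunc k N m x :=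
  RingQuot.liftAlgHom_mkAlgHom_apply ..

/-- The completed universal enveloping algebra of `𝔱⁰_{4,N}`: the inverse limit of the quotients
of `U𝔱⁰_{4,N}` by the powers of the augmentation ideal. -/
def UHat (k : Type*) [CommRing k] (N : ℕ) [NeZero N] : Subalgebra k (∀ m, UTrunc k N m) where
  carrier := {x | ∀ m, transition k N m (x (m + 1)) = x m}
  mul_mem' {x y} hx hy m := by simp only [Pi.mul_apply, map_mul, hx m, hy m]
  add_mem' {x y} hx hy m := by simp only [Pi.add_apply, map_add, hx m, hy m]
  algebraMap_mem' r m := by simp only [Pi.algebraMap_apply, AlgHom.commutes]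

/-- The value `h(A)` of a power series at elements of `𝔱⁰_{4,N}`, modulo the `m`-th power of the
augmentation ideal. -/
def substTrunc {k : Type*} [CommRing k] {N : ℕ} [NeZero N] {X : Type} [Fintype X]
    (h : NCSeries k X) (A : X → T4 k N) (m : ℕ) : UTrunc k N m :=
  ∑ n ∈ Finset.range m, ∑ w : Fin n → X, h (List.ofFn w) •
    (List.ofFn fun i => toTrunc k N m (UniversalEnvelopingAlgebra.ι k (A (w i)))).prod

/-- The value `h(A)` of a power series `h` at elements `A` of `𝔱⁰_{4,N}`, in the completed
enveloping algebra. -/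
def subst {k : Type*} [CommRing k] {N : ℕ} [NeZero N] {X : Type} [Fintype X]
    (h : NCSeries k X) (A : X → T4 k N) : UHat k N :=
  ⟨substTrunc h A, fun m => by
    have key : ∀ (n : ℕ) (w : Fin n → X),
        transition k N m (List.ofFn fun i =>
          toTrunc k N (m + 1) (UniversalEnvelopingAlgebra.ι k (A (w i)))).prod
        = (List.ofFn fun i => toTrunc k N m (UniversalEnvelopingAlgebra.ι k (A (w i)))).prod := by
      intro n w
      rw [map_list_prod, List.map_ofFn]
      simp only [Function.comp_def, transition_toTrunc]
    simp only [substTrunc, map_sum, map_smul, key]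
    rw [Finset.sum_range_succ]
    simp only [toTrunc_prod_eq_zero, smul_zero, Finset.sum_const_zero, add_zero]⟩

/-! ### The mixed pentagon equation -/

/-- The generator `t^{1j}` of `𝔱⁰_{4,N}`. -/
def t1 (k : Type*) [CommRing k] (N : ℕ) [NeZero N] (j : Strand) (hj : j ≠ .four := by decide) :
    T4 k N :=
  LieSubmodule.Quotient.mk (FreeLieAlgebra.of k (Gen.t1 (N := N) j hj))

/-- The generator `t(a)^{ij}` of `𝔱⁰_{4,N}`. -/
def t (k : Type*) [CommRing k] (N : ℕ) [NeZero N] (a : ZMod N) (i j : Strand)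
    (hij : i ≠ j := by decide) : T4 k N :=
  LieSubmodule.Quotient.mk (FreeLieAlgebra.of k (Gen.t a i j hij))

/-- The values of the variables `e⁰`, `e¹ = e^{ζ^0}`, `e^{-1} = e^{ζ^1}` (where `ζ = -1`) in a
substitution `h(A₀, A(0), A(1))`. -/
def args {k : Type*} [CommRing k] (A₀ : T4 k 2) (A : ZMod 2 → T4 k 2) : L3 → T4 k 2
  | .zero => A₀
  | .one => A 0
  | .negOne => A 1

/-- `h^{1,2,3} = h(t^{12}, t(a)^{23})`. -/
def sub1_2_3 {k : Type*} [CommRing k] (h : NCSeries k L3) : UHat k 2 :=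
  subst h (args (t1 k 2 .two) fun a => t k 2 a .two .three)

/-- `h^{12,3,4} = h(t^{13} + ∑_c t(c)^{23}, t(a)^{34})`. -/
def sub12_3_4 {k : Type*} [CommRing k] (h : NCSeries k L3) : UHat k 2 :=
  subst h (args (t1 k 2 .three + ∑ c : ZMod 2, t k 2 c .two .three) fun a => t k 2 a .three .four)

/-- `h^{1,23,4} = h(t^{12} + t^{13} + ∑_c t(c)^{23}, t(a)^{24} + t(a)^{34})`. -/
def sub1_23_4 {k : Type*} [CommRing k] (h : NCSeries k L3) : UHat k 2 :=
  subst h (args (t1 k 2 .two + t1 k 2 .three + ∑ c : ZMod 2, t k 2 c .two .three)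
    fun a => t k 2 a .two .four + t k 2 a .three .four)

/-- `h^{1,2,34} = h(t^{12}, t(a)^{23} + t(a)^{24})`. -/
def sub1_2_34 {k : Type*} [CommRing k] (h : NCSeries k L3) : UHat k 2 :=
  subst h (args (t1 k 2 .two) fun a => t k 2 a .two .three + t k 2 a .two .four)

/-- `g^{2,3,4} = g(t(0)^{23}, t(0)^{34})`, for a series `g` in two variables
`e⁰ = t^{12}` and `e¹ = t^{23}`. -/
def sub2_3_4 {k : Type*} [CommRing k] (g : NCSeries k L01) : UHat k 2 :=
  subst g fun
    | .zero => t k 2 0 .two .three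
    | .one => t k 2 0 .three .four

/-- The pair `(g, h)` satisfies the mixed pentagon equation. -/
def MixedPentagon {k : Type*} [CommRing k] (g : NCSeries k L01) (h : NCSeries k L3) : Prop :=
  sub1_2_34 h * sub12_3_4 h = sub2_3_4 g * sub1_23_4 h * sub1_2_3 h

/-- The inclusion of the alphabets. -/
def L01.toL3 : L01 → L3
  | .zero => .zero
  | .one => .one

/-- The image `δ(h)` of a series under the continuous homomorphism `e⁰ ↦ e⁰`, `e¹ ↦ e¹`,
`e^{-1} ↦ 0`. -/
def delta {k : Type*} (h : NCSeries k L3) : NCSeries k L01 := fun w => h (w.map L01.toL3)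

/-- The set `PENT(2, k)` of group-like series `h` such that `(δ(h), h)` satisfies the mixed
pentagon equation. -/
def PENT2 (k : Type*) [CommRing k] : Set (NCSeries k L3) :=
  {h | IsGroupLike h ∧ MixedPentagon (delta h) h}


/-! ### The explicit formulas have the defining properties

The facts about `℘`, the inverse of the shuffle isomorphism, and the shuffle regularization which
the definitions above rely on: `wp_varrho_wstar`, `sh_unshuffleZ`, `regSh_sh`, `regSh_word` and
`regSh_letters`. -/

theorem word_nil {X : Type} : word ([] : List X) = 1 := by simp [word]
theorem word_cons {X : Type} (a : X) (w : List X) : word (a :: w) = e a * word w := by simp [word]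
theorem word_append {X : Type} (u v : List X) : word (u ++ v) = word u * word v := by simp [word]
theorem ext_word {X : Type} {M : Type*} [AddCommGroup M] [Module ℚ M] {f g : Alg X →ₗ[ℚ] M}
    (h : ∀ w, f (word w) = g (word w)) : f = g :=
  (wordBasis X).ext fun w => by rw [wordBasis_apply, h]

theorem toXY_aux (k : ℕ+) (ks : List ℕ+) :
    varrho (wstar (k :: ks)) = e L01.one * ((e L01.zero - e L01.one) ^ (k - 1 : ℕ) *
      (ks.map fun n : ℕ+ => e L01.zero * (e L01.zero - e L01.one) ^ (n - 1 : ℕ)).prod) := by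
  have h0 : varrho (e L01.zero) = e L01.zero - e L01.one := by simp [varrho]
  have h1 : varrho (e L01.one) = - e L01.one := by simp [varrho]
  simp only [wstar, map_neg, map_mul, map_pow, map_list_prod, List.map_map, h0, h1,
    Function.comp_def, map_sub]
  simp [mul_assoc]

theorem toXY_word (k : ℕ+) (ks : List ℕ+) :
    toXY ((e L01.zero - e L01.one) ^ (k - 1 : ℕ) *
      (ks.map fun n : ℕ+ => e L01.zero * (e L01.zero - e L01.one) ^ (n - 1 : ℕ)).prod)
    = word (List.replicate (k - 1 : ℕ) L01.zero ++ zWord ks) := by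
  have h0 : toXY (e L01.zero) = e L01.one := by simp [toXY]
  have h1 : toXY (e L01.one) = e L01.one - e L01.zero := by simp [toXY]
  have hr : ∀ n, word (List.replicate n L01.zero) = e L01.zero ^ n := by intro n; simp [word]
  have hz : ∀ ks : List ℕ+, (ks.map fun n : ℕ+ => e L01.one * e L01.zero ^ (n - 1 : ℕ)).prod
      = word (zWord ks) := by
    intro ks
    induction ks with
    | nil => simp [zWord, word]
    | cons a l ih =>
      have : zWord (a :: l) = L01.one :: (List.replicate (a - 1 : ℕ) L01.zero ++ zWord l) := by
        simp [zWord]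
      rw [this, word_cons, word_append, hr, List.map_cons, List.prod_cons, ih, mul_assoc]
  simp only [map_mul, map_pow, map_list_prod, List.map_map, h0, h1,
    Function.comp_def, map_sub, sub_sub_cancel]
  rw [hz, word_append, hr]

theorem index_aux (k : ℕ+) (ks : List ℕ+) :
    indexOfXY (List.replicate (k - 1 : ℕ) L01.zero ++ zWord ks) = k :: ks := by
  induction ks generalizing k with
  | nil =>
    induction k using PNat.recOn with
    | one => simp [zWord, indexOfXY]
    | succ n ih =>
      have : ((n + 1 : ℕ+) : ℕ) - 1 = (n - 1 : ℕ) + 1 := by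
        have := n.pos; simp; omega
      rw [this, List.replicate_succ, List.cons_append, indexOfXY, ih]; rfl
  | cons a l ihl =>
    induction k using PNat.recOn with
    | one =>
      have : zWord (a :: l) = L01.one :: (List.replicate (a - 1 : ℕ) L01.zero ++ zWord l) := by
        simp [zWord]
      simp [this, indexOfXY, ihl]
    | succ n ih =>
      have : ((n + 1 : ℕ+) : ℕ) - 1 = (n - 1 : ℕ) + 1 := by
        have := n.pos; simp; omega
      rw [this, List.replicate_succ, List.cons_append, indexOfXY, ih]; rfl

theorem wp_one_mul (p : Alg L01) :
    wp (e L01.one * p) = linExt (fun v => theta1 (indexOfXY v)) (toXY p) := by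
  have : wp ∘ₗ LinearMap.mulLeft ℚ (e L01.one)
      = linExt (fun v => theta1 (indexOfXY v)) ∘ₗ toXY.toLinearMap := by
    refine ext_word fun w => ?_
    simp only [LinearMap.comp_apply, LinearMap.mulLeft_apply, ← word_cons, AlgHom.toLinearMap_apply]
    rw [wp, linExt_word]
  exact LinearMap.congr_fun this p

theorem sh_word {X : Type} (u v : List X) :
    sh (word u) (word v) = ((shuffles u v).map word).sum := by
  rw [sh, linExt_word, linExt_word]

theorem sh_one_left {X : Type} (x : Alg X) : sh 1 x = x := by
  have : sh (1 : Alg X) = LinearMap.id := ext_word fun w => by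
    rw [← word_nil, sh_word]; simp [shuffles]
  rw [this]; rfl

theorem sh_one_right {X : Type} (x : Alg X) : sh x 1 = x := by
  have : sh.flip (1 : Alg X) = LinearMap.id := ext_word fun w => by
    rw [← word_nil, LinearMap.flip_apply, sh_word]; cases w <;> simp [shuffles]
  exact LinearMap.congr_fun this x

theorem sh_cons {X : Type} (a b : X) (x y : Alg X) :
    sh (e a * x) (e b * y) = e a * sh x (e b * y) + e b * sh (e a * x) y := by
  have hw : ∀ u v : List X, sh (e a * word u) (e b * word v)
      = e a * sh (word u) (e b * word v) + e b * sh (e a * word u) (word v) := by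
    intro u v
    have hs : ∀ (c : X) (l : List (List X)), ((l.map (c :: ·)).map word).sum
        = e c * (l.map word).sum := by
      intro c l
      induction l with
      | nil => simp
      | cons w l ih => simp only [List.map_cons, List.sum_cons, ih, word_cons, mul_add]
    rw [← word_cons, ← word_cons, sh_word, sh_word, sh_word, shuffles, List.map_append,
      List.sum_append, hs, hs]
  have h1 : ∀ u, sh (e a * word u) ∘ₗ LinearMap.mulLeft ℚ (e b)
      = LinearMap.mulLeft ℚ (e a) ∘ₗ sh (word u) ∘ₗ LinearMap.mulLeft ℚ (e b)
        + LinearMap.mulLeft ℚ (e b) ∘ₗ sh (e a * word u) := fun u => ext_word fun v => by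
    simpa using hw u v
  have h2 : (sh.flip (e b * y)) ∘ₗ LinearMap.mulLeft ℚ (e a)
      = LinearMap.mulLeft ℚ (e a) ∘ₗ sh.flip (e b * y)
        + LinearMap.mulLeft ℚ (e b) ∘ₗ sh.flip y ∘ₗ LinearMap.mulLeft ℚ (e a) :=
    ext_word fun u => by simpa using LinearMap.congr_fun (h1 u) y
  simpa using LinearMap.congr_fun h2 x

theorem sh_comm {X : Type} (x y : Alg X) : sh x y = sh y x := by
  have hw : ∀ n, ∀ u v : List X, u.length + v.length = n →
      sh (word u) (word v) = sh (word v) (word u) := by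
    intro n
    induction n with
    | zero =>
      intro u v h
      obtain ⟨rfl, rfl⟩ : u = [] ∧ v = [] := by simpa using h
      rfl
    | succ n ih =>
      intro u v h
      cases u with
      | nil => rw [word_nil, sh_one_left, sh_one_right]
      | cons a u =>
        cases v with
        | nil => rw [word_nil, sh_one_left, sh_one_right]
        | cons b v =>
          simp only [List.length_cons] at h
          have h1 := ih u (b :: v) (by simp; omega)
          have h2 := ih (a :: u) v (by simp; omega)
          simp only [word_cons] at h1 h2 ⊢
          rw [sh_cons, sh_cons, h1, h2, add_comm]
  have : (sh : Alg X →ₗ[ℚ] _) = sh.flip := ext_word fun u => ext_word fun v => hw _ u v rfl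
  exact LinearMap.congr_fun (LinearMap.congr_fun this x) y

theorem sh_assoc {X : Type} (x y z : Alg X) : sh (sh x y) z = sh x (sh y z) := by
  have hw : ∀ n, ∀ u v w : List X, u.length + v.length + w.length = n →
      sh (sh (word u) (word v)) (word w) = sh (word u) (sh (word v) (word w)) := by
    intro n
    induction n with
    | zero =>
      intro u v w h
      obtain ⟨⟨rfl, rfl⟩, rfl⟩ : (u = [] ∧ v = []) ∧ w = [] := by simpa using h
      simp [word_nil, sh_one_left]
    | succ n ih =>
      intro u v w h
      rcases u with _ | ⟨a, u⟩
      · simp only [word_nil, sh_one_left]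
      rcases v with _ | ⟨b, v⟩
      · simp only [word_nil, sh_one_left, sh_one_right]
      rcases w with _ | ⟨c, w⟩
      · simp only [word_nil, sh_one_right]
      simp only [List.length_cons] at h
      have h1 := ih u (b :: v) (c :: w) (by simp; omega)
      have h2 := ih (a :: u) v (c :: w) (by simp; omega)
      have h3 := ih (a :: u) (b :: v) w (by simp; omega)
      simp only [word_cons] at h1 h2 h3 ⊢
      rw [sh_cons a b, sh_cons b c] at *
      simp only [map_add, LinearMap.add_apply, sh_cons] at *
      rw [h1, h2, ← h3]
      simp only [mul_add]
      abel
  have key : ∀ u v, sh (sh (word u) (word v)) = sh (word u) ∘ₗ sh (word v) :=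
    fun u v => ext_word fun w => hw _ u v w rfl
  have key2 : ∀ u, sh.flip z ∘ₗ sh (word u) = sh (word u) ∘ₗ sh.flip z :=
    fun u => ext_word fun v => LinearMap.congr_fun (key u v) z
  have key3 : sh.flip z ∘ₗ sh.flip y = sh.flip (sh y z) :=
    ext_word fun u => LinearMap.congr_fun (key2 u) y
  exact LinearMap.congr_fun key3 x


theorem sh_cons_word {X : Type} (a b : X) (u v : List X) :
    sh (word (a :: u)) (word (b :: v))
      = e a * sh (word u) (word (b :: v)) + e b * sh (word (a :: u)) (word v) := by
  simp only [word_cons, sh_cons]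

/-- The antipode identity of the shuffle algebra. -/
theorem antipode {X : Type} : ∀ (n : ℕ) (v : List X), v.length = n + 1 →
    ∑ i ∈ Finset.range (v.length + 1), (-1 : ℚ) ^ (v.length - i) •
      sh (word (v.take i)) (word (v.drop i).reverse) = 0 := by
  intro n
  induction n with
  | zero =>
    intro v hv
    obtain ⟨a, rfl⟩ := List.length_eq_one_iff.1 hv
    simp [Finset.sum_range_succ, word_nil, sh_one_left, sh_one_right]
  | succ n ih =>
    intro v hv
    obtain ⟨a, m, b, rfl⟩ : ∃ a m b, v = a :: (m ++ [b]) := by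
      cases v with
      | nil => simp at hv
      | cons a v =>
        rcases List.eq_nil_or_concat v with rfl | ⟨m, b, rfl⟩
        · simp at hv
        · exact ⟨a, m, b, by simp⟩
    have hm : m.length = n := by simpa using hv
    have ih1 := ih (m ++ [b]) (by simpa using hm)
    have ih2 := ih (a :: m) (by simpa using hm)
    have l1 : (m ++ [b]).length = n + 1 := by simpa using hm
    have l2 : (a :: m).length = n + 1 := by simpa using hm
    have l3 : (a :: (m ++ [b])).length = n + 2 := by simpa using hm
    rw [l1] at ih1
    rw [l2] at ih2
    rw [l3, Finset.sum_range_succ', Finset.sum_range_succ]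
    have hmid : ∀ i ∈ Finset.range (n + 1),
        (-1 : ℚ) ^ (n + 2 - (i + 1)) • sh (word ((a :: (m ++ [b])).take (i + 1)))
          (word ((a :: (m ++ [b])).drop (i + 1)).reverse)
        = e a * ((-1 : ℚ) ^ (n + 1 - i) • sh (word ((m ++ [b]).take i))
            (word ((m ++ [b]).drop i).reverse))
          - e b * ((-1 : ℚ) ^ (n + 1 - (i + 1)) • sh (word ((a :: m).take (i + 1)))
            (word ((a :: m).drop (i + 1)).reverse)) := by
      intro i hi
      have hi : i ≤ n := by simpa [Nat.lt_succ_iff] using hi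
      have e1 : (m ++ [b]).drop i = m.drop i ++ [b] := by
        rw [List.drop_append_of_le_length (by omega)]
      have e2 : (m ++ [b]).take i = m.take i := by
        rw [List.take_append_of_le_length (by omega)]
      have e3 : (-1 : ℚ) ^ (n + 1 - i) = - (-1) ^ (n - i) := by
        rw [show n + 1 - i = (n - i) + 1 by omega, pow_succ]; ring
      simp only [List.take_succ_cons, List.drop_succ_cons, e1, e2, List.reverse_append,
        List.reverse_singleton, List.singleton_append, sh_cons_word,
        show n + 2 - (i + 1) = n + 1 - i by omega, show n + 1 - (i + 1) = n - i by omega, e3]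
      simp only [smul_add, neg_smul, mul_neg, mul_smul_comm]
      abel
    rw [Finset.sum_congr rfl hmid, Finset.sum_sub_distrib, ← Finset.mul_sum, ← Finset.mul_sum]
    rw [Finset.sum_range_succ] at ih1
    rw [Finset.sum_range_succ'] at ih2
    rw [← eq_neg_iff_add_eq_zero] at ih1 ih2
    rw [ih1, ih2]
    have t1 : (m ++ [b]).take (n + 1) = m ++ [b] := List.take_of_length_le (by omega)
    have t2 : (m ++ [b]).drop (n + 1) = [] := List.drop_eq_nil_of_le (by omega)
    have e3 : (-1 : ℚ) ^ (n + 2) = - (-1) ^ (n + 1) := by ring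
    simp [t1, t2, word_nil, sh_one_left, sh_one_right, word_cons, e3]

theorem unshuffleZ_aux {X : Type} (z : X) (y : Alg X) (v : List X) :
    ∑ i ∈ Finset.range (v.length + 1), (-1 : ℚ) ^ (v.length - i) •
      sh (e z * sh (word (v.drop i).reverse) y) (word (v.take i)) = word v * (e z * y) := by
  induction v with
  | nil => simp [word_nil, sh_one_left, sh_one_right]
  | cons a v ih =>
    have hA := antipode _ (a :: v) rfl
    rw [List.length_cons] at hA ⊢
    rw [Finset.sum_range_succ'] at hA ⊢
    have h1 : ∀ i ∈ Finset.range (v.length + 1),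
        (-1 : ℚ) ^ (v.length + 1 - (i + 1)) •
          sh (e z * sh (word ((a :: v).drop (i + 1)).reverse) y) (word ((a :: v).take (i + 1)))
        = e z * sh ((-1 : ℚ) ^ (v.length + 1 - (i + 1)) •
            sh (word ((a :: v).take (i + 1))) (word ((a :: v).drop (i + 1)).reverse)) y
          + e a * ((-1 : ℚ) ^ (v.length - i) •
            sh (e z * sh (word (v.drop i).reverse) y) (word (v.take i))) := by
      intro i _
      simp only [List.take_succ_cons, List.drop_succ_cons, word_cons, sh_cons,
        Nat.add_sub_add_right, smul_add, map_smul, LinearMap.smul_apply, mul_smul_comm]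
      rw [sh_comm (sh _ y), ← sh_assoc]
    rw [Finset.sum_congr rfl h1, Finset.sum_add_distrib, ← Finset.mul_sum, ← Finset.mul_sum, ih]
    rw [← eq_neg_iff_add_eq_zero] at hA
    have h2 : ∀ (s : Finset ℕ) (f : ℕ → Alg X), ∑ i ∈ s, sh (f i) y = sh (∑ i ∈ s, f i) y :=
      fun s f => by simp
    rw [h2, hA]
    simp [word_nil, sh_one_left, sh_one_right, word_cons, mul_assoc]

/-- `unshuffleZ` is a section of the shuffle product `u ⊗ v ↦ u ш v`. -/
theorem sh_unshuffleZ (x : Alg LZ) : TensorProduct.lift sh (unshuffleZ x) = x := by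
  have : TensorProduct.lift sh ∘ₗ unshuffleZ = LinearMap.id := by
    refine ext_word fun w => ?_
    simp only [LinearMap.comp_apply, LinearMap.id_apply, unshuffleZ, linExt_word]
    have hw := List.takeWhile_append_dropWhile (p := (· ≠ LZ.z)) (l := w)
    have hd := List.head?_dropWhile_not (· ≠ LZ.z) w
    generalize w.takeWhile (· ≠ LZ.z) = v at *
    generalize w.dropWhile (· ≠ LZ.z) = r at *
    subst hw
    cases r with
    | nil => simp [sh_one_left]
    | cons b u' =>
      obtain rfl : b = LZ.z := by simpa using hd
      simp only [map_sum, map_smul, TensorProduct.lift.tmul]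
      rw [unshuffleZ_aux, word_append, word_cons]
  exact LinearMap.congr_fun this x


theorem shPow {X : Type} (x : X) (i j : ℕ) :
    sh (e x ^ i) (e x ^ j) = ((i + j).choose i : ℚ) • e x ^ (i + j) := by
  induction i generalizing j with
  | zero => simp [sh_one_left]
  | succ i ih =>
    induction j with
    | zero => simp [sh_one_right]
    | succ j ihj =>
      rw [pow_succ' (e x) i, pow_succ' (e x) j, sh_cons, ← pow_succ' (e x) j, ← pow_succ' (e x) i,
        ih, ihj, mul_smul_comm, mul_smul_comm, ← pow_succ', ← pow_succ',
        show i + 1 + (j + 1) = (i + j + 1) + 1 by omega, show i + (j + 1) = i + j + 1 by omega,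
        show i + 1 + j = i + j + 1 by omega, ← add_smul, Nat.choose_succ_succ (i + j + 1) i,
        Nat.cast_add]

theorem word_replicate {X : Type} (x : X) (n : ℕ) : word (List.replicate n x) = e x ^ n := by
  simp [word]

theorem leibniz_iter {X : Type} (D : Alg X →ₗ[ℚ] Alg X)
    (hD : ∀ p q, D (sh p q) = sh (D p) q + sh p (D q)) (n : ℕ) (p q : Alg X) :
    (D ^ n) (sh p q) = ∑ ij ∈ Finset.HasAntidiagonal.antidiagonal n, ((n.choose ij.1 : ℕ) : ℚ) •
      sh ((D ^ ij.1) p) ((D ^ ij.2) q) := by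
  induction n generalizing p q with
  | zero => simp
  | succ n ih =>
    rw [pow_succ, Module.End.mul_apply, hD, map_add, ih, ih]
    have := Finset.sum_antidiagonal_choose_succ_nsmul
      (fun i j => sh ((D ^ i) p) ((D ^ j) q)) n
    simp only [← Nat.cast_smul_eq_nsmul ℚ] at this
    rw [this]
    simp only [pow_succ, Module.End.mul_apply]
    rw [add_comm]
    congr 1
    refine Finset.sum_congr rfl fun ij hij => ?_
    rw [Finset.HasAntidiagonal.mem_antidiagonal] at hij
    rw [← hij, Nat.choose_symm_add]

/-- If `D` is a locally nilpotent derivation of the shuffle product, then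
`∑ (-1)^i (D^i p) ш e_x^i` is multiplicative in `p`. -/
theorem reg_mul_aux {X : Type} (x : X) (D R : Alg X →ₗ[ℚ] Alg X)
    (hD : ∀ p q, D (sh p q) = sh (D p) q + sh p (D q))
    (hn : ∀ p, ∃ n, ∀ m ≥ n, (D ^ m) p = 0)
    (hR : ∀ p n, (∀ m ≥ n, (D ^ m) p = 0) →
      R p = ∑ i ∈ Finset.range n, (-1 : ℚ) ^ i • sh ((D ^ i) p) (e x ^ i)) (p q : Alg X) :
    R (sh p q) = sh (R p) (R q) := by
  obtain ⟨a, ha⟩ := hn p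
  obtain ⟨b, hb⟩ := hn q
  have hab : ∀ m ≥ a + b, (D ^ m) (sh p q) = 0 := by
    intro m hm
    rw [leibniz_iter D hD]
    refine Finset.sum_eq_zero fun ij hij => ?_
    rw [Finset.HasAntidiagonal.mem_antidiagonal] at hij
    rcases le_or_gt a ij.1 with h | h
    · rw [ha _ h]; simp
    · rw [hb ij.2 (by omega)]; simp
  have hterm : ∀ i j, sh ((-1 : ℚ) ^ i • sh ((D ^ i) p) (e x ^ i))
      ((-1 : ℚ) ^ j • sh ((D ^ j) q) (e x ^ j))
      = (-1 : ℚ) ^ (i + j) • sh ((((i + j).choose i : ℕ) : ℚ) • sh ((D ^ i) p) ((D ^ j) q))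
        (e x ^ (i + j)) := by
    intro i j
    have : sh (sh ((D ^ i) p) (e x ^ i)) (sh ((D ^ j) q) (e x ^ j))
        = sh (sh ((D ^ i) p) ((D ^ j) q)) (sh (e x ^ i) (e x ^ j)) := by
      rw [sh_assoc, sh_assoc, ← sh_assoc (e x ^ i), sh_comm (e x ^ i) ((D ^ j) q), sh_assoc]
    simp only [map_smul, LinearMap.smul_apply, this, shPow, smul_smul, pow_add]
    congr 1; ring
  rw [hR _ _ hab, hR p (a + b) (fun m hm => ha m (by omega)),
    hR q (a + b) (fun m hm => hb m (by omega))]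
  simp only [map_sum, LinearMap.sum_apply, hterm]
  simp only [leibniz_iter D hD, map_sum, LinearMap.sum_apply, Finset.smul_sum]
  rw [← Finset.sum_product', Finset.sum_sigma']
  symm
  refine Finset.sum_bij_ne_zero (fun ij _ _ => ⟨ij.2 + ij.1, (ij.2, ij.1)⟩) ?_ ?_ ?_ ?_
  · rintro ⟨j, i⟩ h hne
    simp only [Finset.mem_sigma, Finset.mem_range, Finset.HasAntidiagonal.mem_antidiagonal, and_true]
    by_contra hlt
    apply hne
    rcases le_or_gt a i with h | h
    · simp [ha _ h]
    · simp [hb j (by omega)]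
  · rintro ⟨j, i⟩ _ _ ⟨j', i'⟩ _ _ h
    simp only [Sigma.mk.injEq] at h
    obtain ⟨_, h⟩ := h
    have := eq_of_heq h
    simp_all
  · rintro ⟨n, i, j⟩ h _
    simp only [Finset.mem_sigma, Finset.mem_range, Finset.HasAntidiagonal.mem_antidiagonal] at h
    obtain ⟨h1, rfl⟩ := h
    refine ⟨(j, i), ?_, ?_, rfl⟩
    · simp; omega
    · assumption
  · rintro ⟨j, i⟩ _ _
    rfl


theorem word_induction {X : Type} {P : Alg X → Prop} (h0 : P 0) (hw : ∀ w, P (word w))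
    (hadd : ∀ p q, P p → P q → P (p + q)) (hsmul : ∀ (c : ℚ) p, P p → P (c • p)) (p : Alg X) :
    P p := by
  have hp : p ∈ Submodule.span ℚ (Set.range (wordBasis X)) := by
    rw [(wordBasis X).span_eq]; trivial
  induction hp using Submodule.span_induction with
  | mem x h => obtain ⟨w, rfl⟩ := h; rw [wordBasis_apply]; exact hw w
  | zero => exact h0
  | add x y _ _ hx hy => exact hadd x y hx hy
  | smul c x _ hx => exact hsmul c x hx

theorem reg_mul {X : Type} (x : X) (D R : Alg X →ₗ[ℚ] Alg X)
    (hD : ∀ p q, D (sh p q) = sh (D p) q + sh p (D q))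
    (hR : ∀ w, ∃ n, ∀ m ≥ n, (D ^ m) (word w) = 0 ∧
      R (word w) = ∑ i ∈ Finset.range m, (-1 : ℚ) ^ i • sh ((D ^ i) (word w)) (e x ^ i))
    (p q : Alg X) : R (sh p q) = sh (R p) (R q) := by
  have key : ∀ p, ∃ n, ∀ m ≥ n, (D ^ m) p = 0 ∧
      R p = ∑ i ∈ Finset.range m, (-1 : ℚ) ^ i • sh ((D ^ i) p) (e x ^ i) := by
    refine word_induction ?_ hR ?_ ?_
    · exact ⟨0, by simp⟩
    · rintro p q ⟨a, ha⟩ ⟨b, hb⟩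
      refine ⟨max a b, fun m hm => ?_⟩
      obtain ⟨h1, h2⟩ := ha m (le_trans (le_max_left _ _) hm)
      obtain ⟨h3, h4⟩ := hb m (le_trans (le_max_right _ _) hm)
      refine ⟨by rw [map_add, h1, h3, add_zero], ?_⟩
      rw [map_add, h2, h4, ← Finset.sum_add_distrib]
      simp
    · rintro c p ⟨a, ha⟩
      refine ⟨a, fun m hm => ?_⟩
      obtain ⟨h1, h2⟩ := ha m hm
      refine ⟨by rw [map_smul, h1, smul_zero], ?_⟩
      rw [map_smul, h2, Finset.smul_sum]
      refine Finset.sum_congr rfl fun i _ => ?_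
      rw [map_smul, map_smul, LinearMap.smul_apply, smul_comm]
  refine reg_mul_aux x D R hD (fun p => ?_) (fun p n hn => ?_) p q
  · obtain ⟨n, hn⟩ := key p
    exact ⟨n, fun m hm => (hn m hm).1⟩
  · obtain ⟨n', hn'⟩ := key p
    rw [(hn' _ (le_max_right n n')).2]
    symm
    refine Finset.sum_subset (by simp) fun i _ hi => ?_
    rw [hn i (by simpa using hi)]
    simp

/-- Stripping an initial `x` off words. -/
def stripLeft {X : Type} [DecidableEq X] (x : X) : Alg X →ₗ[ℚ] Alg X :=
  linExt fun
    | [] => 0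
    | a :: w => if a = x then word w else 0

theorem stripLeft_cons {X : Type} [DecidableEq X] (x a : X) (p : Alg X) :
    stripLeft x (e a * p) = if a = x then p else 0 := by
  have : stripLeft x ∘ₗ LinearMap.mulLeft ℚ (e a) = if a = x then LinearMap.id else 0 := by
    refine ext_word fun w => ?_
    simp only [LinearMap.comp_apply, LinearMap.mulLeft_apply, ← word_cons]
    rw [stripLeft, linExt_word]
    by_cases h : a = x <;> simp [h]
  have := LinearMap.congr_fun this p
  split_ifs at this ⊢ <;> exact this

theorem stripLeft_one {X : Type} [DecidableEq X] (x : X) : stripLeft x 1 = 0 := by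
  rw [← word_nil, stripLeft, linExt_word]

/-- Stripping a final `x` off words. -/
def stripRight {X : Type} [DecidableEq X] (x : X) : Alg X →ₗ[ℚ] Alg X :=
  linExt fun w => if w.getLast? = some x then word w.dropLast else 0

theorem stripRight_one {X : Type} [DecidableEq X] (x : X) : stripRight x 1 = 0 := by
  rw [← word_nil, stripRight, linExt_word]; simp

/-- The constant term. -/
def constTerm (X : Type) : Alg X →ₐ[ℚ] ℚ := FreeAlgebra.lift ℚ fun _ => 0

theorem constTerm_cons {X : Type} (a : X) (p : Alg X) : constTerm X (e a * p) = 0 := by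
  simp [constTerm]

theorem stripRight_cons {X : Type} [DecidableEq X] (x a : X) (p : Alg X) :
    stripRight x (e a * p) = e a * stripRight x p + if a = x then constTerm X p • 1 else 0 := by
  have : stripRight x ∘ₗ LinearMap.mulLeft ℚ (e a) = LinearMap.mulLeft ℚ (e a) ∘ₗ stripRight x
      + if a = x then (LinearMap.toSpanSingleton ℚ (Alg X) 1) ∘ₗ (constTerm X).toLinearMap
        else 0 := by
    refine ext_word fun w => ?_
    simp only [LinearMap.comp_apply, LinearMap.mulLeft_apply, ← word_cons, LinearMap.add_apply]
    rw [stripRight, linExt_word, linExt_word]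
    cases w with
    | nil => by_cases h : a = x <;> simp [h, word_nil]
    | cons b w =>
      rw [List.getLast?_cons_cons, List.dropLast_cons_cons]
      have : (if a = x then (LinearMap.toSpanSingleton ℚ (Alg X) 1) ∘ₗ (constTerm X).toLinearMap
        else 0) (word (b :: w)) = 0 := by
        split_ifs
        · simp [word_cons, constTerm]
        · simp
      rw [this, add_zero]
      split_ifs
      · rw [word_cons]
      · simp
  have := LinearMap.congr_fun this p
  split_ifs at this ⊢ <;> simpa using this

theorem stripLeft_leibniz {X : Type} [DecidableEq X] (x : X) (p q : Alg X) :
    stripLeft x (sh p q) = sh (stripLeft x p) q + sh p (stripLeft x q) := by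
  have hw : ∀ u v : List X, stripLeft x (sh (word u) (word v))
      = sh (stripLeft x (word u)) (word v) + sh (word u) (stripLeft x (word v)) := by
    intro u v
    rcases u with _ | ⟨a, u⟩
    · simp [word_nil, sh_one_left, stripLeft_one]
    rcases v with _ | ⟨b, v⟩
    · simp [word_nil, sh_one_right, stripLeft_one]
    rw [word_cons, word_cons, sh_cons, map_add, stripLeft_cons, stripLeft_cons, stripLeft_cons,
      stripLeft_cons]
    split_ifs <;> simp
  refine word_induction (P := fun p => stripLeft x (sh p q) = sh (stripLeft x p) q
    + sh p (stripLeft x q)) (by simp) (fun u => ?_) ?_ ?_ p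
  · refine word_induction (P := fun q => stripLeft x (sh (word u) q) = sh (stripLeft x (word u)) q
      + sh (word u) (stripLeft x q)) (by simp) (hw u) ?_ ?_ q
    · intro p q hp hq; simp only [map_add, hp, hq]; abel
    · intro c p hp; simp only [map_smul, hp, smul_add]
  · intro p q hp hq; simp only [map_add, LinearMap.add_apply, hp, hq]; abel
  · intro c p hp; simp only [map_smul, LinearMap.smul_apply, hp, smul_add]

theorem stripRight_leibniz {X : Type} [DecidableEq X] (x : X) (p q : Alg X) :
    stripRight x (sh p q) = sh (stripRight x p) q + sh p (stripRight x q) := by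
  have hw : ∀ n, ∀ u v : List X, u.length + v.length = n → stripRight x (sh (word u) (word v))
      = sh (stripRight x (word u)) (word v) + sh (word u) (stripRight x (word v)) := by
    intro n
    induction n with
    | zero =>
      intro u v h
      obtain ⟨rfl, rfl⟩ : u = [] ∧ v = [] := by simpa using h
      simp [word_nil, sh_one_left, stripRight_one]
    | succ n ih =>
      intro u v h
      rcases u with _ | ⟨a, u⟩
      · simp [word_nil, sh_one_left, stripRight_one]
      rcases v with _ | ⟨b, v⟩
      · simp [word_nil, sh_one_right, stripRight_one]
      simp only [List.length_cons] at h
      have h1 := ih u (b :: v) (by simp; omega)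
      have h2 := ih (a :: u) v (by simp; omega)
      have c1 : constTerm X (sh (word u) (e b * word v)) = 0 := by
        cases u with
        | nil => rw [word_nil, sh_one_left, constTerm_cons]
        | cons c u => rw [word_cons, sh_cons, map_add, constTerm_cons, constTerm_cons, add_zero]
      have c2 : constTerm X (sh (e a * word u) (word v)) = 0 := by
        cases v with
        | nil => rw [word_nil, sh_one_right, constTerm_cons]
        | cons c v => rw [word_cons, sh_cons, map_add, constTerm_cons, constTerm_cons, add_zero]
      simp only [word_cons] at h1 h2 ⊢
      rw [sh_cons, map_add, stripRight_cons, stripRight_cons x b, h1, h2, c1, c2,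
        stripRight_cons, stripRight_cons]
      split_ifs <;> simp [sh_cons, sh_one_left, sh_one_right, mul_add] <;> abel
  refine word_induction (P := fun p => stripRight x (sh p q) = sh (stripRight x p) q
    + sh p (stripRight x q)) (by simp) (fun u => ?_) ?_ ?_ p
  · refine word_induction (P := fun q => stripRight x (sh (word u) q)
      = sh (stripRight x (word u)) q + sh (word u) (stripRight x q)) (by simp)
      (fun v => hw _ u v rfl) ?_ ?_ q
    · intro p q hp hq; simp only [map_add, hp, hq]; abel
    · intro c p hp; simp only [map_smul, hp, smul_add]
  · intro p q hp hq; simp only [map_add, LinearMap.add_apply, hp, hq]; abel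
  · intro c p hp; simp only [map_smul, LinearMap.smul_apply, hp, smul_add]

theorem stripLeft_pow {X : Type} [DecidableEq X] (x : X) (i : ℕ) (w : List X) :
    (stripLeft x ^ i) (word w) = if w.take i = List.replicate i x then word (w.drop i) else 0 := by
  induction i generalizing w with
  | zero => simp
  | succ i ih =>
    rw [pow_succ, Module.End.mul_apply]
    cases w with
    | nil => simp [word_nil, stripLeft_one, List.replicate_succ]
    | cons a w =>
      rw [word_cons, stripLeft_cons, List.take_succ_cons, List.replicate_succ, List.drop_succ_cons]
      by_cases h : a = x
      · simp [h, ih]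
      · simp [h]

theorem stripRight_pow {X : Type} [DecidableEq X] (x : X) (i : ℕ) (w : List X) :
    (stripRight x ^ i) (word w) = if i ≤ w.length ∧ w.drop (w.length - i) = List.replicate i x then
      word (w.take (w.length - i)) else 0 := by
  induction i generalizing w with
  | zero => simp
  | succ i ih =>
    rw [pow_succ, Module.End.mul_apply]
    rcases List.eq_nil_or_concat w with rfl | ⟨m, b, rfl⟩
    · simp [word_nil, stripRight_one]
    · have h0 : stripRight x (word (m ++ [b])) = if b = x then word m else 0 := by
        rw [stripRight, linExt_word]; simp
      rw [List.concat_eq_append, h0]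
      by_cases hi : i ≤ m.length
      · have e1 : (m ++ [b]).drop (m.length - i) = m.drop (m.length - i) ++ [b] := by
          rw [List.drop_append_of_le_length (by omega)]
        have e2 : (m ++ [b]).take (m.length - i) = m.take (m.length - i) := by
          rw [List.take_append_of_le_length (by omega)]
        have e3 : (m ++ [b]).length - (i + 1) = m.length - i := by simp
        rw [e3, e1, e2, List.replicate_succ']
        by_cases h : b = x
        · simp [h, ih, hi]
        · simp [h]
      · by_cases h : b = x <;> simp [h, ih, hi]

theorem regLeft_sh {X : Type} [DecidableEq X] (x : X) (p q : Alg X) :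
    regLeft x (sh p q) = sh (regLeft x p) (regLeft x q) := by
  refine reg_mul x (stripLeft x) (regLeft x) (stripLeft_leibniz x)
    (fun w => ⟨w.length + 1, fun m hm => ?_⟩) p q
  have h0 : ∀ i ≥ w.length + 1, (stripLeft x ^ i) (word w) = 0 := by
    intro i hi
    rw [stripLeft_pow, if_neg]
    intro h
    have := congrArg List.length h
    simp at this
    omega
  refine ⟨h0 m hm, ?_⟩
  rw [regLeft, linExt_word]
  symm
  rw [← Finset.sum_subset (Finset.range_subset_range.2 hm)
    (fun i _ hi => by rw [h0 i (by simpa using hi)]; simp)]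
  refine Finset.sum_congr rfl fun i _ => ?_
  rw [stripLeft_pow, word_replicate]
  split_ifs <;> simp

theorem regRight_sh {X : Type} [DecidableEq X] (x : X) (p q : Alg X) :
    regRight x (sh p q) = sh (regRight x p) (regRight x q) := by
  refine reg_mul x (stripRight x) (regRight x) (stripRight_leibniz x)
    (fun w => ⟨w.length + 1, fun m hm => ?_⟩) p q
  have h0 : ∀ i ≥ w.length + 1, (stripRight x ^ i) (word w) = 0 := by
    intro i hi
    rw [stripRight_pow, if_neg]
    rintro ⟨h, -⟩
    omega
  refine ⟨h0 m hm, ?_⟩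
  rw [regRight, linExt_word]
  symm
  rw [← Finset.sum_subset (Finset.range_subset_range.2 hm)
    (fun i _ hi => by rw [h0 i (by simpa using hi)]; simp)]
  refine Finset.sum_congr rfl fun i hi => ?_
  have hi : i ≤ w.length := by simpa [Nat.lt_succ_iff] using hi
  rw [stripRight_pow, word_replicate]
  simp only [hi, true_and]
  split_ifs <;> simp

/-- `regSh` is a homomorphism for the shuffle product. -/
theorem regSh_sh {X : Type} [DecidableEq X] (x₀ x₁ : X) (p q : Alg X) :
    regSh x₀ x₁ (sh p q) = sh (regSh x₀ x₁ p) (regSh x₀ x₁ q) := by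
  simp only [regSh, LinearMap.comp_apply, regRight_sh, regLeft_sh]

/-- `regSh` fixes the admissible words. -/
theorem regSh_word {X : Type} [DecidableEq X] (x₀ x₁ : X) (w : List X)
    (h₀ : w.head? ≠ some x₀) (h₁ : w.getLast? ≠ some x₁) : regSh x₀ x₁ (word w) = word w := by
  have hR : regRight x₁ (word w) = word w := by
    rw [regRight, linExt_word, Finset.sum_eq_single 0]
    · simp [word_nil, sh_one_right]
    · intro i hi hne
      rw [if_neg]
      intro h
      apply h₁
      have hi : i ≤ w.length := by simpa [Nat.lt_succ_iff] using hi
      obtain ⟨j, rfl⟩ := Nat.exists_eq_succ_of_ne_zero hne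
      rw [← List.take_append_drop (w.length - (j + 1)) w, h, List.replicate_succ',
        ← List.append_assoc]
      simp
    · simp
  have hL : regLeft x₀ (word w) = word w := by
    rw [regLeft, linExt_word, Finset.sum_eq_single 0]
    · simp [word_nil, sh_one_right]
    · intro i hi hne
      rw [if_neg]
      intro h
      apply h₀
      obtain ⟨j, rfl⟩ := Nat.exists_eq_succ_of_ne_zero hne
      rw [← List.take_append_drop (j + 1) w, h, List.replicate_succ]
      simp
    · simp
  rw [regSh, LinearMap.comp_apply, hR, hL]

/-- `regSh` kills `e_{x₀}` and `e_{x₁}`. -/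
theorem regSh_letters {X : Type} [DecidableEq X] (x₀ x₁ : X) :
    regSh x₀ x₁ (word [x₀]) = 0 ∧ regSh x₀ x₁ (word [x₁]) = 0 := by
  have hR : regRight x₁ (word [x₁]) = 0 := by
    rw [regRight, linExt_word]
    simp [Finset.sum_range_succ, word_nil, sh_one_right, sh_one_left]
  have hL : regLeft x₀ (word [x₀]) = 0 := by
    rw [regLeft, linExt_word]
    simp [Finset.sum_range_succ, word_nil, sh_one_right, sh_one_left]
  refine ⟨?_, by rw [regSh, LinearMap.comp_apply, hR, map_zero]⟩
  by_cases h : x₀ = x₁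
  · subst h; rw [regSh, LinearMap.comp_apply, hR, map_zero]
  · have : regRight x₁ (word [x₀]) = word [x₀] := by
      rw [regRight, linExt_word]
      simp [Finset.sum_range_succ, word_nil, sh_one_right, h]
    rw [regSh, LinearMap.comp_apply, this, hL]

/-- The defining property of `℘`. -/
theorem wp_varrho_wstar (k : List ℕ+) : wp (varrho (wstar k)) = theta1 k := by
  cases k with
  | nil =>
    have h1 : wp (word []) = 1 := by rw [wp, linExt_word]
    have h2 : reg01 (word []) = word [] := regSh_word _ _ _ (by simp) (by simp)
    rw [word_nil] at h1 h2
    simp [wstar, h1, h2, theta1, theta', theta]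
  | cons k ks => rw [toXY_aux, wp_one_mul, toXY_word, linExt_word, index_aux]

end Confluence

end

/-!
Every `h ∈ PENT(2, k)` satisfies the confluence relations. The proof is algebraic: the mixed pentagon
equation is evaluated at suitable elements of endomorphism algebras.

**The pentagon equation in an algebra.** Elements of an associative algebra which satisfy the relations
of `𝔱⁰_{4,2}` (`Rep`), each multiplied by a central variable of degree one, define a homomorphism from
the enveloping algebra modulo powers of its augmentation ideal to truncated power series. Hence the
mixed pentagon equation holds for the values of `h` at these elements (`Rep.mixedPentagon`,
`Rep.pentagon`). As `h` is group-like, its values are multiplicative in commuting arguments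
(`hval_add`). Very simple solutions of the relations already yield that `h` vanishes at the powers of
`e⁰` and of `e¹`, the duality of `δ(h)`, the distribution relation (`hval_dist`) and the identity
`hval_pp`. With two solutions built from letters and deletion operators (`delOp`), whose commutators
with letters are combinations of commutators of letters, one obtains the reflection equation
`hval_reflection`, an analogue of the duality for `h` itself. It is an identity in the free algebra, as
this algebra acts faithfully on series, and therefore holds everywhere.

**From `z = 1` to `z = 0`.** The letters `0, z, -1, -z²`, acting on series by multiplication, and the
transposes of `∂₀, ∂₁, ∂₋₁` (`partialOp`), which are deletion operators, satisfy the commutator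
relations of `confluence_of_lie'`. This identity is one more instance of the pentagon equation,
simplified by the reflection equation. Applied to the series `1`, it says that the value of `h` at
`u|_{z → 1}` is the sum of the coefficients of `h` at the words `c₁ ⋯ c_l`, times the values of the
series `δ(h)(e₀ + e_{-z²}, e_z) δ(h)(e₀, -e₀ - e_{-z²})` at `∂_{c₁} ⋯ ∂_{c_l} u` (`pairing_atOne`). This
is the shape of the definition of `φ`. What remains is to see that on `ℬ` this connecting series is
`⟨h, reg_{z → 0} u⟩` (`pairing_connectionSeries_eq`): its second factor is `⟨δ(h), ϱ(ε(v))⟩`, its first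
factor `⟨δ(h), ū⟩`, and `⟨δ(h), ū⟩ = ⟨h, dist(ū)⟩` by the distribution relation (`pairing_dist`), so that
only the map `℘` is left.

**The map `℘`.** One needs `⟨h, ℘(x)⟩ = ⟨δ(h), ϱ(x)⟩` (`pairing_wp`), that is
`⟨h, θ₁(κ)⟩ = ⟨δ(h), w⋆(κ)⟩` for all indices `κ`. The pentagon equation for a solution by operators on
triples (`triplesRep`) gives a recursion for `⟨δ(h), w⋆(κ)⟩`, valid for `κ ≠ (1, …, 1)`
(`delta_snoc_one`, `wstarValue_recursion`). Up to an inhomogeneous term it is the recursion which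
defines `θ`. The inhomogeneous term consists of the values at `w⋆(1, …, 1)`, which follow from `hval_pp`
(`starValue_replicate`): they vanish for an odd number of ones, and for `2m` ones are twice the value at
`e₋₁ e₀^{2m-1}`, the correction in the definition of `θ₁`.
-/

open scoped TensorProduct

noncomputable section

namespace Confluence

attribute [local instance] LieRing.ofAssociativeRing

/-! ### Solutions of the relations of `𝔱⁰_{4,2}` in an algebra -/

/-- The part of degree `n` of the value `h(A)` of a power series at elements `A` of an algebra. -/
def evc {k R : Type*} [CommRing k] [Ring R] [Algebra k R] {X : Type} [Fintype X] (A : X → R) :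
    ℕ → NCSeries k X → R
  | 0, h => algebraMap k R (h [])
  | n + 1, h => ∑ x, A x * evc A n (fun w => h (x :: w))

theorem evc_eq_sum {k R : Type*} [CommRing k] [Ring R] [Algebra k R] {X : Type} [Fintype X]
    (A : X → R) (n : ℕ) (h : NCSeries k X) :
    evc A n h = ∑ w : Fin n → X, h (List.ofFn w) • (List.ofFn fun i => A (w i)).prod := by
  induction n generalizing h with
  | zero => simp [evc, Algebra.algebraMap_eq_smul_one]
  | succ n ih =>
    rw [← (Fin.consEquiv (fun _ => X)).sum_comp, Fintype.sum_prod_type, evc]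
    refine Finset.sum_congr rfl fun x _ => ?_
    rw [ih, Finset.mul_sum]
    refine Finset.sum_congr rfl fun w _ => ?_
    simp [Fin.consEquiv, List.ofFn_succ]

/-- The value `h(A)` of a power series at elements `A` of an algebra, its part of degree `n` being
marked by the `n`-th power of the central variable. -/
def ev {k R : Type*} [CommRing k] [Ring R] [Algebra k R] {X : Type} [Fintype X]
    (h : NCSeries k X) (A : X → R) : PowerSeries R := PowerSeries.mk fun n => evc A n h

/-- Elements of an algebra which satisfy the relations of the generators `t^{1j}`, `t^{ij} =
t(0)^{ij}` and `u^{ij} = t(1)^{ij}` of `𝔱⁰_{4,2}`. As `-a = a` in `ℤ/2ℤ`, one pair `i < j` of each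
kind suffices. The elements default to `0` and the relations to a proof by `noncomm_ring`, so that a
solution is given by its nonzero elements and the relations which are not ring identities. -/
structure Rep (R : Type*) [Ring R] where
  t12 : R := 0
  t13 : R := 0
  t23 : R := 0
  u23 : R := 0
  t24 : R := 0
  u24 : R := 0
  t34 : R := 0
  u34 : R := 0
  tri1 : Commute t23 (t24 + t34) := by change _ * _ = _ * _; noncomm_ring
  tri2 : Commute t23 (u24 + u34) := by change _ * _ = _ * _; noncomm_ring
  tri3 : Commute u23 (u24 + t34) := by change _ * _ = _ * _; noncomm_ring
  tri4 : Commute u23 (t24 + u34) := by change _ * _ = _ * _; noncomm_ring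
  tri5 : Commute t24 (t23 + t34) := by change _ * _ = _ * _; noncomm_ring
  tri6 : Commute t24 (u23 + u34) := by change _ * _ = _ * _; noncomm_ring
  tri7 : Commute u24 (u23 + t34) := by change _ * _ = _ * _; noncomm_ring
  tri8 : Commute u24 (t23 + u34) := by change _ * _ = _ * _; noncomm_ring
  tri9 : Commute t34 (t23 + t24) := by change _ * _ = _ * _; noncomm_ring
  tri10 : Commute t34 (u23 + u24) := by change _ * _ = _ * _; noncomm_ring
  tri11 : Commute u34 (u23 + t24) := by change _ * _ = _ * _; noncomm_ring
  tri12 : Commute u34 (t23 + u24) := by change _ * _ = _ * _; noncomm_ring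
  cen1 : Commute (t12 + t13 + (t23 + u23)) t23 := by change _ * _ = _ * _; noncomm_ring
  cen2 : Commute (t12 + t13 + (t23 + u23)) u23 := by change _ * _ = _ * _; noncomm_ring
  pole1 : Commute t12 (t13 + (t23 + u23)) := by change _ * _ = _ * _; noncomm_ring
  pole2 : Commute t13 (t12 + (t23 + u23)) := by change _ * _ = _ * _; noncomm_ring
  dis1 : Commute t12 t34 := by change _ * _ = _ * _; noncomm_ring
  dis2 : Commute t12 u34 := by change _ * _ = _ * _; noncomm_ring
  dis3 : Commute t13 t24 := by change _ * _ = _ * _; noncomm_ring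
  dis4 : Commute t13 u24 := by change _ * _ = _ * _; noncomm_ring

/-- The images of the generators. -/
def Rep.gen {R : Type*} [Ring R] (r : Rep R) : Gen 2 → R
  | .t1 .two _ => r.t12
  | .t1 .three _ => r.t13
  | .t1 .four _ => 0
  | .t a .two .three _ => if a = 0 then r.t23 else r.u23
  | .t a .three .two _ => if a = 0 then r.t23 else r.u23
  | .t a .two .four _ => if a = 0 then r.t24 else r.u24
  | .t a .four .two _ => if a = 0 then r.t24 else r.u24
  | .t a .three .four _ => if a = 0 then r.t34 else r.u34
  | .t a .four .three _ => if a = 0 then r.t34 else r.u34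
  | .t _ .two .two _ => 0
  | .t _ .three .three _ => 0
  | .t _ .four .four _ => 0

/-- The homomorphism from the free Lie algebra which maps each generator to its image times the
central variable. -/
def Rep.freeHom (k : Type*) {R : Type*} [CommRing k] [Ring R] [Algebra k R] (r : Rep R) :
    FreeLieAlgebra k (Gen 2) →ₗ⁅k⁆ PowerSeries R :=
  FreeLieAlgebra.lift k fun g => PowerSeries.monomial 1 (r.gen g)

theorem Rep.freeHom_of (k : Type*) {R : Type*} [CommRing k] [Ring R] [Algebra k R] (r : Rep R)
    (g : Gen 2) : r.freeHom k (FreeLieAlgebra.of k g) = PowerSeries.monomial 1 (r.gen g) := by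
  simp [Rep.freeHom]

theorem bracket_monomial_of_commute {R : Type*} [Ring R] {x y : R} (h : Commute x y) :
    ⁅PowerSeries.monomial 1 x, PowerSeries.monomial 1 y⁆ = 0 := by
  rw [LieRing.of_associative_ring_bracket, PowerSeries.monomial_mul_monomial,
    PowerSeries.monomial_mul_monomial, h.eq, sub_self]

theorem sum_zmod_two {M : Type*} [AddCommMonoid M] (f : ZMod 2 → M) : ∑ c, f c = f 0 + f 1 :=
  Fin.sum_univ_two f

theorem zmod_two_cases {P : ZMod 2 → Prop} (h0 : P 0) (h1 : P 1) (a : ZMod 2) : P a := by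
  have : a = 0 ∨ a = 1 := by revert a; decide
  rcases this with rfl | rfl <;> assumption

theorem Rep.freeHom_relator (k : Type*) {R : Type*} [CommRing k] [Ring R] [Algebra k R]
    (r : Rep R) {x : FreeLieAlgebra k (Gen 2)} (hx : Relator k 2 x) : r.freeHom k x = 0 := by
  have e1 : (1 : ZMod 2) + 1 = 0 := by decide
  cases hx with
  | symm a i j hij =>
    rw [map_sub, r.freeHom_of k, r.freeHom_of k, sub_eq_zero]
    congr 1
    induction a using zmod_two_cases <;> cases i <;> cases j <;> rfl
  | triangle a b i j l hij hil hjl =>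
    rw [LieHom.map_lie, map_add, r.freeHom_of k, r.freeHom_of k, r.freeHom_of k, ← map_add]
    refine bracket_monomial_of_commute ?_
    have c1 := r.tri1
    have c2 := r.tri2
    have c3 := r.tri3
    have c4 := r.tri4
    have c5 := r.tri5
    have c6 := r.tri6
    have c7 := r.tri7
    have c8 := r.tri8
    have c9 := r.tri9
    have c10 := r.tri10
    have c11 := r.tri11
    have c12 := r.tri12
    induction a using zmod_two_cases <;> induction b using zmod_two_cases <;> cases i <;>
      cases j <;> (try contradiction) <;> cases l <;> (try contradiction) <;>
      simp only [zero_add, add_zero, e1, Rep.gen, if_true, one_ne_zero, if_false] <;>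
      first | assumption | (rw [add_comm]; assumption)
  | central a i j hi hj hij =>
    rw [LieHom.map_lie, map_add, map_add, map_sum]
    simp only [Rep.freeHom_of, sum_zmod_two]
    rw [← map_add, ← map_add, ← map_add]
    refine bracket_monomial_of_commute ?_
    have c1 := r.cen1
    have c2 := r.cen2
    induction a using zmod_two_cases <;> cases i <;>
      cases j <;> (try contradiction) <;> simp only [Rep.gen, if_true, one_ne_zero, if_false] <;>
      first | assumption | (rw [add_comm r.t13]; assumption)
  | pole i j hi hj hij =>
    rw [LieHom.map_lie, map_add, map_sum]
    simp only [Rep.freeHom_of, sum_zmod_two]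
    rw [← map_add, ← map_add]
    refine bracket_monomial_of_commute ?_
    have c1 := r.pole1
    have c2 := r.pole2
    cases i <;> cases j <;> (try contradiction) <;>
      simp only [Rep.gen, if_true, one_ne_zero, if_false] <;> assumption
  | disjoint a i j l hi hij hil hjl =>
    rw [LieHom.map_lie, r.freeHom_of k, r.freeHom_of k]
    refine bracket_monomial_of_commute ?_
    have c1 := r.dis1
    have c2 := r.dis2
    have c3 := r.dis3
    have c4 := r.dis4
    induction a using zmod_two_cases <;> cases i <;>
      cases j <;> (try contradiction) <;> cases l <;> (try contradiction) <;>
      simp only [Rep.gen, if_true, one_ne_zero, if_false] <;> assumption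

theorem Rep.freeHom_relIdeal (k : Type*) {R : Type*} [CommRing k] [Ring R] [Algebra k R]
    (r : Rep R) {x : FreeLieAlgebra k (Gen 2)} (hx : x ∈ relIdeal k 2) : r.freeHom k x = 0 := by
  have : relIdeal k 2 ≤ (r.freeHom k).ker :=
    LieSubmodule.lieSpan_le.2 fun y hy => (r.freeHom k).mem_ker.2 (r.freeHom_relator k hy)
  exact (r.freeHom k).mem_ker.1 (this hx)

/-- The homomorphism on `𝔱⁰_{4,2}` which maps each generator to its image times the
central variable. -/
def Rep.hom (k : Type*) {R : Type*} [CommRing k] [Ring R] [Algebra k R] (r : Rep R) :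
    T4 k 2 →ₗ⁅k⁆ PowerSeries R :=
  { (relIdeal k 2).toSubmodule.liftQ (r.freeHom k : FreeLieAlgebra k (Gen 2) →ₗ[k] PowerSeries R)
      (fun _ hx => r.freeHom_relIdeal k hx) with
    map_lie' := by
      intro x y
      obtain ⟨x, rfl⟩ := Submodule.Quotient.mk_surjective _ x
      obtain ⟨y, rfl⟩ := Submodule.Quotient.mk_surjective _ y
      exact (r.freeHom k).map_lie x y }

/-- The Lie algebra is mapped to series without constant term; hence products of `m` of its elements
vanish modulo the `m`-th power of the variable. -/
theorem Rep.constantCoeff_hom (k : Type*) {R : Type*} [CommRing k] [Ring R] [Algebra k R]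
    (r : Rep R) (x : T4 k 2) : PowerSeries.constantCoeff (r.hom k x) = 0 := by
  obtain ⟨x, rfl⟩ := Submodule.Quotient.mk_surjective _ x
  let c : PowerSeries R →ₗ⁅k⁆ R :=
    { toFun := fun f => PowerSeries.constantCoeff f
      map_add' := map_add _
      map_smul' := fun a f => by simp
      map_lie' := fun {f g} => by simp [LieRing.of_associative_ring_bracket] }
  have : c.comp (r.freeHom k) = 0 := by
    ext g
    change PowerSeries.constantCoeff (r.freeHom k (FreeLieAlgebra.of k g)) = 0
    rw [r.freeHom_of k]
    simp [← PowerSeries.coeff_zero_eq_constantCoeff_apply, PowerSeries.coeff_monomial]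
  exact LieHom.congr_fun this x

/-- Congruence of power series modulo the `m`-th power of the variable. -/
def truncCon (R : Type*) [Ring R] (m : ℕ) : RingCon (PowerSeries R) where
  r f g := ∀ n < m, PowerSeries.coeff n f = PowerSeries.coeff n g
  iseqv := ⟨fun _ _ _ => rfl, fun h n hn => (h n hn).symm,
    fun h h' n hn => (h n hn).trans (h' n hn)⟩
  add' := fun h h' n hn => by rw [map_add, map_add, h n hn, h' n hn]
  mul' := fun h h' n hn => by
    rw [PowerSeries.coeff_mul, PowerSeries.coeff_mul]
    refine Finset.sum_congr rfl fun p hp => ?_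
    rw [Finset.HasAntidiagonal.mem_antidiagonal] at hp
    rw [h p.1 (by omega), h' p.2 (by omega)]

theorem coeff_list_prod_eq_zero {R : Type*} [Ring R] (l : List (PowerSeries R))
    (hl : ∀ f ∈ l, PowerSeries.constantCoeff f = 0) (n : ℕ) (hn : n < l.length) :
    PowerSeries.coeff n l.prod = 0 := by
  induction l generalizing n with
  | nil => simp at hn
  | cons f l ih =>
    rw [List.prod_cons, PowerSeries.coeff_mul]
    refine Finset.sum_eq_zero fun p hp => ?_
    rw [Finset.HasAntidiagonal.mem_antidiagonal] at hp
    rcases Nat.eq_zero_or_pos p.1 with h0 | h0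
    · rw [h0, PowerSeries.coeff_zero_eq_constantCoeff_apply, hl f (by simp), zero_mul]
    · rw [ih (fun g hg => hl g (by simp [hg])) p.2 (by simp at hn; omega), mul_zero]

/-- The homomorphism on the enveloping algebra modulo the `m`-th power of the augmentation ideal
induced by `Rep.hom`. -/
def Rep.truncHom (k : Type*) {R : Type*} [CommRing k] [Ring R] [Algebra k R] (r : Rep R) (m : ℕ) :
    UTrunc k 2 m →ₐ[k] (truncCon R m).Quotient :=
  RingQuot.liftAlgHom k ⟨((truncCon R m).mkₐ k).comp (UniversalEnvelopingAlgebra.lift k (r.hom k)),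
    by
      rintro _ _ ⟨x⟩
      rw [map_zero, AlgHom.comp_apply, ← map_zero ((truncCon R m).mkₐ k)]
      refine (RingCon.eq _).2 fun n hn => ?_
      rw [map_list_prod, map_zero]
      refine coeff_list_prod_eq_zero _ ?_ n (by simpa using hn)
      intro f hf
      simp only [List.map_ofFn, List.mem_ofFn, Function.comp_apply,
        UniversalEnvelopingAlgebra.lift_ι_apply] at hf
      obtain ⟨i, rfl⟩ := hf
      exact r.constantCoeff_hom k _⟩

/-! ### The mixed pentagon equation in an algebra -/

theorem list_prod_monomial_one {R : Type*} [Ring R] (n : ℕ) (a : Fin n → R) :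
    (List.ofFn fun i => PowerSeries.monomial 1 (a i)).prod
      = PowerSeries.monomial n (List.ofFn a).prod := by
  induction n with
  | zero => simp [PowerSeries.monomial_zero_eq_C]
  | succ n ih =>
    rw [List.ofFn_succ, List.ofFn_succ, List.prod_cons, List.prod_cons, ih,
      PowerSeries.monomial_mul_monomial, add_comm]

theorem coeff_ev {k R : Type*} [CommRing k] [Ring R] [Algebra k R] {X : Type} [Fintype X]
    (h : NCSeries k X) (A : X → R) (n : ℕ) : PowerSeries.coeff n (ev h A) = evc A n h := by
  simp [ev]

theorem Rep.truncHom_substTrunc {k R : Type*} [CommRing k] [Ring R] [Algebra k R] (r : Rep R)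
    {X : Type} [Fintype X] (h : NCSeries k X) (A : X → T4 k 2) (A' : X → R)
    (hA : ∀ x, r.hom k (A x) = PowerSeries.monomial 1 (A' x)) (m : ℕ) :
    r.truncHom k m (substTrunc h A m) = (truncCon R m).mkₐ k (ev h A') := by
  have h1 : ∀ y, r.truncHom k m (toTrunc k 2 m (UniversalEnvelopingAlgebra.ι k y))
      = (truncCon R m).mkₐ k (r.hom k y) := fun y => by
    rw [toTrunc, Rep.truncHom, RingQuot.liftAlgHom_mkAlgHom_apply, AlgHom.comp_apply,
      UniversalEnvelopingAlgebra.lift_ι_apply]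
  have h2 : r.truncHom k m (substTrunc h A m)
      = (truncCon R m).mkₐ k (∑ n ∈ Finset.range m, PowerSeries.monomial n (evc A' n h)) := by
    rw [substTrunc, map_sum, map_sum]
    refine Finset.sum_congr rfl fun n _ => ?_
    rw [evc_eq_sum, map_sum, map_sum, map_sum]
    refine Finset.sum_congr rfl fun w _ => ?_
    rw [map_smul, map_list_prod, List.map_ofFn]
    simp only [Function.comp_def, h1, hA]
    have h3 : ∀ (c : k) (a : R), PowerSeries.monomial n (c • a)
        = c • PowerSeries.monomial n a := fun c a => by
      ext i; simp [PowerSeries.coeff_monomial]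
    rw [h3, map_smul, ← list_prod_monomial_one, map_list_prod, List.map_ofFn]
    rfl
  rw [h2]
  refine (RingCon.eq _).2 fun n hn => ?_
  rw [map_sum, coeff_ev, Finset.sum_eq_single n]
  · simp
  · intro i _ hi
    simp [PowerSeries.coeff_monomial, hi.symm]
  · simp [hn]

/-- The values of the variables `e⁰`, `e¹`, `e^{-1}`. -/
def trip {R : Type*} (a b c : R) : L3 → R
  | .zero => a
  | .one => b
  | .negOne => c

theorem sum_L01 {M : Type*} [AddCommMonoid M] (f : L01 → M) : ∑ x, f x = f .zero + f .one := by
  change ∑ x ∈ ({.zero, .one} : Finset L01), f x = _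
  simp

theorem sum_L3 {M : Type*} [AddCommMonoid M] (f : L3 → M) :
    ∑ x, f x = f .zero + f .one + f .negOne := by
  change ∑ x ∈ ({.zero, .one, .negOne} : Finset L3), f x = _
  simp [add_assoc]

theorem evc_delta {k R : Type*} [CommRing k] [Ring R] [Algebra k R] (a b : R) (n : ℕ)
    (h : NCSeries k L3) :
    evc (fun | .zero => a | .one => b : L01 → R) n (delta h) = evc (trip a b 0) n h := by
  induction n generalizing h with
  | zero => rfl
  | succ n ih =>
    rw [evc, evc, sum_L01, sum_L3]
    have h0 := ih (fun w => h (.zero :: w))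
    have h1 := ih (fun w => h (.one :: w))
    simp only [trip, zero_mul, add_zero, ← h0, ← h1]
    rfl

/-- The mixed pentagon equation holds for the values of `h` in any algebra with elements which
satisfy the relations of `𝔱⁰_{4,2}`. -/
theorem Rep.mixedPentagon {k R : Type*} [CommRing k] [Ring R] [Algebra k R] (r : Rep R)
    {h : NCSeries k L3} (hh : h ∈ PENT2 k) :
    ev h (trip r.t12 (r.t23 + r.t24) (r.u23 + r.u24))
        * ev h (trip (r.t13 + (r.t23 + r.u23)) r.t34 r.u34)
      = ev h (trip r.t23 r.t34 0)
        * ev h (trip (r.t12 + r.t13 + (r.t23 + r.u23)) (r.t24 + r.t34) (r.u24 + r.u34))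
        * ev h (trip r.t12 r.t23 r.u23) := by
  have hp := hh.2
  ext n
  have hn : substTrunc h (args (t1 k 2 .two)
        fun a => t k 2 a .two .three + t k 2 a .two .four) (n + 1)
      * substTrunc h (args (t1 k 2 .three + ∑ c : ZMod 2, t k 2 c .two .three)
        fun a => t k 2 a .three .four) (n + 1)
      = substTrunc (delta h) (fun | .zero => t k 2 0 .two .three | .one => t k 2 0 .three .four)
        (n + 1)
      * substTrunc h (args (t1 k 2 .two + t1 k 2 .three + ∑ c : ZMod 2, t k 2 c .two .three)
        fun a => t k 2 a .two .four + t k 2 a .three .four) (n + 1)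
      * substTrunc h (args (t1 k 2 .two) fun a => t k 2 a .two .three) (n + 1) :=
    congrFun (congrArg Subtype.val hp) (n + 1)
  replace hn := congrArg (r.truncHom k (n + 1)) hn
  have g1 : ∀ j hj, r.hom k (t1 k 2 j hj) = PowerSeries.monomial 1 (r.gen (.t1 j hj)) :=
    fun j hj => r.freeHom_of k _
  have g2 : ∀ a i j hij,
      r.hom k (t k 2 a i j hij) = PowerSeries.monomial 1 (r.gen (.t a i j hij)) :=
    fun a i j hij => r.freeHom_of k _
  rw [map_mul, map_mul, map_mul,
    r.truncHom_substTrunc _ _ (trip r.t12 (r.t23 + r.t24) (r.u23 + r.u24)) (by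
      rintro (_ | _ | _) <;>
        simp only [args, trip, map_add, g1, g2, Rep.gen, if_true, one_ne_zero, if_false]),
    r.truncHom_substTrunc _ _ (trip (r.t13 + (r.t23 + r.u23)) r.t34 r.u34) (by
      rintro (_ | _ | _) <;>
        simp only [args, trip, map_add, sum_zmod_two, g1, g2, Rep.gen, if_true,
          one_ne_zero, if_false]),
    r.truncHom_substTrunc _ _
      (trip (r.t12 + r.t13 + (r.t23 + r.u23)) (r.t24 + r.t34) (r.u24 + r.u34)) (by
      rintro (_ | _ | _) <;>
        simp only [args, trip, map_add, sum_zmod_two, g1, g2, Rep.gen, if_true,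
          one_ne_zero, if_false]),
    r.truncHom_substTrunc _ _ (trip r.t12 r.t23 r.u23) (by
      rintro (_ | _ | _) <;>
        simp only [args, trip, g1, g2, Rep.gen, if_true, one_ne_zero, if_false]),
    r.truncHom_substTrunc _ _ (fun | .zero => r.t23 | .one => r.t34) (by
      rintro (_ | _) <;> simp only [g2, Rep.gen, if_true]),
    ← map_mul, ← map_mul, ← map_mul] at hn
  have hd : ev (delta h) (fun | .zero => r.t23 | .one => r.t34 : L01 → R)
      = ev h (trip r.t23 r.t34 0) := by
    ext n
    rw [coeff_ev, coeff_ev, evc_delta]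
  rw [hd] at hn
  exact (RingCon.eq _).1 hn n (Nat.lt_succ_self n)

/-! ### Group-like series at commuting sums -/

theorem sum_words_succ {X : Type} [Fintype X] {M : Type*} [AddCommMonoid M] (n : ℕ)
    (F : List X → M) :
    ∑ w : Fin (n + 1) → X, F (List.ofFn w) = ∑ x, ∑ w : Fin n → X, F (x :: List.ofFn w) := by
  rw [← (Fin.consEquiv (fun _ => X)).sum_comp, Fintype.sum_prod_type]
  simp [Fin.consEquiv, List.ofFn_succ]

theorem evc_eq_sum_map {k R : Type*} [CommRing k] [Ring R] [Algebra k R] {X : Type} [Fintype X]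
    (A : X → R) (n : ℕ) (h : NCSeries k X) :
    evc A n h = ∑ w : Fin n → X, h (List.ofFn w) • ((List.ofFn w).map A).prod := by
  simp [evc_eq_sum, List.map_ofFn, Function.comp_def]

theorem map_evc {k R R' : Type*} [CommRing k] [Ring R] [Algebra k R] [Ring R'] [Algebra k R']
    {X : Type} [Fintype X] (φ : R →ₐ[k] R') (A : X → R) (n : ℕ) (h : NCSeries k X) :
    φ (evc A n h) = evc (fun x => φ (A x)) n h := by
  induction n generalizing h with
  | zero => simp [evc]
  | succ n ih => simp [evc, ih]

theorem evc_commute {k R : Type*} [CommRing k] [Ring R] [Algebra k R] {X : Type} [Fintype X]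
    {A : X → R} {y : R} (hy : ∀ x, Commute (A x) y) (n : ℕ) (h : NCSeries k X) :
    Commute (evc A n h) y := by
  induction n generalizing h with
  | zero => exact Algebra.commutes _ _
  | succ n ih => exact Commute.sum_left _ _ _ fun x _ => (hy x).mul_left (ih _)

/-- The coefficient of `u ⊗ v` in the coproduct of `h`, as a sum over shuffles. -/
def shCoeff {k : Type*} [CommRing k] {X : Type} (h : NCSeries k X) (u v : List X) : k :=
  ((shuffles u v).map h).sum

theorem shCoeff_nil_left {k : Type*} [CommRing k] {X : Type} (h : NCSeries k X) (v : List X) :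
    shCoeff h [] v = h v := by simp [shCoeff, shuffles]

theorem shCoeff_nil_right {k : Type*} [CommRing k] {X : Type} (h : NCSeries k X) (u : List X) :
    shCoeff h u [] = h u := by cases u <;> simp [shCoeff, shuffles]

theorem shCoeff_cons {k : Type*} [CommRing k] {X : Type} (h : NCSeries k X) (a b : X)
    (u v : List X) :
    shCoeff h (a :: u) (b :: v)
      = shCoeff (fun w => h (a :: w)) u (b :: v) + shCoeff (fun w => h (b :: w)) (a :: u) v := by
  simp [shCoeff, shuffles, Function.comp_def]

theorem length_of_mem_shuffles {X : Type} : ∀ (u v w : List X), w ∈ shuffles u v →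
    w.length = u.length + v.length
  | [], v, w, hw => by simp_all [shuffles]
  | a :: u, [], w, hw => by simp_all [shuffles]
  | a :: u, b :: v, w, hw => by
    rw [shuffles, List.mem_append, List.mem_map, List.mem_map] at hw
    rcases hw with ⟨w', hw', rfl⟩ | ⟨w', hw', rfl⟩
    · have := length_of_mem_shuffles u (b :: v) w' hw'
      simp at this ⊢; omega
    · have := length_of_mem_shuffles (a :: u) v w' hw'
      simp at this ⊢; omega
termination_by u v => u.length + v.length

theorem count_map_cons {X : Type} [DecidableEq X] (a b : X) (w : List X) (L : List (List X)) :
    (L.map (a :: ·)).count (b :: w) = if a = b then L.count w else 0 := by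
  induction L with
  | nil => simp
  | cons l L ih =>
    rw [List.map_cons, List.count_cons, ih, List.count_cons]
    by_cases h : a = b <;> simp [h]

theorem count_map_left {X : Type} [DecidableEq X] (a b : X) (u v : List X)
    (L : List (List X × List X)) :
    (L.map fun p => (a :: p.1, p.2)).count (b :: u, v) = if a = b then L.count (u, v) else 0 := by
  induction L with
  | nil => simp
  | cons l L ih =>
    rw [List.map_cons, List.count_cons, ih, List.count_cons]
    by_cases h : a = b <;> simp [h, Prod.ext_iff]

theorem count_map_right {X : Type} [DecidableEq X] (a b : X) (u v : List X)
    (L : List (List X × List X)) :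
    (L.map fun p => (p.1, a :: p.2)).count (u, b :: v) = if a = b then L.count (u, v) else 0 := by
  induction L with
  | nil => simp
  | cons l L ih =>
    rw [List.map_cons, List.count_cons, ih, List.count_cons]
    by_cases h : a = b <;> simp [h, Prod.ext_iff]

theorem count_map_left_nil {X : Type} [DecidableEq X] (a : X) (v : List X)
    (L : List (List X × List X)) :
    (L.map fun p => (a :: p.1, p.2)).count ([], v) = 0 := by
  simp [List.count_eq_zero]

theorem count_map_right_nil {X : Type} [DecidableEq X] (a : X) (u : List X)
    (L : List (List X × List X)) :
    (L.map fun p => (p.1, a :: p.2)).count (u, []) = 0 := by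
  simp [List.count_eq_zero]

/-- The coproduct of a word, listed by subsets of positions, is dual to the shuffle product. -/
theorem count_unshuffles {X : Type} [DecidableEq X] (w : List X) : ∀ u v : List X,
    (unshuffles w).count (u, v) = (shuffles u v).count w := by
  induction w with
  | nil =>
    rintro (_ | ⟨a, u⟩) (_ | ⟨b, v⟩)
    · simp [unshuffles, shuffles]
    · simp [unshuffles, shuffles]
    · simp [unshuffles, shuffles]
    · have h0 : ∀ (c : X) (L : List (List X)), (L.map (c :: ·)).count [] = 0 := by
        simp [List.count_eq_zero]
      rw [unshuffles, shuffles, List.count_append, h0, h0]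
      simp
  | cons c w ih =>
    rintro (_ | ⟨a, u⟩) (_ | ⟨b, v⟩)
    · simp [unshuffles, shuffles, List.count_eq_zero]
    · rw [unshuffles, List.count_append, count_map_left_nil, count_map_right, ih]
      by_cases h : c = b
      · simp [shuffles, h, List.count_singleton]
      · simp [shuffles, h, Ne.symm h]
    · rw [unshuffles, List.count_append, count_map_right_nil, count_map_left, ih]
      by_cases h : c = a
      · cases u <;> simp [shuffles, h, List.count_singleton]
      · simp [shuffles, h, Ne.symm h]
    · rw [unshuffles, List.count_append, count_map_left, count_map_right, shuffles,
        List.count_append, count_map_cons, count_map_cons, ih, ih]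
      simp only [eq_comm]

theorem sum_count_mul {k : Type*} [CommRing k] {X : Type} [DecidableEq X] [Fintype X] (n : ℕ)
    (h : List X → k) (L : List (List X)) (hL : ∀ w ∈ L, w.length = n) :
    ∑ w : Fin n → X, (L.count (List.ofFn w) : k) * h (List.ofFn w) = (L.map h).sum := by
  induction L with
  | nil => simp
  | cons l L ih =>
    rw [List.map_cons, List.sum_cons, ← ih fun w hw => hL w (by simp [hw])]
    obtain ⟨w₀, rfl⟩ : ∃ w₀ : Fin n → X, List.ofFn w₀ = l := by
      have := hL l (by simp)
      subst this
      exact ⟨l.get, List.ofFn_get l⟩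
    simp only [List.count_cons, Nat.cast_add, add_mul, Finset.sum_add_distrib]
    rw [add_comm]
    congr 1
    rw [Finset.sum_eq_single w₀]
    · simp
    · intro b _ hb
      simp [(List.ofFn_injective.ne hb).symm]
    · simp

theorem coprodCoeff_eq {k : Type*} [CommRing k] {X : Type} [DecidableEq X] [Fintype X]
    (h : NCSeries k X) (u v : List X) : coprodCoeff h u v = shCoeff h u v := by
  simp only [coprodCoeff, count_unshuffles]
  exact sum_count_mul _ _ _ fun w hw => length_of_mem_shuffles u v w hw

/-- The terms of `shCoeff h u v` with the first letter taken from `u`. -/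
def shLeft {k : Type*} [CommRing k] {X : Type} (h : NCSeries k X) : List X → List X → k
  | [], _ => 0
  | a :: u, v => shCoeff (fun w => h (a :: w)) u v

/-- The terms of `shCoeff h u v` with the first letter taken from `v`. -/
def shRight {k : Type*} [CommRing k] {X : Type} (h : NCSeries k X) : List X → List X → k
  | _, [] => 0
  | u, b :: v => shCoeff (fun w => h (b :: w)) u v

theorem shCoeff_eq_add {k : Type*} [CommRing k] {X : Type} (h : NCSeries k X) (u v : List X)
    (huv : u.length + v.length ≠ 0) : shCoeff h u v = shLeft h u v + shRight h u v := by
  rcases u with _ | ⟨a, u⟩ <;> rcases v with _ | ⟨b, v⟩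
  · simp at huv
  · simp [shLeft, shRight, shCoeff_nil_left]
  · simp [shLeft, shRight, shCoeff_nil_right]
  · rw [shLeft, shRight, shCoeff_cons]

/-- The value of a series at sums of commuting elements is the value of its coproduct. -/
theorem evc_add_aux {k R : Type*} [CommRing k] [Ring R] [Algebra k R] {X : Type} [Fintype X]
    {A B : X → R} (hAB : ∀ x y, Commute (A x) (B y)) (n : ℕ) (h : NCSeries k X) :
    evc (fun x => A x + B x) n h = ∑ p ∈ Finset.HasAntidiagonal.antidiagonal n,
      ∑ u : Fin p.1 → X, ∑ v : Fin p.2 → X, shCoeff h (List.ofFn u) (List.ofFn v) •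
        (((List.ofFn u).map A).prod * ((List.ofFn v).map B).prod) := by
  induction n generalizing h with
  | zero => simp [evc, shCoeff_nil_left, Algebra.algebraMap_eq_smul_one]
  | succ n ih =>
    have hB : ∀ (b : X) (u : List X), (u.map A).prod * B b = B b * (u.map A).prod := by
      intro b u
      induction u with
      | nil => simp
      | cons a u ih => rw [List.map_cons, List.prod_cons, mul_assoc, ih, ← mul_assoc, (hAB a b).eq,
          mul_assoc]
    let T : (List X → List X → k) → ℕ × ℕ → R := fun c p => ∑ u : Fin p.1 → X, ∑ v : Fin p.2 → X,
      c (List.ofFn u) (List.ofFn v) • (((List.ofFn u).map A).prod * ((List.ofFn v).map B).prod)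
    have hL0 : ∀ j, T (shLeft h) (0, j) = 0 := fun j => by simp [T, shLeft]
    have hR0 : ∀ i, T (shRight h) (i, 0) = 0 := fun i => by
      refine Finset.sum_eq_zero fun u _ => Finset.sum_eq_zero fun v _ => ?_
      have : List.ofFn v = [] := by simp
      rw [this]
      cases List.ofFn u <;> simp [shRight]
    have hL : ∀ i j, T (shLeft h) (i + 1, j)
        = ∑ a, A a * T (shCoeff fun w => h (a :: w)) (i, j) := by
      intro i j
      simp only [T]
      rw [sum_words_succ i fun u => ∑ v : Fin j → X, shLeft h u (List.ofFn v) •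
        ((u.map A).prod * ((List.ofFn v).map B).prod)]
      refine Finset.sum_congr rfl fun a _ => ?_
      simp only [Finset.mul_sum, shLeft, List.map_cons, List.prod_cons, mul_smul_comm, mul_assoc]
    have hR : ∀ i j, T (shRight h) (i, j + 1)
        = ∑ b, B b * T (shCoeff fun w => h (b :: w)) (i, j) := by
      intro i j
      have h1 : ∀ u : Fin i → X, ∑ v : Fin (j + 1) → X, shRight h (List.ofFn u) (List.ofFn v) •
          (((List.ofFn u).map A).prod * ((List.ofFn v).map B).prod)
          = ∑ b, ∑ v : Fin j → X, B b * (shCoeff (fun w => h (b :: w)) (List.ofFn u) (List.ofFn v) •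
          (((List.ofFn u).map A).prod * ((List.ofFn v).map B).prod)) := by
        intro u
        rw [sum_words_succ j fun v => shRight h (List.ofFn u) v •
          (((List.ofFn u).map A).prod * (v.map B).prod)]
        refine Finset.sum_congr rfl fun b _ => Finset.sum_congr rfl fun v _ => ?_
        rw [List.map_cons, List.prod_cons, ← mul_assoc, hB, mul_smul_comm, mul_assoc]
        cases List.ofFn u <;> rfl
      simp only [T, h1, Finset.mul_sum]
      rw [Finset.sum_comm]
    have hS : ∀ p ∈ Finset.HasAntidiagonal.antidiagonal (n + 1), T (shCoeff h) p
        = T (shLeft h) p + T (shRight h) p := by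
      intro p hp
      rw [Finset.HasAntidiagonal.mem_antidiagonal] at hp
      simp only [T, ← Finset.sum_add_distrib, ← add_smul]
      refine Finset.sum_congr rfl fun u _ => Finset.sum_congr rfl fun v _ => ?_
      rw [shCoeff_eq_add]
      simp; omega
    change _ = ∑ p ∈ Finset.HasAntidiagonal.antidiagonal (n + 1), T (shCoeff h) p
    rw [Finset.sum_congr rfl hS, Finset.sum_add_distrib, Finset.Nat.sum_antidiagonal_succ,
      Finset.Nat.sum_antidiagonal_succ', hL0, hR0, zero_add, zero_add]
    simp only [hL, hR]
    rw [← Finset.sum_add_distrib, evc]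
    simp only [ih, Finset.mul_sum, add_mul, Finset.sum_add_distrib]
    congr 1
    · simp only [T, Finset.mul_sum]
      exact Finset.sum_comm
    · simp only [T, Finset.mul_sum]
      exact Finset.sum_comm

/-- The values of group-like series are multiplicative in commuting arguments. -/
theorem ev_add {k R : Type*} [CommRing k] [Ring R] [Algebra k R] {X : Type} [DecidableEq X]
    [Fintype X] {h : NCSeries k X} (hh : IsGroupLike h) {A B : X → R}
    (hAB : ∀ x y, Commute (A x) (B y)) : ev h (fun x => A x + B x) = ev h A * ev h B := by
  ext n
  rw [coeff_ev, PowerSeries.coeff_mul, evc_add_aux hAB]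
  refine Finset.sum_congr rfl fun p _ => ?_
  rw [coeff_ev, coeff_ev, evc_eq_sum_map, evc_eq_sum_map, Finset.sum_mul_sum]
  refine Finset.sum_congr rfl fun u _ => Finset.sum_congr rfl fun v _ => ?_
  rw [← coprodCoeff_eq, hh.2, smul_mul_smul_comm]

theorem constantCoeff_ev {k R : Type*} [CommRing k] [Ring R] [Algebra k R] {X : Type} [Fintype X]
    {h : NCSeries k X} (h1 : h [] = 1) (A : X → R) :
    PowerSeries.constantCoeff (ev h A) = ((1 : Rˣ) : R) := by
  rw [← PowerSeries.coeff_zero_eq_constantCoeff_apply, coeff_ev, evc, h1]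
  simp

/-- The value of a series with constant term `1`, as a unit. -/
def evU {k : Type*} (R : Type*) [CommRing k] [Ring R] [Algebra k R] {X : Type} [Fintype X]
    {h : NCSeries k X} (h1 : h [] = 1) (A : X → R) : (PowerSeries R)ˣ where
  val := ev h A
  inv := PowerSeries.invOfUnit (ev h A) 1
  val_inv := PowerSeries.mul_invOfUnit _ _ (constantCoeff_ev h1 A)
  inv_val := PowerSeries.invOfUnit_mul _ _ (constantCoeff_ev h1 A)

theorem ev_commute {k R : Type*} [CommRing k] [Ring R] [Algebra k R] {X : Type} [Fintype X]
    {A B : X → R} (hAB : ∀ x y, Commute (A x) (B y)) (h h' : NCSeries k X) :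
    Commute (ev h A) (ev h' B) := by
  have h1 : ∀ i j, Commute (evc A i h) (evc B j h') := fun i j =>
    evc_commute (fun x => (evc_commute (fun y => (hAB x y).symm) j h').symm) i h
  ext n
  rw [PowerSeries.coeff_mul, PowerSeries.coeff_mul, ← Finset.Nat.sum_antidiagonal_swap]
  refine Finset.sum_congr rfl fun p _ => ?_
  simp only [coeff_ev, Prod.fst_swap, Prod.snd_swap, (h1 _ _).eq]

theorem map_ev {k R R' : Type*} [CommRing k] [Ring R] [Algebra k R] [Ring R'] [Algebra k R']
    {X : Type} [Fintype X] (φ : R →ₐ[k] R') (A : X → R) (h : NCSeries k X) :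
    PowerSeries.map (φ : R →+* R') (ev h A) = ev h fun x => φ (A x) := by
  ext n
  rw [PowerSeries.coeff_map, coeff_ev, coeff_ev, ← map_evc]
  rfl

/-! ### Special cases of the pentagon equation -/

section Identities

variable {k R : Type*} [CommRing k] [Ring R] [Algebra k R] {h : NCSeries k L3}

/-- The value `h(a, b, c)` of an element of `PENT(2, k)` at elements of an algebra, as a unit of
the ring of power series. -/
def hval (hh : h ∈ PENT2 k) (a b c : R) : (PowerSeries R)ˣ := evU R hh.1.1 (trip a b c)

theorem val_hval (hh : h ∈ PENT2 k) (a b c : R) :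
    (hval hh a b c : PowerSeries R) = ev h (trip a b c) := rfl

theorem Rep.pentagon (r : Rep R) (hh : h ∈ PENT2 k) :
    hval hh r.t12 (r.t23 + r.t24) (r.u23 + r.u24) * hval hh (r.t13 + (r.t23 + r.u23)) r.t34 r.u34
      = hval hh r.t23 r.t34 0
        * hval hh (r.t12 + r.t13 + (r.t23 + r.u23)) (r.t24 + r.t34) (r.u24 + r.u34)
        * hval hh r.t12 r.t23 r.u23 :=
  Units.ext (r.mixedPentagon hh)

theorem hval_add (hh : h ∈ PENT2 k) {a b c a' b' c' : R}
    (hc : ∀ x y, Commute (trip a b c x) (trip a' b' c' y)) :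
    hval hh (a + a') (b + b') (c + c') = hval hh a b c * hval hh a' b' c' := by
  refine Units.ext ?_
  rw [Units.val_mul, val_hval, val_hval, val_hval, ← ev_add hh.1 hc]
  congr 1
  ext x
  cases x <;> rfl

theorem hval_commute (hh : h ∈ PENT2 k) {a b c a' b' c' : R}
    (hc : ∀ x y, Commute (trip a b c x) (trip a' b' c' y)) :
    Commute (hval hh a b c) (hval hh a' b' c') :=
  Units.ext (ev_commute hc h h)

theorem hval_zero (hh : h ∈ PENT2 k) : hval hh (0 : R) 0 0 = 1 := by
  have := hval_add hh (R := R) (a := 0) (b := 0) (c := 0) (a' := 0) (b' := 0) (c' := 0)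
    (by rintro (_ | _ | _) y <;> exact Commute.zero_left _)
  simpa using this

/-- The pentagon equation with `t^{12}` as the only nonzero element. -/
theorem hval_left (hh : h ∈ PENT2 k) (a : R) : hval hh a 0 0 = 1 := by
  have := ({ t12 := a } : Rep R).pentagon hh
  simpa [hval_zero] using this

/-- The pentagon equation with `t(0)^{34}` as the only nonzero element. -/
theorem hval_mid (hh : h ∈ PENT2 k) (a : R) : hval hh 0 a 0 = 1 := by
  have := ({ t34 := a } : Rep R).pentagon hh
  simpa [hval_zero] using this

/-- At commuting elements only the last argument matters. -/
theorem hval_of_commute (hh : h ∈ PENT2 k) {a b c : R} (hab : Commute a b) (hac : Commute a c)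
    (hbc : Commute b c) : hval hh a b c = hval hh 0 0 c := by
  have h1 := hval_add hh (a := a) (b := 0) (c := 0) (a' := 0) (b' := b) (c' := c)
    (by rintro (_ | _ | _) (_ | _ | _) <;> simp [trip, *])
  have h2 := hval_add hh (a := (0 : R)) (b := b) (c := 0) (a' := 0) (b' := 0) (c' := c)
    (by rintro (_ | _ | _) (_ | _ | _) <;> simp [trip, *])
  simp only [add_zero, zero_add, hval_left, hval_mid, one_mul] at h1 h2
  rw [h1, h2]

theorem hval_right_neg (hh : h ∈ PENT2 k) (c : R) :
    hval hh 0 0 (-c) = (hval hh 0 0 c)⁻¹ := by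
  have := hval_add hh (a := (0 : R)) (b := 0) (c := -c) (a' := 0) (b' := 0) (c' := c)
    (by rintro (_ | _ | _) (_ | _ | _) <;> simp [trip])
  rw [eq_inv_iff_mul_eq_one, ← this]
  simp [hval_zero]

/-- The duality relation of `δ(h)`. -/
theorem hval_dual (hh : h ∈ PENT2 k) (a b : R) : hval hh b a 0 * hval hh a b 0 = 1 := by
  have key : hval hh a (-a) 0 * hval hh (-a) a 0
      = hval hh b a 0 * hval hh 0 (-b) 0 * hval hh a b 0 := by
    convert ({ t12 := a, t34 := a, t23 := b, t13 := -a-b, t24 := -a-b } : Rep R).pentagon hh using 3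
      <;> dsimp only <;> abel_nf
  rw [hval_of_commute hh (a := a) (b := -a), hval_of_commute hh (a := -a)] at key
  · simpa [hval_zero, hval_mid] using key.symm
  all_goals simp

/-- The case `c = -a - b` of an arbitrary third argument reduces to `δ(h)`. -/
theorem hval_middle_letter (hh : h ∈ PENT2 k) (a b : R) :
    hval hh a b (-a-b) * hval hh 0 0 a = hval hh 0 0 (-b) * hval hh a b 0 := by
  have key : hval hh a b (-a-b) * hval hh (-a) 0 a
      = hval hh b 0 0 * hval hh 0 0 (-b) * hval hh a b 0 := by
    convert ({ t12 := a, u34 := a, t23 := b, t13 := -a-b, u24 := -a-b } : Rep R).pentagon hh using 3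
      <;> dsimp only <;> abel_nf
  rw [hval_of_commute hh (a := -a), hval_left, one_mul] at key
  · exact key
  all_goals simp

/-- The distribution relation. -/
theorem hval_dist (hh : h ∈ PENT2 k) (a b : R) :
    hval hh (a + a) b b = hval hh 0 0 b * hval hh a b 0 := by
  have key : hval hh 0 (-b) (-b) * hval hh (a + a) b b
      = hval hh a b 0 * hval hh (a + a) (-a) (-a) * hval hh 0 a a := by
    convert ({ t23 := a, u23 := a, t34 := b, u34 := b, t24 := -a-b, u24 := -a-b } :
      Rep R).pentagon hh using 3 <;> dsimp only <;> abel_nf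
  rw [hval_of_commute hh (a := 0) (b := -b), hval_of_commute hh (a := a + a) (b := -a),
    hval_of_commute hh (a := 0) (b := a), hval_right_neg, hval_right_neg, inv_mul_cancel_right,
    inv_mul_eq_iff_eq_mul] at key
  · exact key
  all_goals simp

/-- Comparison of the arguments `(0, b, ·)` and `(b, 0, ·)`. -/
theorem hval_pk (hh : h ∈ PENT2 k) (a b : R) :
    hval hh 0 b a * hval hh b 0 (-a-b) = hval hh 0 0 (-b) := by
  have key : hval hh 0 b a * hval hh b 0 (-a-b)
      = hval hh b 0 0 * hval hh b 0 (-b) * hval hh 0 b 0 := by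
    convert ({ u24 := a, t23 := b, u34 := -a-b } : Rep R).pentagon hh
      using 3 <;> dsimp only <;> abel_nf
  rw [hval_left, hval_mid, one_mul, mul_one, hval_of_commute hh (a := b) (c := -b)] at key
  · exact key
  all_goals simp

/-- Comparison of the arguments `(0, b, ·)` and `(a, 0, ·)`. -/
theorem hval_kpf (hh : h ∈ PENT2 k) (a b : R) :
    hval hh 0 b a * hval hh a 0 (-a-b) = hval hh a b (-a-b) * hval hh 0 0 a := by
  have key : hval hh 0 b a * hval hh a 0 (-a-b)
      = hval hh 0 0 0 * hval hh a b (-a-b) * hval hh 0 0 a := by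
    convert ({ u23 := a, t24 := b, u34 := -a-b } : Rep R).pentagon hh
      using 3 <;> dsimp only <;> abel_nf
  rwa [hval_zero, one_mul] at key

/-- The values of `δ(h)` in terms of those of `h(e⁰, 0, e⁻¹)`, by elimination of `h(0, e¹, e⁻¹)`
from `hval_pk` and `hval_kpf`. -/
theorem hval_pp (hh : h ∈ PENT2 k) (a b : R) :
    hval hh b 0 (-a-b) * hval hh a b 0 = hval hh a 0 (-a-b) := by
  have h1 := hval_kpf hh a b
  rw [hval_middle_letter, eq_mul_inv_of_mul_eq (hval_pk hh a b), mul_assoc, mul_right_inj,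
    inv_mul_eq_iff_eq_mul] at h1
  exact h1.symm

end Identities

/-! ### Letters and deletion operators acting on series -/

section Operators

variable {k : Type*} [CommRing k] {X : Type}

/-- The weight of a letter relative to its right neighbour. -/
def nextWeight (m : X → X → k) (m₀ : X → k) (x : X) : List X → k
  | [] => m₀ x
  | y :: _ => m x y

/-- The transpose of the operator which deletes the letters of a word one by one, each with the
difference of its weights relative to the left and right neighbours. The weight of `x` next to `y`
is `m x y`, next to the right end of the word `m₀ x`, next to the left end `E x`. -/
def delFun (m : X → X → k) (m₀ : X → k) : (X → k) → NCSeries k X → NCSeries k X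
  | _, _, [] => 0
  | E, f, x :: l => (E x - nextWeight m m₀ x l) * f l
      + delFun m m₀ (fun y => m y x) (fun w => f (x :: w)) l
termination_by structural _ _ l => l

theorem delFun_add (m : X → X → k) (m₀ E : X → k) (f g : NCSeries k X) (l : List X) :
    delFun m m₀ E (fun w => f w + g w) l = delFun m m₀ E f l + delFun m m₀ E g l := by
  induction l generalizing E f g with
  | nil => simp [delFun]
  | cons x l ih => simp only [delFun, ih]; ring

theorem delFun_smul (m : X → X → k) (m₀ E : X → k) (c : k) (f : NCSeries k X) (l : List X) :
    delFun m m₀ E (fun w => c * f w) l = c * delFun m m₀ E f l := by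
  induction l generalizing E f with
  | nil => simp [delFun]
  | cons x l ih => simp only [delFun, ih]; ring

/-- `delFun` as a linear map. -/
def delOp (m : X → X → k) (m₀ E : X → k) : Module.End k (NCSeries k X) where
  toFun := delFun m m₀ E
  map_add' f g := funext fun l => delFun_add m m₀ E f g l
  map_smul' c f := funext fun l => delFun_smul m m₀ E c f l

theorem delOp_nil (m : X → X → k) (m₀ E : X → k) (f : NCSeries k X) : delOp m m₀ E f [] = 0 := rfl

theorem delOp_cons (m : X → X → k) (m₀ E : X → k) (f : NCSeries k X) (x : X) (l : List X) :
    delOp m m₀ E f (x :: l) = (E x - nextWeight m m₀ x l) * f l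
      + delOp m m₀ (fun y => m y x) (fun w => f (x :: w)) l := rfl

theorem delOp_zero (m : X → X → k) (m₀ E : X → k) (l : List X) :
    delOp m m₀ E (fun _ => (0 : k)) l = 0 := congrFun (map_zero (delOp m m₀ E)) l

variable [DecidableEq X]

/-- Multiplication of series by a letter from the left. -/
def mulLetter (b : X) : Module.End k (NCSeries k X) where
  toFun f
    | [] => 0
    | x :: l => if x = b then f l else 0
  map_add' f g := by
    ext l
    cases l <;> simp [ite_add_ite]
  map_smul' c f := by
    ext l
    cases l <;> simp

theorem mulLetter_nil (b : X) (f : NCSeries k X) : mulLetter b f [] = 0 := rfl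

theorem mulLetter_cons (b x : X) (f : NCSeries k X) (l : List X) :
    mulLetter b f (x :: l) = if x = b then f l else 0 := rfl

/-- The commutators of the deletion operators with the letters. -/
theorem delOp_lie_mulLetter [Fintype X] (m : X → X → k) (m₀ E : X → k) (b : X) :
    ⁅delOp m m₀ E, (mulLetter b : Module.End k (NCSeries k X))⁆
      = ∑ c, (m c b - E c) • ⁅(mulLetter b : Module.End k (NCSeries k X)), mulLetter c⁆ := by
  refine LinearMap.ext fun f => funext fun l => ?_
  have hs : ∀ g : X → Module.End k (NCSeries k X), (∑ c, g c) f l = ∑ c, g c f l := fun g => by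
    rw [LinearMap.sum_apply, Finset.sum_apply]
  have h1 : ∀ x, (fun w => mulLetter b f (x :: w)) = if x = b then f else fun _ => 0 := by
    intro x; ext w; rw [mulLetter_cons]; split_ifs <;> rfl
  rw [hs]
  simp only [LieRing.of_associative_ring_bracket, LinearMap.smul_apply, LinearMap.sub_apply,
    Module.End.mul_apply, Pi.sub_apply, Pi.smul_apply, smul_eq_mul]
  rcases l with _ | ⟨x, _ | ⟨y, l⟩⟩
  · simp [mulLetter_nil, delOp_nil]
  · rw [delOp_cons, h1]
    by_cases h : x = b <;> simp [mulLetter_nil, mulLetter_cons, delOp_nil, h]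
  · rw [delOp_cons, h1]
    simp only [mulLetter_cons, nextWeight, mul_sub, mul_ite, mul_zero, Finset.sum_sub_distrib]
    by_cases hx : x = b <;> by_cases hy : y = b
    · subst hx; subst hy
      simp [delOp_cons, nextWeight]
      ring
    · subst hx
      simp [hy, delOp_cons, nextWeight]
      ring
    · subst hy
      simp [hx, delOp_zero]
      ring
    · simp [hx, hy, delOp_zero]

/-- Application of a polynomial in the letter operators to the unit series yields its
coefficients. -/
theorem lift_mulLetter_apply (p : FreeAlgebra k X) :
    FreeAlgebra.lift k (fun b : X => (mulLetter b : Module.End k (NCSeries k X))) p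
      (fun l => if l = [] then 1 else 0)
      = fun l => (FreeAlgebra.basisFreeMonoid k X).repr p (FreeMonoid.ofList l) := by
  let L : FreeAlgebra k X →ₗ[k] NCSeries k X :=
    { toFun := fun p => FreeAlgebra.lift k
        (fun b : X => (mulLetter b : Module.End k (NCSeries k X))) p
          (fun l => if l = [] then 1 else 0)
      map_add' := fun p q => by rw [map_add]; rfl
      map_smul' := fun c p => by rw [map_smul]; rfl }
  let L' : FreeAlgebra k X →ₗ[k] NCSeries k X :=
    { toFun := fun p l => (FreeAlgebra.basisFreeMonoid k X).repr p (FreeMonoid.ofList l)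
      map_add' := fun p q => by ext; simp
      map_smul' := fun c p => by ext; simp }
  have : L = L' := by
    refine (FreeAlgebra.basisFreeMonoid k X).ext fun w => funext fun l => ?_
    have h1 : L' (FreeAlgebra.basisFreeMonoid k X w) l
        = if l = FreeMonoid.toList w then 1 else 0 := by
      change (FreeAlgebra.basisFreeMonoid k X).repr _ _ = _
      by_cases h : l = FreeMonoid.toList w
      · rw [h, Module.Basis.repr_self, FreeMonoid.ofList_toList, if_pos rfl, Finsupp.single_eq_same]
      · rw [Module.Basis.repr_self, Finsupp.single_eq_of_ne (fun h' => h (by rw [← h']; rfl)),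
          if_neg h]
    have h2 : FreeAlgebra.basisFreeMonoid k X w
        = ((FreeMonoid.toList w).map (FreeAlgebra.ι k)).prod := by
      change (FreeAlgebra.equivMonoidAlgebraFreeMonoid (R := k)).symm _ = _
      simp [FreeAlgebra.equivMonoidAlgebraFreeMonoid, MonoidAlgebra.lift_apply,
          FreeMonoid.lift_apply]
    rw [h1, h2]
    clear h1 h2
    generalize FreeMonoid.toList w = v
    change FreeAlgebra.lift k (fun b : X => (mulLetter b : Module.End k (NCSeries k X))) _ _ l = _
    induction v generalizing l with
    | nil => simp
    | cons a v ih =>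
      rw [List.map_cons, List.prod_cons, map_mul, Module.End.mul_apply, FreeAlgebra.lift_ι_apply]
      cases l with
      | nil => simp [mulLetter_nil]
      | cons x l => simp only [mulLetter_cons, ih, List.cons.injEq, ite_and]
  exact LinearMap.congr_fun this p

/-- The free algebra acts faithfully on series. -/
theorem lift_mulLetter_injective : Function.Injective
    (FreeAlgebra.lift k (fun b : X => (mulLetter b : Module.End k (NCSeries k X)))) := by
  intro p q hpq
  apply (FreeAlgebra.basisFreeMonoid k X).repr.injective
  ext w
  have h := lift_mulLetter_apply p
  rw [hpq, lift_mulLetter_apply] at h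
  exact Eq.symm <| congrFun h (FreeMonoid.toList w)

end Operators

/-! ### The reflection equation -/

section Reflection

variable {k R : Type*} [CommRing k] [Ring R] [Algebra k R] {h : NCSeries k L3}

/-- The computation in the group of units behind `reflection_of_lie`: `x q y p` is the product in
the reflection equation, `h1` and `h2` are the two pentagon equations, and the other hypotheses are
instances of the simpler identities. -/
theorem reflection_aux {G : Type*} [Group G] {x y z q p u v g g' m n₁ n₂ : G}
    (h1 : q * u = v * g) (h2 : m * n₁ = n₂ * p) (f : m * x = y⁻¹ * g') (k1 : n₁ * v = z⁻¹)
    (k2 : n₂ * u = z⁻¹) (d : g' * g = 1) (q1 : Commute z⁻¹ y⁻¹) (q2 : Commute z⁻¹ g')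
    (q3 : Commute z⁻¹ x) (q4 : Commute u y) (q5 : Commute v x) : x * q * y * p = 1 := by
  have e1 := eq_mul_inv_of_mul_eq h1
  have e2 := eq_mul_inv_of_mul_eq f
  have e3 := eq_mul_inv_of_mul_eq k1
  have e4 := eq_mul_inv_of_mul_eq k2
  have w : Commute z⁻¹ (y⁻¹ * g' * x⁻¹) := (q1.mul_right q2).mul_right q3.inv_right
  have e5 : p = u * (y⁻¹ * g' * x⁻¹) * v⁻¹ := by
    rw [← inv_mul_eq_iff_eq_mul] at h2
    rw [← h2, e2, e3, e4]
    calc (z⁻¹ * u⁻¹)⁻¹ * (y⁻¹ * g' * x⁻¹ * (z⁻¹ * v⁻¹))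
        = u * z * (y⁻¹ * g' * x⁻¹ * z⁻¹) * v⁻¹ := by group
      _ = u * (y⁻¹ * g' * x⁻¹) * v⁻¹ := by rw [← w.eq]; group
  have e6 : g * g' = 1 := mul_eq_one_comm.1 d
  have e7 : u⁻¹ * y * u = y := by rw [mul_assoc, ← q4.eq, inv_mul_cancel_left]
  have e8 : v * x⁻¹ = x⁻¹ * v := q5.inv_right.eq
  calc x * q * y * p = x * v * g * (u⁻¹ * y * u) * y⁻¹ * g' * x⁻¹ * v⁻¹ := by
        rw [e1, e5]; group
    _ = x * v * (g * g') * x⁻¹ * v⁻¹ := by rw [e7]; group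
    _ = x * (v * x⁻¹) * v⁻¹ := by rw [e6]; group
    _ = 1 := by rw [e8]; group

/-- Any combination of commutators with letters, with coefficients depending on both letters, is the
commutator with a deletion operator. -/
theorem exists_lie_mulLetter {k : Type*} [CommRing k] {X : Type} [DecidableEq X] [Fintype X]
    (m : X → X → k) : ∃ P : Module.End k (NCSeries k X), ∀ b, P * mulLetter b - mulLetter b * P
      = ∑ c, m c b • (mulLetter b * mulLetter c - mulLetter c * mulLetter b) :=
  ⟨delOp m (fun _ => 0) (fun _ => 0), fun b => by
    simpa [LieRing.of_associative_ring_bracket] using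
      delOp_lie_mulLetter m (fun _ => 0) (fun _ => 0) b⟩

theorem map_trip {R R' : Type*} [Ring R] [Ring R'] {F : Type*} [FunLike F R R'] (φ : F)
    (a b c : R) : (fun x => φ (trip a b c x)) = trip (φ a) (φ b) (φ c) := by
  ext x
  cases x <;> rfl

/-- The reflection equation for elements `S₀, S₁, D` which are part of a system with the given
commutators: combine two instances of the pentagon equation. -/
theorem reflection_of_lie (hh : h ∈ PENT2 k) {S₀ S₁ D Z₀ Z₁ : R}
    (z00 : Z₀ * S₀ = S₀ * Z₀) (z01 : Z₀ * S₁ = S₁ * Z₀)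
    (z0d : Z₀ * D - D * Z₀ = (S₀ + S₁) * D - D * (S₀ + S₁))
    (z10 : Z₁ * S₀ = S₀ * Z₁) (z11 : Z₁ * S₁ - S₁ * Z₁ = S₁ * D - D * S₁)
    (z1d : Z₁ * D - D * Z₁ = D * S₁ - S₁ * D) :
    hval hh 0 0 S₁ * hval hh S₀ S₁ D * hval hh 0 0 S₀ * hval hh S₁ S₀ (-S₀ - S₁ - D) = 1 := by
  -- Two solutions of the relations which consist of combinations of the given elements.
  let r₁ : Rep R :=
    { t12 := S₀, t23 := S₁, t13 := Z₀ - S₀ - S₁, u24 := D, u34 := Z₁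
      tri2 := by change _ * _ = _ * _; linear_combination (norm := noncomm_ring) -z11
      tri8 := by change _ * _ = _ * _; linear_combination (norm := noncomm_ring) -z1d
      tri12 := by change _ * _ = _ * _; linear_combination (norm := noncomm_ring) z11 + z1d
      cen1 := by change _ * _ = _ * _; linear_combination (norm := noncomm_ring) z01
      pole1 := by change _ * _ = _ * _; linear_combination (norm := noncomm_ring) -z00
      pole2 := by change _ * _ = _ * _; linear_combination (norm := noncomm_ring) z00 + z01
      dis2 := by change _ * _ = _ * _; linear_combination (norm := noncomm_ring) -z10
      dis4 := by change _ * _ = _ * _; linear_combination (norm := noncomm_ring) z0d }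
  let r₂ : Rep R :=
    { t12 := S₁, t13 := D, t23 := S₀, u23 := -S₀ - S₁ - D, u24 := D, t34 := Z₀, u34 := -D - Z₀ - Z₁
      tri1 := by change _ * _ = _ * _; linear_combination (norm := noncomm_ring) -z00
      tri2 := by change _ * _ = _ * _; linear_combination (norm := noncomm_ring) z00 + z10
      tri3 := by change _ * _ = _ * _; linear_combination (norm := noncomm_ring) z0d + z00 + z01
      tri4 := by
        change _ * _ = _ * _
        linear_combination (norm := noncomm_ring) -z0d - z00 - z01 - z10 - z11 - z1d
      tri7 := by change _ * _ = _ * _; linear_combination (norm := noncomm_ring) -z0d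
      tri8 := by change _ * _ = _ * _; linear_combination (norm := noncomm_ring) z0d + z1d
      tri9 := by change _ * _ = _ * _; linear_combination (norm := noncomm_ring) z00
      tri10 := by change _ * _ = _ * _; linear_combination (norm := noncomm_ring) -z00 - z01
      tri11 := by
        change _ * _ = _ * _
        linear_combination (norm := noncomm_ring) z0d + z00 + z01 + z10 + z11 + z1d
      tri12 := by
        change _ * _ = _ * _
        linear_combination (norm := noncomm_ring) -z00 - z0d - z10 - z1d
      dis1 := by change _ * _ = _ * _; linear_combination (norm := noncomm_ring) -z01
      dis2 := by change _ * _ = _ * _; linear_combination (norm := noncomm_ring) z01 + z11 }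
  have c00 : Commute Z₀ S₀ := z00
  have c01 : Commute Z₀ S₁ := z01
  have c10 : Commute Z₁ S₀ := z10
  have c11 : Commute (D + Z₁) S₁ := by
    change _ * _ = _ * _; linear_combination (norm := noncomm_ring) z11
  have h1 : hval hh S₀ S₁ D * hval hh Z₀ 0 Z₁ = hval hh Z₀ 0 (D + Z₁) * hval hh S₀ S₁ 0 := by
    have key : hval hh S₀ S₁ D * hval hh (Z₀ + -S₀) (0 + 0) (Z₁ + 0)
        = hval hh S₁ 0 0 * hval hh Z₀ 0 (D + Z₁) * hval hh S₀ S₁ 0 := by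
      convert r₁.pentagon hh using 3 <;> simp only [r₁] <;> abel_nf
    rw [hval_left, one_mul, hval_add, hval_left, mul_one] at key
    · exact key
    · rintro (_ | _ | _) (_ | _ | _) <;> simp [trip, *]
  have h2 : hval hh S₁ S₀ (-S₁ - S₀) * hval hh 0 Z₀ (-(D + Z₁) - Z₀)
      = hval hh 0 Z₀ (-Z₁ - Z₀) * hval hh S₁ S₀ (-S₀ - S₁ - D) := by
    have key : hval hh S₁ S₀ (-S₁ - S₀) * hval hh (-S₁ + 0) (0 + Z₀) (0 + (-(D + Z₁) - Z₀))
        = hval hh S₀ Z₀ 0 * hval hh 0 Z₀ (-Z₁ - Z₀) * hval hh S₁ S₀ (-S₀ - S₁ - D) := by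
      convert r₂.pentagon hh using 3 <;> simp only [r₂] <;> abel_nf
    rw [hval_of_commute hh (a := S₀) (b := Z₀), hval_left, one_mul, hval_add, hval_left,
      one_mul] at key
    · exact key
    · have c : Commute S₁ (D + Z₁) := c11.symm
      have c' : Commute S₁ Z₀ := c01.symm
      have c'' : Commute S₁ (-(D + Z₁) - Z₀) := c.neg_right.sub_right c'
      rintro (_ | _ | _) (_ | _ | _) <;> simp only [trip, Commute.zero_left, Commute.zero_right] <;>
        exact Commute.neg_left (by assumption)
    all_goals simp [c00.symm]
  have f := hval_middle_letter hh S₁ S₀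
  have k1 := hval_pk hh (-(D + Z₁) - Z₀) Z₀
  have k2 := hval_pk hh (-Z₁ - Z₀) Z₀
  have e1 : -(-(D + Z₁) - Z₀) - Z₀ = D + Z₁ := by abel
  have e2 : -(-Z₁ - Z₀) - Z₀ = Z₁ := by abel
  rw [e1] at k1
  rw [e2] at k2
  have d := hval_dual hh S₀ S₁
  have q1 : Commute (hval hh 0 0 (-Z₀)) (hval hh 0 0 (-S₀)) := hval_commute hh (by
    rintro (_ | _ | _) (_ | _ | _) <;> simp [trip, *])
  have q2 : Commute (hval hh 0 0 (-Z₀)) (hval hh S₁ S₀ 0) := hval_commute hh (by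
    rintro (_ | _ | _) (_ | _ | _) <;> simp [trip, *])
  have q3 : Commute (hval hh 0 0 (-Z₀)) (hval hh 0 0 S₁) := hval_commute hh (by
    rintro (_ | _ | _) (_ | _ | _) <;> simp [trip, *])
  have q4 : Commute (hval hh Z₀ 0 Z₁) (hval hh 0 0 S₀) := hval_commute hh (by
    rintro (_ | _ | _) (_ | _ | _) <;> simp [trip, *])
  have q5 : Commute (hval hh Z₀ 0 (D + Z₁)) (hval hh 0 0 S₁) := hval_commute hh (by
    rintro (_ | _ | _) (_ | _ | _) <;>
      simp only [trip, Commute.zero_left, Commute.zero_right] <;> assumption)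
  rw [hval_right_neg] at f k1 k2 q2 q3 q1
  rw [hval_right_neg] at q1
  exact reflection_aux h1 h2 f k1 k2 d q1 q2 q3 q4 q5

/-- `reflection_of_lie` for elements `P`, `Q` with the commutators of deletion operators; the
elements `P + S₁` and `Q - D` are then as needed. -/
theorem reflection_of_lie' (hh : h ∈ PENT2 k) {S₀ S₁ D P Q : R}
    (a0 : P * S₀ - S₀ * P = S₀ * S₁ - S₁ * S₀) (a1 : P * S₁ - S₁ * P = 0)
    (a2 : P * D - D * P = S₀ * D - D * S₀) (b0 : Q * S₀ - S₀ * Q = D * S₀ - S₀ * D)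
    (b1 : Q * S₁ - S₁ * Q = 0) (b2 : Q * D - D * Q = D * S₁ - S₁ * D) :
    hval hh 0 0 S₁ * hval hh S₀ S₁ D * hval hh 0 0 S₀ * hval hh S₁ S₀ (-S₀ - S₁ - D) = 1 := by
  refine reflection_of_lie hh (Z₀ := P + S₁) (Z₁ := Q - D) ?_ ?_ ?_ ?_ ?_ ?_
  · linear_combination (norm := noncomm_ring) a0
  · linear_combination (norm := noncomm_ring) a1
  · linear_combination (norm := noncomm_ring) a2
  · linear_combination (norm := noncomm_ring) b0
  · linear_combination (norm := noncomm_ring) b1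
  · linear_combination (norm := noncomm_ring) b2

/-- The reflection equation, at arbitrary elements of an algebra. It suffices to prove it for the
letters of the free algebra, which act faithfully on series; there the deletion operators provide
the auxiliary elements. -/
theorem hval_reflection (hh : h ∈ PENT2 k) (a b c : R) :
    hval hh 0 0 b * hval hh a b c * hval hh 0 0 a * hval hh b a (-a - b - c) = 1 := by
  let S : L3 → Module.End k (NCSeries k L3) := mulLetter
  have hS : hval hh 0 0 (S .one) * hval hh (S .zero) (S .one) (S .negOne) * hval hh 0 0 (S .zero)
      * hval hh (S .one) (S .zero) (-S .zero - S .one - S .negOne) = 1 := by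
    obtain ⟨P, hP⟩ := exists_lie_mulLetter (X := L3)
      (fun | .one, .zero => 1 | .zero, .negOne => -1 | _, _ => (0 : k))
    obtain ⟨Q, hQ⟩ := exists_lie_mulLetter (X := L3)
      (fun | .negOne, .zero => -1 | .one, .negOne => 1 | _, _ => (0 : k))
    have a0 : P * S .zero - S .zero * P = S .zero * S .one - S .one * S .zero := by
      rw [hP, sum_L3]; simp [S]
    have a1 : P * S .one - S .one * P = 0 := by rw [hP, sum_L3]; simp
    have a2 : P * S .negOne - S .negOne * P = S .zero * S .negOne - S .negOne * S .zero := by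
      rw [hP, sum_L3]; simp [S]
      exact (neg_one_smul k _).trans (neg_sub _ _)
    have b0 : Q * S .zero - S .zero * Q = S .negOne * S .zero - S .zero * S .negOne := by
      rw [hQ, sum_L3]; simp [S]
      exact (neg_one_smul k _).trans (neg_sub _ _)
    have b1 : Q * S .one - S .one * Q = 0 := by rw [hQ, sum_L3]; simp
    have b2 : Q * S .negOne - S .negOne * Q = S .negOne * S .one - S .one * S .negOne := by
      rw [hQ, sum_L3]; simp [S]
    exact reflection_of_lie' hh a0 a1 a2 b0 b1 b2
  -- From the operators to the free algebra by faithfulness, and from there to arbitrary elements.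
  let φ : FreeAlgebra k L3 →ₐ[k] Module.End k (NCSeries k L3) := FreeAlgebra.lift k S
  let ψ : FreeAlgebra k L3 →ₐ[k] R := FreeAlgebra.lift k (trip a b c)
  let x : L3 → FreeAlgebra k L3 := FreeAlgebra.ι k
  have hφ : ∀ i, φ (x i) = S i := fun i => FreeAlgebra.lift_ι_apply _ _
  have hψ₀ : ψ (x .zero) = a := FreeAlgebra.lift_ι_apply _ _
  have hψ₁ : ψ (x .one) = b := FreeAlgebra.lift_ι_apply _ _
  have hψ₂ : ψ (x .negOne) = c := FreeAlgebra.lift_ι_apply _ _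
  have hF : hval hh 0 0 (x .one) * hval hh (x .zero) (x .one) (x .negOne) * hval hh 0 0 (x .zero)
      * hval hh (x .one) (x .zero) (-x .zero - x .one - x .negOne) = 1 := by
    apply Units.ext
    have hinj : Function.Injective
        (PowerSeries.map (φ : FreeAlgebra k L3 →+* Module.End k (NCSeries k L3))) :=
      fun f g hfg => PowerSeries.ext fun n =>
        lift_mulLetter_injective (by
          have := congrArg (PowerSeries.coeff n) hfg
          rwa [PowerSeries.coeff_map, PowerSeries.coeff_map] at this)
    apply hinj
    simpa only [Units.val_mul, val_hval, map_mul, map_ev, map_trip, hφ, map_zero, map_neg, map_sub,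
      Units.val_one, map_one] using congrArg Units.val hS
  apply Units.ext
  simpa only [Units.val_mul, val_hval, map_mul, map_ev, map_trip, hψ₀, hψ₁, hψ₂, map_zero, map_neg,
      map_sub, Units.val_one, map_one] using
    congrArg (fun f : (PowerSeries (FreeAlgebra k L3))ˣ =>
      PowerSeries.map (ψ : FreeAlgebra k L3 →+* R) f.val) hF

end Reflection

/-! ### The confluence identity for operators -/

section ConfluenceIdentity

variable {k R : Type*} [CommRing k] [Ring R] [Algebra k R] {h : NCSeries k L3}

/-- The computation in the group of units behind `confluence_of_lie`: `key` is the pentagon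
equation, `r₁`, `r₂`, `r₃` are reflection equations, which eliminate `m`, `p` and `q`, and the
factors `e` are values at a single element. -/
theorem confluence_aux {G : Type*} [Group G] {A A' B B' F K L n m p q e₁ e₀ ez ep es et : G}
    (key : n * m = B' * p * q) (f : n * e₁ = es⁻¹ * A') (d₁ : A' * A = 1) (d₂ : B' * B = 1)
    (r₁ : ep * F * ez * m = 1) (r₂ : ep * K * et * p = 1) (r₃ : e₁ * L * e₀ * q = 1)
    (c₁ : Commute ep e₁) (c₂ : Commute ep L) (c₃ : Commute ep e₀) (c₄ : Commute e₁ F)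
    (c₅ : Commute e₁ ez) (c₆ : Commute ez A) (c₇ : Commute e₀ K) (c₈ : ez * es = e₀ * et)
    (c₉ : Commute (e₀ * et) B) : F * A = L * K * B := by
  have en : n = es⁻¹ * A⁻¹ * e₁⁻¹ := by
    rw [eq_mul_inv_of_mul_eq f, eq_inv_of_mul_eq_one_left d₁]
  have em := eq_inv_of_mul_eq_one_right r₁
  have e2 := eq_inv_of_mul_eq_one_right r₂
  have e3 := eq_inv_of_mul_eq_one_right r₃
  rw [en, em, e2, e3, eq_inv_of_mul_eq_one_left d₂, ← inv_inj] at key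
  simp only [mul_inv_rev, inv_inv] at key
  have h1 : ep * F * ez * (e₁ * (A * es)) = ep * e₁ * F * A * (ez * es) := by
    calc ep * F * ez * (e₁ * (A * es)) = ep * F * (ez * e₁) * A * es := by group
      _ = ep * (F * e₁) * (ez * A) * es := by rw [← c₅.eq]; group
      _ = ep * e₁ * F * A * (ez * es) := by rw [← c₄.eq, c₆.eq]; group
  have h2 : e₁ * L * e₀ * (ep * K * et * B) = ep * e₁ * L * K * B * (e₀ * et) := by
    calc e₁ * L * e₀ * (ep * K * et * B) = e₁ * L * (e₀ * ep) * K * et * B := by group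
      _ = e₁ * (L * ep) * (e₀ * K) * et * B := by rw [← c₃.eq]; group
      _ = (e₁ * ep) * L * K * ((e₀ * et) * B) := by rw [← c₂.eq, c₇.eq]; group
      _ = ep * e₁ * L * K * B * (e₀ * et) := by rw [← c₁.eq, c₉.eq]; group
  have h3 : ep * e₁ * F * A * (ez * es) = ep * e₁ * L * K * B * (ez * es) := by
    rw [← h1, c₈, ← h2]
    simpa only [mul_assoc] using key
  have h4 := mul_right_cancel h3
  simp only [mul_assoc, mul_right_inj] at h4 ⊢
  exact h4

/-- The consequence of the pentagon and reflection equations for elements with the given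
commutators: those of the letters `0, z, -1, -z²` (as `S₀, S₁, D, E`) with modified deletion
operators. -/
theorem confluence_of_lie (hh : h ∈ PENT2 k) {S₀ S₁ D E Z₀ Zp Zm : R}
    (hz0 : Z₀ * S₀ - S₀ * Z₀ = S₀ * E - E * S₀) (hz1 : Z₀ * S₁ - S₁ * Z₀ = 0)
    (hzd : Z₀ * D - D * Z₀ = (S₀ + S₁ + E) * D - D * (S₀ + S₁ + E))
    (hze : Z₀ * E - E * Z₀ = E * S₀ - S₀ * E)
    (hp0 : Zp * S₀ - S₀ * Zp = 0) (hp1 : Zp * S₁ - S₁ * Zp = 0)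
    (hpd : Zp * D - D * Zp = D * E - E * D) (hpe : Zp * E - E * Zp = E * D - D * E)
    (hm0 : Zm * S₀ - S₀ * Zm = 0) (hm1 : Zm * S₁ - S₁ * Zm = S₁ * (D + E) - (D + E) * S₁)
    (hmd : Zm * D - D * Zm = D * (E + S₁) - (E + S₁) * D)
    (hme : Zm * E - E * Zm = E * (D + S₁) - (D + S₁) * E) :
    hval hh Z₀ Zp (Zm + D + E) * hval hh (S₀ + E) S₁ 0
      = hval hh S₀ S₁ (D + E) * hval hh (E + Z₀) Zp Zm * hval hh (-S₀ - E) S₀ 0 := by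
  let r : Rep R :=
    { t12 := S₁, t13 := D + E + Zp, t23 := S₀, u23 := -S₀ - S₁ - D - E, t24 := E, u24 := D,
      t34 := Z₀
      u34 := -Z₀ - Zm - Zp - D - E
      tri1 := by
        change _ * _ = _ * _
        linear_combination (norm := noncomm_ring) -hz0
      tri2 := by
        change _ * _ = _ * _
        linear_combination (norm := noncomm_ring) hz0 + hp0 + hm0
      tri3 := by
        change _ * _ = _ * _
        linear_combination (norm := noncomm_ring) hz0 + hz1 + hzd + hze
      tri4 := by
        change _ * _ = _ * _
        linear_combination (norm := noncomm_ring)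
          -hz0 - hz1 - hzd - hze - hp0 - hp1 - hpd - hpe - hm0 - hm1 - hmd - hme
      tri5 := by
        change _ * _ = _ * _
        linear_combination (norm := noncomm_ring) -hze
      tri6 := by
        change _ * _ = _ * _
        linear_combination (norm := noncomm_ring) hze + hpe + hme
      tri7 := by
        change _ * _ = _ * _
        linear_combination (norm := noncomm_ring) -hzd
      tri8 := by
        change _ * _ = _ * _
        linear_combination (norm := noncomm_ring) hzd + hpd + hmd
      tri9 := by
        change _ * _ = _ * _
        linear_combination (norm := noncomm_ring) hz0 + hze
      tri10 := by
        change _ * _ = _ * _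
        linear_combination (norm := noncomm_ring) -hz0 - hz1 - hze
      tri11 := by
        change _ * _ = _ * _
        linear_combination (norm := noncomm_ring)
          hz0 + hz1 + hzd + hp0 + hp1 + hpd + hm0 + hm1 + hmd
      tri12 := by
        change _ * _ = _ * _
        linear_combination (norm := noncomm_ring) -hz0 - hzd - hp0 - hpd - hm0 - hmd
      cen1 := by
        change _ * _ = _ * _
        linear_combination (norm := noncomm_ring) hp0
      cen2 := by
        change _ * _ = _ * _
        linear_combination (norm := noncomm_ring) -hp0 - hp1 - hpd - hpe
      pole1 := by
        change _ * _ = _ * _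
        linear_combination (norm := noncomm_ring) -hp1
      pole2 := by
        change _ * _ = _ * _
        linear_combination (norm := noncomm_ring) -hpd - hpe
      dis1 := by
        change _ * _ = _ * _
        linear_combination (norm := noncomm_ring) -hz1
      dis2 := by
        change _ * _ = _ * _
        linear_combination (norm := noncomm_ring) hz1 + hp1 + hm1
      dis3 := by
        change _ * _ = _ * _
        linear_combination (norm := noncomm_ring) hpe
      dis4 := by
        change _ * _ = _ * _
        linear_combination (norm := noncomm_ring) hpd }
  have a1 : Commute S₁ Z₀ := (sub_eq_zero.1 hz1).symm
  have a2 : Commute S₁ Zp := (sub_eq_zero.1 hp1).symm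
  have a3 : Commute S₁ (Zm + D + E) := by
    change _ * _ = _ * _; linear_combination (norm := noncomm_ring) -hm1
  have a4 : Commute S₀ (E + Z₀) := by
    change _ * _ = _ * _; linear_combination (norm := noncomm_ring) -hz0
  have a5 : Commute S₀ Zp := (sub_eq_zero.1 hp0).symm
  have a6 : Commute S₀ Zm := (sub_eq_zero.1 hm0).symm
  have a7 : Commute Z₀ (S₀ + E) := by
    change _ * _ = _ * _; linear_combination (norm := noncomm_ring) hz0 + hze
  have a8 : Commute Zp (D + E) := by
    change _ * _ = _ * _; linear_combination (norm := noncomm_ring) hpd + hpe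
  have a9 : Commute (S₀ + (E + Z₀)) S₀ := by
    change _ * _ = _ * _; linear_combination (norm := noncomm_ring) hz0
  have a10 : Commute (S₀ + (E + Z₀)) Z₀ := by
    change _ * _ = _ * _; linear_combination (norm := noncomm_ring) -hz0 - hze
  have a11 : Commute (S₀ + (E + Z₀)) (-S₀ - E) := by
    have : -S₀ - E = Z₀ - (S₀ + (E + Z₀)) := by abel
    rw [this]
    exact a10.sub_right (Commute.refl _)
  -- `S₀ + E + Z₀` commutes with `S₀` and `E`, so it may be added to the first argument.
  have a12 : hval hh Z₀ S₀ 0 = hval hh (-S₀ - E) S₀ 0 := by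
    have := hval_add hh (a := S₀ + (E + Z₀)) (b := 0) (c := 0) (a' := -S₀ - E) (b' := S₀) (c' := 0)
      (by rintro (_ | _ | _) (_ | _ | _) <;>
            simp only [trip, Commute.zero_left, Commute.zero_right] <;> assumption)
    rw [hval_left, one_mul, zero_add, zero_add] at this
    rw [← this]
    congr 1
    abel
  rw [← a12]
  have key : hval hh S₁ (S₀ + E) (-S₁ - (S₀ + E)) * hval hh Zp Z₀ (-Z₀ - Zp - (Zm + D + E))
      = hval hh S₀ Z₀ 0 * hval hh Zp (E + Z₀) (-(E + Z₀) - Zp - Zm)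
        * hval hh S₁ S₀ (-S₀ - S₁ - (D + E)) := by
    have key : hval hh S₁ (S₀ + E) (-S₁ - (S₀ + E))
          * hval hh (-S₁ + Zp) (0 + Z₀) (0 + (-Z₀ - Zp - (Zm + D + E)))
        = hval hh S₀ Z₀ 0 * hval hh Zp (E + Z₀) (-(E + Z₀) - Zp - Zm)
        * hval hh S₁ S₀ (-S₀ - S₁ - (D + E)) := by
      convert r.pentagon hh using 3 <;> simp only [r] <;> abel_nf
    rw [hval_add hh (a := -S₁), hval_left, one_mul] at key
    · exact key
    · have c : Commute S₁ (-Z₀ - Zp - (Zm + D + E)) := ((a1.neg_right).sub_right a2).sub_right a3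
      rintro (_ | _ | _) (_ | _ | _) <;> simp only [trip, Commute.zero_left] <;>
        exact Commute.neg_left (by assumption)
  have f := hval_middle_letter hh S₁ (S₀ + E)
  rw [hval_right_neg] at f
  refine confluence_aux key f (hval_dual hh _ _) (hval_dual hh _ _) (hval_reflection hh _ _ _)
    (hval_reflection hh _ _ _) (hval_reflection hh _ _ _) ?_ ?_ ?_ ?_ ?_ ?_ ?_ ?_ ?_
  iterate 7
    refine hval_commute hh ?_
    rintro (_ | _ | _) (_ | _ | _) <;> simp only [trip, Commute.zero_left, Commute.zero_right] <;>
      first | assumption | (apply Commute.symm; assumption)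
  · rw [← hval_add, ← hval_add]
    · simp only [add_zero]
      congr 1
      abel
    · rintro (_ | _ | _) (_ | _ | _) <;> simp [trip, a4]
    · rintro (_ | _ | _) (_ | _ | _) <;> simp only [trip, Commute.zero_left, Commute.zero_right]
      exact a7
  · rw [← hval_add]
    · refine hval_commute hh ?_
      rintro (_ | _ | _) (_ | _ | _) <;>
        simp only [trip, add_zero, Commute.zero_left, Commute.zero_right] <;>
        assumption
    · rintro (_ | _ | _) (_ | _ | _) <;> simp [trip, a4]

/-- `confluence_of_lie`, in terms of deletion operators. -/
theorem confluence_of_lie' (hh : h ∈ PENT2 k) {S₀ S₁ D E P₀ P₁ Pm : R}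
    (p00 : P₀ * S₀ - S₀ * P₀ = (S₀ * S₁ - S₁ * S₀) + (S₀ * E - E * S₀))
    (p01 : P₀ * S₁ - S₁ * P₀ = 0)
    (p0d : P₀ * D - D * P₀ = (S₀ * D - D * S₀) + (E * D - D * E))
    (p0e : P₀ * E - E * P₀ = (E * S₀ - S₀ * E) + (E * S₁ - S₁ * E))
    (p10 : P₁ * S₀ - S₀ * P₁ = 0) (p11 : P₁ * S₁ - S₁ * P₁ = 0)
    (p1d : P₁ * D - D * P₁ = D * E - E * D) (p1e : P₁ * E - E * P₁ = E * D - D * E)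
    (pm0 : Pm * S₀ - S₀ * Pm = (D * S₀ - S₀ * D) + (E * S₀ - S₀ * E))
    (pm1 : Pm * S₁ - S₁ * Pm = 0)
    (pmd : Pm * D - D * Pm = D * S₁ - S₁ * D)
    (pme : Pm * E - E * Pm = E * S₁ - S₁ * E) :
    hval hh P₀ P₁ Pm * (hval hh (S₀ + E) S₁ 0 * hval hh S₀ (-S₀ - E) 0)
      = hval hh S₀ S₁ (D + E) * hval hh (E + P₀ + S₁ - S₀) P₁ (Pm - D - E) := by
  have key := confluence_of_lie hh (S₀ := S₀) (S₁ := S₁) (D := D) (E := E) (Z₀ := P₀ + S₁)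
    (Zp := P₁) (Zm := Pm - D - E)
    (by linear_combination (norm := noncomm_ring) p00)
    (by linear_combination (norm := noncomm_ring) p01)
    (by linear_combination (norm := noncomm_ring) p0d)
    (by linear_combination (norm := noncomm_ring) p0e)
    p10 p11 p1d p1e
    (by linear_combination (norm := noncomm_ring) pm0)
    (by linear_combination (norm := noncomm_ring) pm1)
    (by linear_combination (norm := noncomm_ring) pmd)
    (by linear_combination (norm := noncomm_ring) pme)
  have c1 : Commute P₀ S₁ := sub_eq_zero.1 p01
  have c2 : Commute P₁ S₁ := sub_eq_zero.1 p11
  have c3 : Commute Pm S₁ := sub_eq_zero.1 pm1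
  -- The summands `S₁` and `S₀` in the first arguments commute with all arguments and do not matter.
  have e1 : hval hh (P₀ + S₁) P₁ (Pm - D - E + D + E) = hval hh P₀ P₁ Pm := by
    have := hval_add hh (a := P₀) (b := P₁) (c := Pm) (a' := S₁) (b' := 0) (c' := 0)
      (by rintro (_ | _ | _) (_ | _ | _) <;> simp [trip, *])
    rw [hval_left, mul_one, add_zero, add_zero] at this
    rw [← this]
    congr 1
    abel
  have c4 : Commute (E + P₀ + S₁ - S₀) S₀ := by
    change _ * _ = _ * _; linear_combination (norm := noncomm_ring) p00
  have c5 : Commute P₁ S₀ := sub_eq_zero.1 p10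
  have c6 : Commute (Pm - D - E) S₀ := by
    change _ * _ = _ * _; linear_combination (norm := noncomm_ring) pm0
  have e2 : hval hh (E + (P₀ + S₁)) P₁ (Pm - D - E)
      = hval hh (E + P₀ + S₁ - S₀) P₁ (Pm - D - E) := by
    have := hval_add hh (a := E + P₀ + S₁ - S₀) (b := P₁) (c := Pm - D - E) (a' := S₀) (b' := 0)
      (c' := 0) (by rintro (_ | _ | _) (_ | _ | _) <;>
        simp only [trip, Commute.zero_left, Commute.zero_right] <;> assumption)
    rw [hval_left, mul_one, add_zero, add_zero] at this
    rw [← this]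
    congr 1
    abel
  rw [e1, e2] at key
  rw [← mul_assoc, key, mul_assoc, hval_dual hh S₀ (-S₀ - E), mul_one]

end ConfluenceIdentity

/-! ### The pairing, and orders of vanishing -/

section Pairing

variable {k : Type*} [CommRing k]

/-- Shuffles can be computed from the last letters as well as from the first ones. -/
theorem shCoeff_snoc {X : Type} : ∀ (n : ℕ) (u v : List X), u.length + v.length = n →
    ∀ (h : NCSeries k X) (a b : X), shCoeff h (u ++ [a]) (v ++ [b])
      = shCoeff (fun w => h (w ++ [a])) u (v ++ [b])
          + shCoeff (fun w => h (w ++ [b])) (u ++ [a]) v := by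
  intro n
  induction n with
  | zero =>
    intro u v huv h a b
    obtain ⟨rfl, rfl⟩ : u = [] ∧ v = [] := by simpa using huv
    simp [shCoeff_cons, shCoeff_nil_left, shCoeff_nil_right, add_comm]
  | succ n ih =>
    intro u v huv h a b
    rcases u with _ | ⟨x, u⟩ <;> rcases v with _ | ⟨y, v⟩
    · simp at huv
    · have := ih [] v (by simpa using huv) (fun w => h (y :: w)) a b
      simp only [List.nil_append, List.cons_append] at this ⊢
      rw [shCoeff_cons, this, shCoeff_cons]
      simp only [shCoeff_nil_left, List.cons_append]
      ring
    · have := ih u [] (by simpa using huv) (fun w => h (x :: w)) a b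
      simp only [List.nil_append, List.cons_append] at this ⊢
      rw [shCoeff_cons, this, shCoeff_cons]
      simp only [shCoeff_nil_right, List.cons_append]
      ring
    · have h1 := ih u (y :: v) (by simp at huv ⊢; omega) (fun w => h (x :: w)) a b
      have h2 := ih (x :: u) v (by simp at huv ⊢; omega) (fun w => h (y :: w)) a b
      simp only [List.cons_append] at h1 h2 ⊢
      rw [shCoeff_cons, h1, h2, shCoeff_cons, shCoeff_cons]
      simp only [List.cons_append]
      ring

theorem shCoeff_reverse {X : Type} : ∀ (n : ℕ) (u v : List X), u.length + v.length = n →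
    ∀ h : NCSeries k X, shCoeff (fun w => h w.reverse) u v = shCoeff h u.reverse v.reverse := by
  intro n
  induction n with
  | zero =>
    intro u v huv h
    obtain ⟨rfl, rfl⟩ : u = [] ∧ v = [] := by simpa using huv
    simp [shCoeff_nil_left]
  | succ n ih =>
    intro u v huv h
    rcases u with _ | ⟨x, u⟩
    · simp [shCoeff_nil_left]
    rcases v with _ | ⟨y, v⟩
    · simp [shCoeff_nil_right]
    rw [shCoeff_cons, List.reverse_cons, List.reverse_cons, shCoeff_snoc _ _ _ rfl]
    have h1 := ih u (y :: v) (by simp at huv ⊢; omega) (fun w => h (w ++ [x]))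
    have h2 := ih (x :: u) v (by simp at huv ⊢; omega) (fun w => h (w ++ [y]))
    simp only [List.reverse_cons] at h1 h2 ⊢
    rw [h1, h2]

theorem shuffles_map {X Y : Type} (f : X → Y) : ∀ u v : List X,
    shuffles (u.map f) (v.map f) = (shuffles u v).map (List.map f)
  | [], v => by simp [shuffles]
  | a :: u, [] => by simp [shuffles]
  | a :: u, b :: v => by
    have h1 := shuffles_map f u (b :: v)
    have h2 := shuffles_map f (a :: u) v
    simp only [List.map_cons] at h1 h2 ⊢
    rw [shuffles, shuffles, h1, h2]
    simp [Function.comp_def]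
termination_by u v => u.length + v.length

theorem isGroupLike_delta {h : NCSeries k L3} (hh : IsGroupLike h) : IsGroupLike (delta h) := by
  refine ⟨hh.1, fun u v => ?_⟩
  rw [coprodCoeff_eq, delta, delta, ← hh.2, coprodCoeff_eq, shCoeff, shCoeff, shuffles_map,
    List.map_map]
  rfl

variable [Algebra ℚ k]

theorem pairing_word {X : Type} (h : NCSeries k X) (w : List X) :
    pairing h (word w) = h w.reverse := by rw [pairing, linExt_word]

theorem pairing_one {X : Type} (h : NCSeries k X) : pairing h 1 = h [] := by
  rw [← word_nil, pairing_word]; rfl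

theorem pairing_mul_letter {X : Type} (h : NCSeries k X) (p : Alg X) (x : X) :
    pairing h (p * e x) = pairing (fun w => h (x :: w)) p := by
  have : pairing h ∘ₗ LinearMap.mulRight ℚ (e x) = pairing (fun w => h (x :: w)) :=
    ext_word fun w => by
      have : word w * e x = word (w ++ [x]) := by rw [word_append]; simp [word]
      rw [LinearMap.comp_apply, LinearMap.mulRight_apply, this, pairing_word, pairing_word]
      simp
  exact LinearMap.congr_fun this p

/-- Group-like series are characters of the shuffle algebra. -/
theorem pairing_sh {X : Type} [DecidableEq X] [Fintype X] {h : NCSeries k X} (hh : IsGroupLike h)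
    (p q : Alg X) : pairing h (sh p q) = pairing h p * pairing h q := by
  have hw : ∀ u v : List X, pairing h (sh (word u) (word v))
      = pairing h (word u) * pairing h (word v) := by
    intro u v
    rw [sh_word, map_list_sum, List.map_map, pairing_word, pairing_word, ← hh.2, coprodCoeff_eq,
      ← shCoeff_reverse _ _ _ rfl, shCoeff]
    simp only [Function.comp_def, pairing_word]
  have h1 : ∀ u, pairing h ∘ₗ sh (word u) = (pairing h (word u)) • pairing h := fun u =>
    ext_word fun v => by simpa using hw u v
  have h2 : pairing h ∘ₗ sh.flip q = (pairing h q) • pairing h := ext_word fun u => by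
    simpa [mul_comm] using LinearMap.congr_fun (h1 u) q
  simpa [mul_comm] using LinearMap.congr_fun h2 p

/-- The values of a series at linear combinations of letter operators: if the operator at `x` is
`∑ b, λ x b e_b`, its action pairs the initial part of words with `h` by the transposed
substitution `ψ`, `e_b ↦ ∑ x, λ x b e_x`. -/
theorem evc_mulLetter {X Y : Type} [Fintype X] [Fintype Y] [DecidableEq Y] (c : X → Y → ℚ)
    (A : X → Module.End k (NCSeries k Y)) 
    (hA : ∀ x, A x = ∑ b, algebraMap ℚ k (c x b) • mulLetter b)
    (ψ : Alg Y →ₐ[ℚ] Alg X) (hψ : ∀ b, ψ (e b) = ∑ x, c x b • e x) (n : ℕ) (h : NCSeries k X)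
    (F : NCSeries k Y) (l : List Y) :
    evc A n h F l
      = if n ≤ l.length then pairing h (ψ (word (l.take n).reverse)) * F (l.drop n) else 0 := by
  induction n generalizing h l with
  | zero => simp [evc, word_nil, pairing_one, Algebra.algebraMap_eq_smul_one]
  | succ n ih =>
    rw [evc, LinearMap.sum_apply, Finset.sum_apply]
    have hs : ∀ x (G : NCSeries k Y) l, A x G l
        = ∑ b, algebraMap ℚ k (c x b) * mulLetter b G l := by
      intro x G l
      rw [hA, LinearMap.sum_apply, Finset.sum_apply]
      rfl
    simp only [Module.End.mul_apply, hs]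
    cases l with
    | nil => simp [mulLetter_nil]
    | cons b l =>
      simp only [mulLetter_cons, mul_ite, mul_zero, Finset.sum_ite_eq, Finset.mem_univ, if_true,
        ih, List.length_cons, add_le_add_iff_right, List.take_succ_cons, List.drop_succ_cons,
        List.reverse_cons]
      split_ifs
      · have : word ((l.take n).reverse ++ [b]) = word (l.take n).reverse * e b := by
          rw [word_append]; simp [word]
        rw [this, map_mul, hψ, Finset.mul_sum, map_sum, Finset.sum_mul]
        refine Finset.sum_congr rfl fun x _ => ?_
        rw [mul_smul_comm, map_smul, pairing_mul_letter, Algebra.smul_def, mul_assoc]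
      · simp

end Pairing

section Orders

theorem rootMultiplicity_eq_of_eq_mul {p q : Polynomial ℚ} {c : ℚ} {n : ℕ} (hq : q.eval c ≠ 0)
    (hp : p = q * (Polynomial.X - Polynomial.C c) ^ n) : p.rootMultiplicity c = n := by
  rw [hp, Polynomial.rootMultiplicity_mul_X_sub_C_pow (by rintro rfl; simp at hq),
    Polynomial.rootMultiplicity_eq_zero (by simpa [Polynomial.IsRoot] using hq), zero_add]

/-- The orders of the differences of the letters `0, -1, z, -z²` at `z = c`. -/
def ordTable : L3 → LZ → LZ → ℕ
  | .zero, .zero, .z => 1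
  | .zero, .z, .zero => 1
  | .zero, .zero, .negZSq => 2
  | .zero, .negZSq, .zero => 2
  | .zero, .z, .negZSq => 1
  | .zero, .negZSq, .z => 1
  | .one, .negOne, .negZSq => 1
  | .one, .negZSq, .negOne => 1
  | .negOne, .negOne, .z => 1
  | .negOne, .z, .negOne => 1
  | .negOne, .negOne, .negZSq => 1
  | .negOne, .negZSq, .negOne => 1
  | .negOne, .z, .negZSq => 1
  | .negOne, .negZSq, .z => 1
  | _, _, _ => 0

open Polynomial in
theorem ordAt_sub (c : L3) (x y : LZ) : ordAt c (x.toPoly - y.toPoly) = ordTable c x y := by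
  rw [ordAt]
  cases c <;> cases x <;> cases y <;> simp only [LZ.toPoly, L3.toRat, ordTable, sub_self] <;>
  first
  | exact rootMultiplicity_zero
  | (refine rootMultiplicity_eq_of_eq_mul (q := _) (n := 0) ?_ (by rw [pow_zero, mul_one]) <;>
      norm_num)
  | (refine rootMultiplicity_eq_of_eq_mul (q := 1) ?_ (?_ : _ = _) <;> simp <;> ring; done)
  | (refine rootMultiplicity_eq_of_eq_mul (q := -1) ?_ (?_ : _ = _) <;> simp <;> ring; done)
  | (refine rootMultiplicity_eq_of_eq_mul (q := X) ?_ (?_ : _ = _) <;> simp <;> ring; done)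
  | (refine rootMultiplicity_eq_of_eq_mul (q := -X) ?_ (?_ : _ = _) <;> simp <;> ring; done)
  | (refine rootMultiplicity_eq_of_eq_mul (q := X + 1) ?_ (?_ : _ = _) <;> norm_num <;> ring; done)
  | (refine rootMultiplicity_eq_of_eq_mul (q := -(X + 1)) ?_ (?_ : _ = _) <;> norm_num; ring)
  | (refine rootMultiplicity_eq_of_eq_mul (q := X - 1) ?_ (?_ : _ = _) <;> norm_num <;> ring; done)
  | (refine rootMultiplicity_eq_of_eq_mul (q := -(X - 1)) ?_ (?_ : _ = _) <;> norm_num; ring)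

end Orders

/-! ### The transposes of the operators `∂_c` -/

instance : Fintype LZ := ⟨{.zero, .negOne, .z, .negZSq}, fun x => by cases x <;> decide⟩

theorem sum_LZ {M : Type*} [AddCommMonoid M] (f : LZ → M) :
    ∑ x, f x = f .zero + f .negOne + f .z + f .negZSq := by
  change ∑ x ∈ ({.zero, .negOne, .z, .negZSq} : Finset LZ), f x = _
  simp [add_assoc]

section

variable {k : Type*} [CommRing k]

/-- The transpose of `∂_c`, acting on series. -/
def partialOp (k : Type*) [CommRing k] (c : L3) : Module.End k (NCSeries k LZ) :=
  delOp (fun x y => (ordTable c x y : k)) (fun x => (ordTable c x .zero : k))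
    fun x => (ordTable c x .z : k)

theorem partialOp_lie (c : L3) (b : LZ) (f : NCSeries k LZ) (l : List LZ) :
    (partialOp k c * mulLetter b - mulLetter b * partialOp k c : Module.End k (NCSeries k LZ)) f l
      = ∑ y, ((ordTable c y b : k) - (ordTable c y .z : k)) *
        ((mulLetter b * mulLetter y - mulLetter y * mulLetter b :
          Module.End k (NCSeries k LZ)) f l) := by
  have := delOp_lie_mulLetter (fun x y => (ordTable c x y : k)) (fun x => (ordTable c x .zero : k))
    (fun x => (ordTable c x .z : k)) b
  rw [LieRing.of_associative_ring_bracket] at this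
  rw [partialOp, this, LinearMap.sum_apply, Finset.sum_apply]
  rfl

/-- The weights of `partialOp` are those of `∂_c`. Since the pairing reverses words, the left end of
words in `delFun` has `z`, and more generally `b`, as its neighbour, and the right end has `0`. -/
theorem delFun_reverse (c : L3) (v : List LZ) (b : LZ) (f : NCSeries k LZ) :
    delFun (fun x y => (ordTable c x y : k)) (fun x => (ordTable c x .zero : k))
      (fun x => (ordTable c x b : k)) f v.reverse
    = ∑ i ∈ Finset.Icc 1 v.length,
      ((ordTable c ((LZ.zero :: (v ++ [b])).getD i .zero)
          ((LZ.zero :: (v ++ [b])).getD (i + 1) .zero) : k)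
        - (ordTable c ((LZ.zero :: (v ++ [b])).getD i .zero)
          ((LZ.zero :: (v ++ [b])).getD (i - 1) .zero) : k)) * f (v.eraseIdx (i - 1)).reverse := by
  induction v using List.reverseRecOn generalizing b f with
  | nil => simp [delFun]
  | append_singleton v x ih =>
    rw [List.reverse_append, List.reverse_singleton, List.singleton_append, delFun, ih,
      List.length_append, List.length_singleton, Finset.sum_Icc_succ_top (by omega), add_comm]
    congr 1
    · refine Finset.sum_congr rfl fun i hi => ?_
      rw [Finset.mem_Icc] at hi
      have e1 : ∀ j ≤ v.length + 1, (LZ.zero :: (v ++ [x] ++ [b])).getD j .zero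
          = (LZ.zero :: (v ++ [x])).getD j .zero := fun j hj => by
        rw [← List.cons_append, List.getD_append]
        simp; omega
      have e2 : (v ++ [x]).eraseIdx (i - 1) = v.eraseIdx (i - 1) ++ [x] :=
        List.eraseIdx_append_of_lt_length (by omega) _
      rw [e1 i (by omega), e1 (i + 1) (by omega), e1 (i - 1) (by omega), e2, List.reverse_append]
      rfl
    · have e1 : (v ++ [x]).eraseIdx (v.length + 1 - 1) = v := by
        rw [List.eraseIdx_append_of_length_le (by omega)]
        simp
      have e2 : (LZ.zero :: (v ++ [x] ++ [b])).getD (v.length + 1) .zero = x := by simp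
      have e3 : (LZ.zero :: (v ++ [x] ++ [b])).getD (v.length + 1 + 1) .zero = b := by simp
      rw [e1, e2, e3]
      congr 2
      rcases List.eq_nil_or_concat v with rfl | ⟨v, y, rfl⟩
      · rfl
      · simp [nextWeight]

variable [Algebra ℚ k]

theorem pairing_partialOp (c : L3) (f : NCSeries k LZ) (u : Alg LZ) :
    pairing (partialOp k c f) u = pairing f (partialAt c u) := by
  have : pairing (partialOp k c f) = pairing f ∘ₗ partialAt c := ext_word fun w => by
    rw [pairing_word, LinearMap.comp_apply, partialAt, linExt_word]
    simp only [map_sum, map_smul, pairing_word, ordAt_sub]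
    refine (delFun_reverse c w .z f).trans (Finset.sum_congr rfl fun i _ => ?_)
    rw [Algebra.smul_def, map_sub, map_natCast, map_natCast]
  exact LinearMap.congr_fun this u

end

/-- A letter whose deletion leads out of `ℬ` stands between two equal letters, namely `0` and `0` or
`z` and `z`, so that its coefficient vanishes. -/
theorem partialAt_mem_spaceB (c : L3) {u : Alg LZ} (hu : u ∈ spaceB) : partialAt c u ∈ spaceB := by
  suffices spaceB ≤ spaceB.comap (partialAt c) from this hu
  refine Submodule.span_le.2 ?_
  rintro _ ⟨w, h0, h1, rfl⟩
  change partialAt c (word w) ∈ spaceB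
  rw [partialAt, linExt_word]
  refine Submodule.sum_mem _ fun i hi => ?_
  rw [Finset.mem_Icc] at hi
  obtain ⟨p, x, q, hp, rfl⟩ : ∃ p x q, p.length = i - 1 ∧ w = p ++ x :: q :=
    ⟨w.take (i - 1), w[i - 1], w.drop (i - 1 + 1), by simp; omega, by
      rw [← List.drop_eq_getElem_cons, List.take_append_drop]⟩
  obtain rfl : i = p.length + 1 := by omega
  simp only [ordAt_sub]
  have e1 : (LZ.zero :: (p ++ x :: q ++ [LZ.z])).getD (p.length + 1) .zero = x := by simp
  have e2 : (p ++ x :: q).eraseIdx (p.length + 1 - 1) = p ++ q := by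
    rw [List.eraseIdx_append_of_length_le (by omega)]; simp
  rw [e1, e2]
  by_cases hB : (p ++ q).head? ≠ some LZ.zero ∧ (p ++ q).getLast? ≠ some LZ.z
  · exact Submodule.smul_mem _ _ (Submodule.subset_span ⟨_, hB.1, hB.2, rfl⟩)
  have hz : (LZ.zero :: (p ++ x :: q ++ [LZ.z])).getD (p.length + 1 + 1) .zero
      = (LZ.zero :: (p ++ x :: q ++ [LZ.z])).getD (p.length + 1 - 1) .zero := by
    rcases List.eq_nil_or_concat p with rfl | ⟨p, y, rfl⟩ <;> rcases q with _ | ⟨y', q⟩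
    · simp at hB
    · simp_all
    · simp_all
    · exfalso
      cases p <;> simp_all [List.getLast?_cons, List.getLast?_append]
  rw [hz, sub_self, zero_smul]
  exact Submodule.zero_mem _

/-! ### Passage from `z = 1` to the vicinity of `z = 0` -/

section

variable {k : Type*} [CommRing k] {h : NCSeries k L3}

/-- The series `1`. -/
def oneSeries (k : Type*) [CommRing k] (X : Type) [DecidableEq X] : NCSeries k X :=
  fun l => if l = [] then 1 else 0

/-- At operators which kill a vector, a series acts on this vector by its constant term. -/
theorem evc_apply_of_kills {X : Type} [Fintype X] {M : Type*} [AddCommGroup M] [Module k M]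
    {A : X → Module.End k M} {v : M} (hv : ∀ x, A x v = 0) (n : ℕ) (h : NCSeries k X) :
    evc A n h v = if n = 0 then h [] • v else 0 := by
  induction n generalizing h with
  | zero => simp [evc, Algebra.algebraMap_eq_smul_one]
  | succ n ih =>
    rw [evc, LinearMap.sum_apply]
    simp only [Module.End.mul_apply, ih]
    rcases n with _ | n <;> simp [hv]

/-- The series `g(e_0 + e_{-z²}, e_z) g(e_0, -e_0 - e_{-z²})`, with `g = δ(h)`, relating the values
of `h` at `z = 1` and near `z = 0`. -/
def connection (h : NCSeries k L3) : PowerSeries (Module.End k (NCSeries k LZ)) :=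
  ev h (trip (mulLetter .zero + mulLetter .negZSq) (mulLetter .z) 0)
    * ev h (trip (mulLetter .zero) (-mulLetter .zero - mulLetter .negZSq) 0)

/-- The coefficients of `connection`. -/
def connectionSeries (h : NCSeries k L3) : NCSeries k LZ := fun l =>
  PowerSeries.coeff l.length (connection h) (oneSeries k LZ) l

/-- The confluence identity for the letters `0, z, -1, -z²` and the operators `∂_c`. -/
theorem connection_confluence (hh : h ∈ PENT2 k) :
    ev h (fun c => partialOp k c) * connection h
      = ev h (trip (mulLetter .zero) (mulLetter .z) (mulLetter .negOne + mulLetter .negZSq))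
        * ev h (trip (mulLetter .negZSq + partialOp k .zero + mulLetter .z - mulLetter .zero)
            (partialOp k .one) (partialOp k .negOne - mulLetter .negOne - mulLetter .negZSq)) := by
  have e1 : (fun c => partialOp k c)
      = trip (partialOp k .zero) (partialOp k .one) (partialOp k .negOne) := by
    ext c; cases c <;> rfl
  have h1 : ∀ {c b} {T : Module.End k (NCSeries k LZ)},
      (∀ f l, (∑ y, ((ordTable c y b : k) - (ordTable c y .z : k)) *
        ((mulLetter b * mulLetter y - mulLetter y * mulLetter b
          : Module.End k (NCSeries k LZ)) f l)) = T f l) →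
      partialOp k c * mulLetter b - mulLetter b * partialOp k c = T := fun hT =>
    LinearMap.ext fun f => funext fun l => (partialOp_lie _ _ f l).trans (hT f l)
  rw [e1]
  have := congrArg Units.val (confluence_of_lie' hh (S₀ := mulLetter .zero) (S₁ := mulLetter .z)
    (D := mulLetter .negOne) (E := mulLetter .negZSq) (P₀ := partialOp k .zero)
    (P₁ := partialOp k .one) (Pm := partialOp k .negOne) (h1 ?_) (h1 ?_) (h1 ?_) (h1 ?_) (h1 ?_)
    (h1 ?_) (h1 ?_) (h1 ?_) (h1 ?_) (h1 ?_) (h1 ?_) (h1 ?_))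
  · exact this
  all_goals
    intro f l
    simp only [sum_LZ, ordTable, LinearMap.sub_apply, LinearMap.add_apply, Pi.sub_apply,
      Pi.add_apply, LinearMap.zero_apply, Pi.zero_apply]
    push_cast
    ring

theorem partialOp_oneSeries (c : L3) : partialOp k c (oneSeries k LZ)
    = fun l => match l with
      | [x] => (ordTable c x .z : k) - (ordTable c x .zero : k)
      | _ => 0 := by
  funext l
  rcases l with _ | ⟨x, _ | ⟨y, l⟩⟩
  · rfl
  · simp [partialOp, delOp_cons, nextWeight, oneSeries, delOp_nil]
  · rw [partialOp, delOp_cons]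
    have : (fun w => oneSeries k LZ (x :: w)) = fun _ => (0 : k) := by
      ext w; simp [oneSeries]
    rw [this, delOp_zero]
    simp [oneSeries]

theorem mulLetter_oneSeries {X : Type} [DecidableEq X] (b : X) (l : List X) :
    mulLetter b (oneSeries k X) l = if l = [b] then 1 else 0 := by
  rcases l with _ | ⟨x, _ | ⟨y, l⟩⟩
  · simp [mulLetter_nil]
  · simp [mulLetter_cons, oneSeries]
  · simp [mulLetter_cons, oneSeries]

/-- `∂_c` deletes one letter, so its transpose at a word of length `n + 1` only involves words of
length `n`. -/
theorem partialOp_congr (c : L3) {f g : NCSeries k LZ} (l : List LZ)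
    (hfg : ∀ l', l'.length + 1 = l.length → f l' = g l') :
    partialOp k c f l = partialOp k c g l := by
  have : ∀ (m : LZ → LZ → k) (m₀ E : LZ → k) (f g : NCSeries k LZ),
      (∀ l', l'.length + 1 = l.length → f l' = g l') → delFun m m₀ E f l = delFun m m₀ E g l := by
    clear hfg
    induction l with
    | nil => intros; rfl
    | cons x l ih =>
      intro m m₀ E f g hfg
      rw [delFun, delFun, hfg l rfl, ih m m₀ _ _ _ fun l' hl' => hfg (x :: l') (by simpa using hl')]
  exact this _ _ _ _ _ hfg

theorem evc_partialOp_congr (n : ℕ) (h : NCSeries k L3) {f g : NCSeries k LZ} (l : List LZ)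
    (hfg : ∀ l', l'.length + n = l.length → f l' = g l') :
    evc (fun c => partialOp k c) n h f l = evc (fun c => partialOp k c) n h g l := by
  induction n generalizing h l with
  | zero => simp [evc, Algebra.algebraMap_eq_smul_one, hfg l rfl]
  | succ n ih =>
    rw [evc, LinearMap.sum_apply, LinearMap.sum_apply, Finset.sum_apply, Finset.sum_apply]
    refine Finset.sum_congr rfl fun c _ => partialOp_congr c l fun l' hl' => ih _ l' fun l'' hl'' =>
      hfg l'' (by omega)

/-- The operators in the second factor on the right hand side of `connection_confluence` kill the
series `1`: each of the operators `∂_c` differs from a combination of letters by an operator which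
does so. -/
theorem evc_oneSeries (h1 : h [] = 1) (n : ℕ) :
    evc (trip (mulLetter .negZSq + partialOp k .zero + mulLetter .z - mulLetter .zero)
      (partialOp k .one) (partialOp k .negOne - mulLetter .negOne - mulLetter .negZSq)) n h
        (oneSeries k LZ) = if n = 0 then oneSeries k LZ else 0 := by
  rw [evc_apply_of_kills, h1, one_smul]
  rintro (_ | _ | _) <;> funext l <;>
    simp only [trip, LinearMap.sub_apply, LinearMap.add_apply, Pi.sub_apply, Pi.add_apply,
      mulLetter_oneSeries, partialOp_oneSeries] <;>
    rcases l with _ | ⟨_ | _ | _ | _, _ | ⟨y, l⟩⟩ <;> simp [ordTable] <;> norm_num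

variable [Algebra ℚ k]

/-- The first factor on the right hand side of `connection_confluence` yields the values of `h`
after the substitution `z ↦ 1`. -/
theorem evc_mulLetter_atOne (n : ℕ) (h : NCSeries k L3) (F : NCSeries k LZ) (l : List LZ) :
    evc (trip (mulLetter .zero) (mulLetter .z) (mulLetter .negOne + mulLetter .negZSq)) n h F l
      = if n ≤ l.length then pairing h (atOne (word (l.take n).reverse)) * F (l.drop n) else 0 := by
  refine evc_mulLetter (fun
      | .zero, .zero => 1
      | .one, .z => 1
      | .negOne, .negOne => 1
      | .negOne, .negZSq => 1
      | _, _ => 0) _ ?_ atOne ?_ n h F l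
  · rintro (_ | _ | _) <;> simp [sum_LZ, trip]
  · rintro (_ | _ | _ | _) <;> simp [sum_L3, atOne]

/-- The series `h` at `z = 1`, expressed by `h` near `z = 0`. -/
theorem pairing_atOne (hh : h ∈ PENT2 k) (w : List LZ) : pairing h (atOne (word w))
    = ∑ i ∈ Finset.range (w.length + 1),
      evc (fun c => partialOp k c) i h (connectionSeries h) w.reverse := by
  have key := congrArg (fun f : PowerSeries (Module.End k (NCSeries k LZ)) =>
    PowerSeries.coeff w.length f (oneSeries k LZ) w.reverse)
    (connection_confluence hh)
  simp only [PowerSeries.coeff_mul, LinearMap.sum_apply, Finset.sum_apply, Module.End.mul_apply,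
    coeff_ev, Finset.Nat.sum_antidiagonal_eq_sum_range_succ_mk] at key
  -- On the right hand side, only the constant term of the second factor contributes.
  have hR : ∀ i ∈ Finset.range w.length.succ, evc (trip (mulLetter .zero) (mulLetter .z)
      (mulLetter .negOne + mulLetter .negZSq)) i h (evc (trip
        (mulLetter .negZSq + partialOp k .zero + mulLetter .z - mulLetter .zero) (partialOp k .one)
        (partialOp k .negOne - mulLetter .negOne - mulLetter .negZSq)) (w.length - i) h
          (oneSeries k LZ)) w.reverse
      = if i = w.length then pairing h (atOne (word w)) else 0 := by
    intro i hi
    have hi : i ≤ w.length := by simpa [Nat.lt_succ_iff] using hi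
    rw [evc_oneSeries hh.1.1, evc_mulLetter_atOne]
    by_cases h0 : i = w.length
    · subst h0
      rw [List.take_of_length_le (by simp), List.drop_eq_nil_of_le (by simp)]
      simp [oneSeries]
    · have : w.length - i ≠ 0 := by omega
      simp [h0, this]
  rw [Finset.sum_congr rfl hR, Finset.sum_ite_eq', if_pos (by simp)] at key
  rw [← key]
  refine Finset.sum_congr rfl fun i hi => ?_
  have hi : i ≤ w.length := by simpa [Nat.lt_succ_iff] using hi
  refine evc_partialOp_congr i h _ fun l' hl' => ?_
  have : w.length - i = l'.length := by rw [List.length_reverse] at hl'; omega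
  rw [connectionSeries, this]

theorem pairing_prod_partialOp (f : NCSeries k LZ) (c : List L3) (u : Alg LZ) :
    pairing ((c.reverse.map fun a => partialOp k a).prod f) u
      = pairing f (c.foldr (fun a u => partialAt a u) u) := by
  induction c generalizing f with
  | nil => simp
  | cons a c ih =>
    rw [List.foldr_cons, ← pairing_partialOp, ← ih]
    simp

theorem foldr_partialAt_mem (c : List L3) {u : Alg LZ} (hu : u ∈ spaceB) :
    c.foldr (fun a u => partialAt a u) u ∈ spaceB := by
  induction c with
  | nil => exact hu
  | cons a c ih => exact partialAt_mem_spaceB a ih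

/-- If `connectionSeries` computes `reg_{z → 0}` and `h` is compatible with `reg`, then the sum
which defines `φ` is the one in `pairing_atOne`, term by term. -/
theorem pairing_phi (hh : h ∈ PENT2 k) (h3 : ∀ x, pairing h (reg3 x) = pairing h x)
    (hZ : ∀ u ∈ spaceB, pairing (connectionSeries h) u = pairing h (regZ u)) (w : List LZ)
    (hw : word w ∈ spaceB) : pairing h (phi (word w)) = pairing h (atOne (word w)) := by
  rw [pairing_atOne hh, phi, linExt_word, map_sum]
  refine Finset.sum_congr rfl fun i _ => ?_
  rw [evc_eq_sum_map, LinearMap.sum_apply, Finset.sum_apply, map_sum,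
    ← (Equiv.arrowCongr Fin.revPerm (Equiv.refl L3)).sum_comp]
  refine Finset.sum_congr rfl fun c _ => ?_
  have hc : List.ofFn ((Equiv.arrowCongr Fin.revPerm (Equiv.refl L3)) c)
      = (List.ofFn c).reverse := by
    apply List.ext_getElem
    · simp
    · intro j h1 h2
      simp [Fin.rev]
      congr 2
      omega
  rw [pairing_sh hh.1, h3, ← hZ _ (foldr_partialAt_mem _ hw), ← pairing_prod_partialOp, hc,
    pairing_word, pairing_word, mul_comm, List.reverse_reverse]
  rfl

end

/-! ### Distribution relations and regularization -/

/-- Substitutions which are linear in the letters are homomorphisms for the shuffle product. -/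
theorem map_sh_of_letters {X Y : Type} [Fintype X] (c : X → Y → ℚ) (ψ : Alg Y →ₐ[ℚ] Alg X)
    (hψ : ∀ b, ψ (e b) = ∑ x, c x b • e x) (p q : Alg Y) : ψ (sh p q) = sh (ψ p) (ψ q) := by
  have hc : ∀ (a b : X → ℚ) (p q : Alg X), sh ((∑ x, a x • e x) * p) ((∑ x, b x • e x) * q)
      = (∑ x, a x • e x) * sh p ((∑ x, b x • e x) * q)
        + (∑ x, b x • e x) * sh ((∑ x, a x • e x) * p) q := by
    intro a b p q
    simp only [Finset.sum_mul, map_sum, LinearMap.sum_apply, smul_mul_assoc, map_smul,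
      LinearMap.smul_apply, sh_cons, smul_add, Finset.mul_sum, mul_smul_comm,
      Finset.sum_add_distrib]
    congr 1
    · simp only [Finset.smul_sum]
      rw [Finset.sum_comm]
      refine Finset.sum_congr rfl fun x _ => Finset.sum_congr rfl fun y _ => ?_
      rw [smul_comm]
  have hw : ∀ n, ∀ u v : List Y, u.length + v.length = n →
      ψ (sh (word u) (word v)) = sh (ψ (word u)) (ψ (word v)) := by
    intro n
    induction n with
    | zero =>
      intro u v h
      obtain ⟨rfl, rfl⟩ : u = [] ∧ v = [] := by simpa using h
      simp [word_nil, sh_one_left]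
    | succ n ih =>
      intro u v h
      rcases u with _ | ⟨a, u⟩
      · simp [word_nil, sh_one_left]
      rcases v with _ | ⟨b, v⟩
      · simp [word_nil, sh_one_right]
      have h1 := ih u (b :: v) (by simp at h ⊢; omega)
      have h2 := ih (a :: u) v (by simp at h ⊢; omega)
      rw [sh_cons_word, map_add, map_mul ψ, map_mul ψ, h1, h2, word_cons, word_cons, map_mul ψ,
        map_mul ψ, hψ, hψ, hc]
  have h1 : ∀ u, ψ.toLinearMap ∘ₗ sh (word u) = sh (ψ (word u)) ∘ₗ ψ.toLinearMap := fun u =>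
    ext_word fun v => hw _ u v rfl
  have h2 : ψ.toLinearMap ∘ₗ sh.flip q = sh.flip (ψ q) ∘ₗ ψ.toLinearMap :=
    ext_word fun u => LinearMap.congr_fun (h1 u) q
  exact LinearMap.congr_fun h2 p

theorem dist_sh (p q : Alg L01) : dist (sh p q) = sh (dist p) (dist q) := by
  refine map_sh_of_letters (fun
    | .zero, .zero => 2
    | .one, .one => 1
    | .negOne, .one => 1
    | _, _ => 0) dist ?_ p q
  rintro (_ | _) <;> simp [sum_L3, dist, two_smul, two_mul]

theorem regBar_sh (p q : Alg LZ) : regBar (sh p q) = sh (regBar p) (regBar q) := by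
  refine map_sh_of_letters (fun
    | .zero, .zero => 1
    | .zero, .negZSq => 1
    | .one, .z => 1
    | _, _ => 0) regBar ?_ p q
  rintro (_ | _ | _ | _) <;> simp [sum_L01, regBar]

section Characters

variable {k : Type*} [CommRing k] [Algebra ℚ k] {X : Type} [DecidableEq X] {χ : Alg X →ₗ[ℚ] k}

/-- A character of the shuffle algebra which vanishes at the powers of `e_x` is not changed by the
regularization with respect to `e_x`. -/
theorem character_regRight (hχ : ∀ p q, χ (sh p q) = χ p * χ q) {x : X}
    (hx : ∀ i ≠ 0, χ (word (List.replicate i x)) = 0) (p : Alg X) : χ (regRight x p) = χ p := by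
  have : χ ∘ₗ regRight x = χ := ext_word fun w => by
    rw [LinearMap.comp_apply, regRight, linExt_word, map_sum, Finset.sum_eq_single 0]
    · simp [word_nil, sh_one_right]
    · intro i _ hi
      split_ifs
      · rw [map_smul, hχ, hx i hi, mul_zero, smul_zero]
      · exact map_zero _
    · simp
  exact LinearMap.congr_fun this p

theorem character_regLeft (hχ : ∀ p q, χ (sh p q) = χ p * χ q) {x : X}
    (hx : ∀ i ≠ 0, χ (word (List.replicate i x)) = 0) (p : Alg X) : χ (regLeft x p) = χ p := by
  have : χ ∘ₗ regLeft x = χ := ext_word fun w => by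
    rw [LinearMap.comp_apply, regLeft, linExt_word, map_sum, Finset.sum_eq_single 0]
    · simp [word_nil, sh_one_right]
    · intro i _ hi
      split_ifs
      · rw [map_smul, hχ, hx i hi, mul_zero, smul_zero]
      · exact map_zero _
    · simp
  exact LinearMap.congr_fun this p

end Characters

theorem stripRight_word_snoc {X : Type} [DecidableEq X] (x a : X) (w : List X) :
    stripRight x (word (w ++ [a])) = if a = x then word w else 0 := by
  rw [stripRight, linExt_word]; simp

/-- Regularized elements are combinations of words which do not end with `e_x`: since stripping
`e_x` is a derivation, the sum telescopes. -/
theorem stripRight_regRight {X : Type} [DecidableEq X] (x : X) (p : Alg X) :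
    stripRight x (regRight x p) = 0 := by
  have : stripRight x ∘ₗ regRight x = 0 := ext_word fun w => by
    have hR : regRight x (word w) = ∑ i ∈ Finset.range (w.length + 1),
        (-1 : ℚ) ^ i • sh ((stripRight x ^ i) (word w)) (word (List.replicate i x)) := by
      rw [regRight, linExt_word]
      refine Finset.sum_congr rfl fun i hi => ?_
      have hi : i ≤ w.length := by simpa [Nat.lt_succ_iff] using hi
      rw [stripRight_pow]
      simp only [hi, true_and]
      split_ifs <;> simp
    have h0 : (stripRight x ^ (w.length + 1)) (word w) = 0 := by
      rw [stripRight_pow, if_neg]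
      rintro ⟨h, -⟩
      omega
    rw [LinearMap.comp_apply, hR, map_sum, LinearMap.zero_apply]
    have h1 : ∀ n, ∑ i ∈ Finset.range (n + 1), stripRight x
        ((-1 : ℚ) ^ i • sh ((stripRight x ^ i) (word w)) (word (List.replicate i x)))
        = (-1 : ℚ) ^ n • sh ((stripRight x ^ (n + 1)) (word w)) (word (List.replicate n x)) := by
      intro n
      induction n with
      | zero => simp [word_nil, sh_one_right]
      | succ n ih =>
        rw [Finset.sum_range_succ, ih, map_smul, stripRight_leibniz, ← Module.End.mul_apply,
          ← pow_succ', List.replicate_succ', stripRight_word_snoc, if_pos rfl, pow_succ (-1 : ℚ) n]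
        simp
    rw [h1, h0]
    simp
  exact LinearMap.congr_fun this p

section Values

variable {k : Type*} [CommRing k] {h : NCSeries k L3}

theorem evc_single {R : Type*} [Ring R] [Algebra k R] {X : Type} [Fintype X] [DecidableEq X]
    (x : X) (a : R) (n : ℕ) (h : NCSeries k X) :
    evc (fun y => if y = x then a else 0) n h = h (List.replicate n x) • a ^ n := by
  induction n generalizing h with
  | zero => simp [evc, Algebra.algebraMap_eq_smul_one]
  | succ n ih =>
    rw [evc, Finset.sum_eq_single x]
    · rw [ih, if_pos rfl, mul_smul_comm, ← pow_succ', List.replicate_succ]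
    · intro y _ hy
      rw [if_neg hy, zero_mul]
    · simp

theorem coeff_replicate_zero (hh : h ∈ PENT2 k) {n : ℕ} (hn : n ≠ 0) :
    h (List.replicate n .zero) = 0 := by
  have h1 := congrArg (fun f : (PowerSeries k)ˣ => PowerSeries.coeff n f.val) (hval_left hh (1 : k))
  have h2 : trip (1 : k) 0 0 = fun y => if y = L3.zero then 1 else 0 := by
    ext y; cases y <;> rfl
  simpa [val_hval, coeff_ev, h2, evc_single, PowerSeries.coeff_one, hn] using h1

theorem coeff_replicate_one (hh : h ∈ PENT2 k) {n : ℕ} (hn : n ≠ 0) :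
    h (List.replicate n .one) = 0 := by
  have h1 := congrArg (fun f : (PowerSeries k)ˣ => PowerSeries.coeff n f.val) (hval_mid hh (1 : k))
  have h2 : trip (0 : k) 1 0 = fun y => if y = L3.one then 1 else 0 := by
    ext y; cases y <;> rfl
  simpa [val_hval, coeff_ev, h2, evc_single, PowerSeries.coeff_one, hn] using h1

theorem delta_replicate_zero (hh : h ∈ PENT2 k) {n : ℕ} (hn : n ≠ 0) :
    delta h (List.replicate n .zero) = 0 := by
  rw [delta, List.map_replicate]; exact coeff_replicate_zero hh hn

theorem delta_replicate_one (hh : h ∈ PENT2 k) {n : ℕ} (hn : n ≠ 0) :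
    delta h (List.replicate n .one) = 0 := by
  rw [delta, List.map_replicate]; exact coeff_replicate_one hh hn

/-- The coefficient of a product of two values, at the unit series. -/
theorem coeff_mul_oneSeries {Y : Type} [Fintype Y] [DecidableEq Y]
    {U V : PowerSeries (Module.End k (NCSeries k Y))}
    {p q : List Y → k}
    (hU : ∀ n F l, PowerSeries.coeff n U F l
        = if n ≤ l.length then p (l.take n) * F (l.drop n) else 0)
    (hV : ∀ n F l, PowerSeries.coeff n V F l
        = if n ≤ l.length then q (l.take n) * F (l.drop n) else 0)
    (l : List Y) : PowerSeries.coeff l.length (U * V) (oneSeries k Y) l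
      = ∑ i ∈ Finset.range (l.length + 1), p (l.take i) * q (l.drop i) := by
  rw [PowerSeries.coeff_mul, Finset.Nat.sum_antidiagonal_eq_sum_range_succ_mk, LinearMap.sum_apply,
    Finset.sum_apply]
  refine Finset.sum_congr rfl fun i hi => ?_
  have hi : i ≤ l.length := by simpa [Nat.lt_succ_iff] using hi
  have e1 : (l.drop i).take (l.length - i) = l.drop i := List.take_of_length_le (by simp)
  have e2 : (l.drop i).drop (l.length - i) = [] := List.drop_eq_nil_of_le (by simp)
  rw [Module.End.mul_apply, hU, if_pos hi, hV, if_pos (by simp), e1, e2, oneSeries, if_pos rfl,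
    mul_one]

variable [Algebra ℚ k]

theorem pairing_reg3 (hh : h ∈ PENT2 k) (x : Alg L3) : pairing h (reg3 x) = pairing h x := by
  rw [reg3, regSh, LinearMap.comp_apply, character_regLeft (pairing_sh hh.1),
    character_regRight (pairing_sh hh.1)]
  · intro i hi
    rw [pairing_word, List.reverse_replicate, coeff_replicate_one hh hi]
  · intro i hi
    rw [pairing_word, List.reverse_replicate, coeff_replicate_zero hh hi]

/-- `evc_mulLetter` for `δ(h)`. -/
theorem evc_delta_mulLetter {Y : Type} [Fintype Y] [DecidableEq Y] (c : L01 → Y → ℚ)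
    {A₀ A₁ : Module.End k (NCSeries k Y)} (hA₀ : A₀ = ∑ b, algebraMap ℚ k (c .zero b) • mulLetter b)
    (hA₁ : A₁ = ∑ b, algebraMap ℚ k (c .one b) • mulLetter b) (ψ : Alg Y →ₐ[ℚ] Alg L01)
    (hψ : ∀ b, ψ (e b) = ∑ x, c x b • e x) (n : ℕ) (h : NCSeries k L3)
    (F : NCSeries k Y) (l : List Y) :
    evc (trip A₀ A₁ 0) n h F l
      = if n ≤ l.length then pairing (delta h) (ψ (word (l.take n).reverse)) * F (l.drop n)
        else 0 := by
  rw [← evc_delta]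
  refine evc_mulLetter c _ ?_ ψ hψ n (delta h) F l
  rintro (_ | _)
  · exact hA₀
  · exact hA₁

/-- The homomorphism with `e₀ ↦ 0` and `e₁ ↦ e₋₁`. -/
def oneToNegOne : Alg L01 →ₐ[ℚ] Alg L3 :=
  FreeAlgebra.lift ℚ fun
    | .zero => 0
    | .one => e .negOne

theorem oneToNegOne_word (v : List L01) : oneToNegOne (word v)
    = if v = List.replicate v.length .one then word (List.replicate v.length .negOne) else 0 := by
  induction v with
  | nil => simp [word_nil]
  | cons a v ih =>
    rw [word_cons, map_mul, ih, List.length_cons, List.replicate_succ, List.replicate_succ]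
    cases a <;> simp [oneToNegOne, word_cons]

/-- The distribution relation in coordinates: the values of `h` at `dist w` differ from those of
`δ(h)` at `w` only through the letters `1` at the end of `w`. -/
theorem pairing_dist_word (hh : h ∈ PENT2 k) (w : List L01) : pairing h (dist (word w))
    = ∑ i ∈ Finset.range (w.length + 1),
      h (List.replicate i .negOne) * pairing (delta h) ((stripRight .one ^ i) (word w)) := by
  have key := congrArg
    (fun f : (PowerSeries (Module.End k (NCSeries k L01)))ˣ =>
      PowerSeries.coeff w.reverse.length f.val (oneSeries k L01) w.reverse)
    (hval_dist hh (mulLetter L01.zero) (mulLetter L01.one))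
  simp only [Units.val_mul, val_hval] at key
  rw [coeff_mul_oneSeries (p := fun l => pairing h (oneToNegOne (word l.reverse)))
    (q := fun l => pairing (delta h) (word l.reverse)), coeff_ev, evc_mulLetter (fun
      | .zero, .zero => 2
      | .one, .one => 1
      | .negOne, .one => 1
      | _, _ => 0) _ _ dist, if_pos le_rfl, List.take_of_length_le le_rfl,
    List.drop_eq_nil_of_le le_rfl, oneSeries, if_pos rfl, mul_one, List.reverse_reverse] at key
  · rw [key, List.length_reverse]
    refine Finset.sum_congr rfl fun i hi => ?_
    have hi : i ≤ w.length := by simpa [Nat.lt_succ_iff] using hi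
    have e1 : (w.drop (w.length - i)).length = i := by simp; omega
    rw [List.take_reverse, List.drop_reverse, List.reverse_reverse, List.reverse_reverse,
      stripRight_pow, oneToNegOne_word, e1]
    split_ifs with h1 h2 h2
    · rw [pairing_word, List.reverse_replicate]
    · exact absurd ⟨hi, h1⟩ h2
    · exact absurd h2.2 h1
    · simp
  · rintro (_ | _) <;> simp [sum_L3, dist, two_smul, two_mul]
  · rintro (_ | _ | _) <;> simp [sum_L01, trip, two_smul]
  · intro n F l
    rw [coeff_ev]
    refine evc_mulLetter (fun
      | .negOne, .one => 1
      | _, _ => 0) _ ?_ oneToNegOne ?_ n h F l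
    · rintro (_ | _ | _) <;> simp [sum_L01, trip]
    · rintro (_ | _) <;> simp [sum_L3, oneToNegOne]
  · intro n F l
    rw [coeff_ev]
    refine evc_delta_mulLetter (fun
      | .zero, .zero => 1
      | .one, .one => 1
      | _, _ => 0) ?_ ?_ (AlgHom.id ℚ _) ?_ n h F l
    · simp [sum_L01]
    · simp [sum_L01]
    · rintro (_ | _) <;> simp [sum_L01]

/-- The distribution relation at combinations of words which do not end with `e₁`. -/
theorem pairing_dist (hh : h ∈ PENT2 k) {y : Alg L01} (hy : stripRight .one y = 0) :
    pairing h (dist y) = pairing (delta h) y := by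
  have key : ∀ y, ∃ N, ∀ M ≥ N, pairing h (dist y) = ∑ i ∈ Finset.range (M + 1),
      h (List.replicate i .negOne) * pairing (delta h) ((stripRight .one ^ i) y) := by
    refine word_induction ⟨0, fun M _ => by simp⟩ (fun w => ⟨w.length, fun M hM => ?_⟩) ?_ ?_
    · rw [pairing_dist_word hh]
      refine Finset.sum_subset (Finset.range_subset_range.2 (by omega)) fun i _ hi => ?_
      rw [stripRight_pow, if_neg, map_zero, mul_zero]
      rintro ⟨h1, -⟩
      exact hi (by simpa [Nat.lt_succ_iff] using h1)
    · rintro p q ⟨a, ha⟩ ⟨b, hb⟩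
      refine ⟨max a b, fun M hM => ?_⟩
      rw [map_add, map_add, ha M (le_trans (le_max_left _ _) hM),
        hb M (le_trans (le_max_right _ _) hM), ← Finset.sum_add_distrib]
      simp only [map_add, mul_add]
    · rintro c p ⟨a, ha⟩
      refine ⟨a, fun M hM => ?_⟩
      rw [map_smul, map_smul, ha M hM, Finset.smul_sum]
      simp only [map_smul, mul_smul_comm]
  obtain ⟨N, hN⟩ := key y
  rw [hN N le_rfl, Finset.sum_range_succ', Finset.sum_eq_zero]
  · simp [hh.1.1]
  · intro i _
    rw [pow_succ, Module.End.mul_apply, hy, map_zero, map_zero, mul_zero]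

theorem pairing_delta_sh (hh : h ∈ PENT2 k) (p q : Alg L01) :
    pairing (delta h) (sh p q) = pairing (delta h) p * pairing (delta h) q :=
  pairing_sh (isGroupLike_delta hh.1) p q

/-- The regularized distribution relation. As `dist` does not preserve the vanishing at the powers
of `e₁`, the two steps of the regularization are treated on different sides of `dist`. -/
theorem pairing_dist_reg01 (hh : h ∈ PENT2 k) (y : Alg L01) :
    pairing h (dist (reg01 y)) = pairing (delta h) y := by
  have h1 : ∀ p q, (pairing h ∘ₗ dist.toLinearMap) (sh p q)
      = (pairing h ∘ₗ dist.toLinearMap) p * (pairing h ∘ₗ dist.toLinearMap) q := fun p q => by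
    simp [dist_sh, pairing_sh hh.1]
  have h2 : ∀ i ≠ 0, (pairing h ∘ₗ dist.toLinearMap) (word (List.replicate i .zero)) = 0 := by
    intro i hi
    have : dist (word (List.replicate i .zero)) = (2 : ℚ) ^ i • word (List.replicate i .zero) := by
      have : dist (e .zero) = (2 : ℚ) • e .zero := by simp [dist, two_smul, two_mul]
      rw [word_replicate, map_pow, this, smul_pow, word_replicate]
    rw [LinearMap.comp_apply, AlgHom.toLinearMap_apply, this, map_smul, pairing_word,
      List.reverse_replicate, coeff_replicate_zero hh hi, smul_zero]
  have h3 := character_regLeft h1 h2 (regRight .one y)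
  rw [reg01, regSh, LinearMap.comp_apply]
  refine h3.trans ?_
  rw [LinearMap.comp_apply, AlgHom.toLinearMap_apply, pairing_dist hh (stripRight_regRight _ _),
    character_regRight (pairing_delta_sh hh)]
  intro i hi
  rw [pairing_word, List.reverse_replicate, delta_replicate_one hh hi]

end Values

/-! ### The regularization at `z → 0` -/

section Connection

variable {k : Type*} [CommRing k] {h : NCSeries k L3}

theorem constTerm_sh_cons {X : Type} (p : Alg X) (b : X) (v : List X) :
    constTerm X (sh p (word (b :: v))) = 0 := by
  have : (constTerm X).toLinearMap ∘ₗ sh.flip (word (b :: v)) = 0 := ext_word fun u => by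
    rcases u with _ | ⟨a, u⟩
    · simp [word_nil, sh_one_left, word_cons, constTerm]
    · rw [LinearMap.comp_apply, LinearMap.flip_apply, sh_cons_word, AlgHom.toLinearMap_apply,
        map_add, constTerm_cons, constTerm_cons, add_zero, LinearMap.zero_apply]
  exact LinearMap.congr_fun this p

theorem stripRight_word {X : Type} [DecidableEq X] {x : X} {w : List X}
    (hw : w.getLast? ≠ some x) : stripRight x (word w) = 0 := by
  rw [stripRight, linExt_word, if_neg hw]

theorem killNegOne_word (w : List LZ) :
    killNegOne (word w) = if LZ.negOne ∈ w then 0 else word w := by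
  induction w with
  | nil => simp [word_nil]
  | cons a w ih =>
    rw [word_cons, map_mul, ih]
    cases a <;> simp [killNegOne]

/-- The letter substitution underlying `regBar`. -/
def barLetter : LZ → L01
  | .z => .one
  | _ => .zero

/-- The letter substitution underlying `eps`. -/
def epsLetter : LZ → L01
  | .negZSq => .one
  | _ => .zero

theorem regBar_word (w : List LZ) :
    regBar (word w) = if LZ.negOne ∈ w then 0 else word (w.map barLetter) := by
  induction w with
  | nil => simp [word_nil]
  | cons a w ih =>
    rw [word_cons, map_mul, ih]
    cases a <;> simp [regBar, word_cons, barLetter]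

theorem eps_word (w : List LZ) :
    eps (word w) = if LZ.negOne ∈ w ∨ LZ.z ∈ w then 0 else word (w.map epsLetter) := by
  induction w with
  | nil => simp [word_nil]
  | cons a w ih =>
    rw [word_cons, map_mul, ih]
    cases a <;> simp [eps, word_cons, epsLetter]

theorem map_barLetter {w : List LZ} (hw : LZ.z ∉ w) :
    w.map barLetter = List.replicate w.length L01.zero := by
  induction w with
  | nil => rfl
  | cons a w ih =>
    rw [List.mem_cons, not_or] at hw
    rw [List.map_cons, ih hw.2, List.length_cons, List.replicate_succ]
    cases a <;> simp_all [barLetter]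

variable [Algebra ℚ k]

/-- The two factors of `connection` are `ϱ ∘ ε` and the substitution `u ↦ ū` on the values of
`δ(h)`. -/
theorem pairing_connectionSeries (h : NCSeries k L3) (w : List LZ) :
    pairing (connectionSeries h) (word w) = ∑ i ∈ Finset.range (w.length + 1),
      pairing (delta h) (varrho (eps (word (w.take i))))
        * pairing (delta h) (regBar (word (w.drop i))) := by
  rw [pairing_word, connectionSeries, connection, coeff_mul_oneSeries
    (p := fun l => pairing (delta h) (regBar (word l.reverse)))
    (q := fun l => pairing (delta h) ((varrho.comp eps) (word l.reverse)))]
  · rw [← Finset.sum_range_reflect, List.length_reverse]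
    refine Finset.sum_congr rfl fun i hi => ?_
    have hi : i ≤ w.length := by simpa [Nat.lt_succ_iff] using hi
    rw [List.take_reverse, List.drop_reverse, List.reverse_reverse, List.reverse_reverse, mul_comm,
      show w.length - (w.length + 1 - 1 - i) = i by omega]
    rfl
  · intro n F l
    rw [coeff_ev]
    refine evc_delta_mulLetter (fun
      | .zero, .zero => 1
      | .zero, .negZSq => 1
      | .one, .z => 1
      | _, _ => 0) ?_ ?_ regBar ?_ n h F l
    · simp [sum_LZ]
    · simp [sum_LZ]
    · rintro (_ | _ | _ | _) <;> simp [sum_L01, regBar]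
  · intro n F l
    rw [coeff_ev]
    refine evc_delta_mulLetter (fun
      | .zero, .zero => 1
      | .one, .zero => -1
      | .one, .negZSq => -1
      | _, _ => 0) ?_ ?_ (varrho.comp eps) ?_ n h F l
    · simp [sum_LZ]
    · refine LinearMap.ext fun F => funext fun l => ?_
      simp [sum_LZ, sub_eq_add_neg]
    · rintro (_ | _ | _ | _) <;> simp [sum_L01, eps, varrho, sub_eq_add_neg]

theorem pairing_delta_replicate (hh : h ∈ PENT2 k) {n : ℕ} (hn : n ≠ 0) :
    pairing (delta h) (word (List.replicate n .zero)) = 0 := by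
  rw [pairing_word, List.reverse_replicate, delta_replicate_zero hh hn]

/-- Initial letters `0` can be shuffled away. -/
theorem pairing_delta_replicate_append (hh : h ∈ PENT2 k) (m : ℕ) (y : Alg L01) :
    pairing (delta h) (word (List.replicate m .zero) * (e .one * y))
      = (-1) ^ m * pairing (delta h) (e .one * sh (word (List.replicate m .zero)) y) := by
  rw [← unshuffleZ_aux, map_sum, Finset.sum_eq_single 0]
  · rw [List.take_zero, word_nil, sh_one_right, map_smul, Algebra.smul_def]
    simp
  · intro i hi h0
    have hi : i ≤ m := by simpa [Nat.lt_succ_iff] using hi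
    rw [List.take_replicate, min_eq_left hi, map_smul, pairing_delta_sh hh,
      pairing_delta_replicate hh h0, mul_zero, smul_zero]
  · simp

theorem takeWhile_ne_append {u v : List LZ} (hv : LZ.z ∉ v) :
    (v ++ LZ.z :: u).takeWhile (· ≠ LZ.z) = v ∧
      (v ++ LZ.z :: u).dropWhile (· ≠ LZ.z) = LZ.z :: u := by
  induction v with
  | nil => simp
  | cons a v ih =>
    rw [List.mem_cons, not_or] at hv
    have := ih hv.2
    have ha : a ≠ LZ.z := fun h => hv.1 h.symm
    simp only [List.cons_append, List.takeWhile_cons, List.dropWhile_cons]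
    simp only [ne_eq, ha, not_false_eq_true, decide_true, if_true]
    exact ⟨congrArg _ this.1, this.2⟩

/-- The series `connection` computes the regularization at `z → 0`. -/
theorem pairing_connectionSeries_eq (hh : h ∈ PENT2 k)
    (hwp : ∀ v : List L01, v.head? ≠ some .zero →
      pairing h (wp (word v)) = pairing (delta h) (varrho (word v)))
    {u : Alg LZ} (hu : u ∈ spaceB) : pairing (connectionSeries h) u = pairing h (regZ u) := by
  induction hu using Submodule.span_induction with
  | zero => simp
  | add x y _ _ hx hy => rw [map_add, map_add, map_add, hx, hy]
  | smul c x _ hx => rw [map_smul, map_smul, map_smul, hx]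
  | mem x hx =>
  obtain ⟨w, h0, h1, rfl⟩ := hx
  rw [pairing_connectionSeries, regZ]
  simp only [LinearMap.comp_apply, AlgHom.toLinearMap_apply]
  rw [killNegOne_word]
  by_cases hneg : LZ.negOne ∈ w
  · rw [if_pos hneg, map_zero, map_zero, map_zero, map_zero]
    refine Finset.sum_eq_zero fun i _ => ?_
    rw [← List.take_append_drop i w, List.mem_append] at hneg
    rcases hneg with hneg | hneg
    · rw [eps_word, if_pos (Or.inl hneg), map_zero, map_zero, zero_mul]
    · rw [regBar_word, if_pos hneg, map_zero, mul_zero]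
  rw [if_neg hneg]
  have hneg' : ∀ i, LZ.negOne ∉ w.take i := fun i h => hneg (List.mem_of_mem_take h)
  have hneg'' : ∀ i, LZ.negOne ∉ w.drop i := fun i h => hneg (List.mem_of_mem_drop h)
  have hwp' : ∀ v : List LZ, v.head? ≠ some .zero →
      pairing h (wp (eps (word v))) = pairing (delta h) (varrho (eps (word v))) := by
    intro v hv
    rw [eps_word]
    split_ifs with hn
    · simp
    · refine hwp _ ?_
      rcases v with _ | ⟨a, v⟩
      · simp
      · cases a <;> simp_all [epsLetter]
  -- Without the letter `z` only the full initial segment contributes; otherwise the segments inside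
  -- the part `v` before the first `z` do, and the zeros in front of it are shuffled away.
  by_cases hz : LZ.z ∈ w
  · obtain ⟨v, u, rfl, hv⟩ : ∃ v u, w = v ++ LZ.z :: u ∧ LZ.z ∉ v := by
      obtain ⟨v, u, h⟩ := List.append_of_mem hz
      exact List.eq_append_cons_of_mem hz
    obtain ⟨ht, hd⟩ := takeWhile_ne_append (u := u) hv
    rw [unshuffleZ, linExt_word]
    simp only [ht, hd, map_sum, map_smul, TensorProduct.map_tmul, TensorProduct.lift.tmul,
      LinearMap.compl₁₂_apply, AlgHom.toLinearMap_apply]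
    rw [← Finset.sum_subset (Finset.range_subset_range.2
      (by simp : v.length + 1 ≤ (v ++ LZ.z :: u).length + 1))]
    · refine Finset.sum_congr rfl fun i hi => ?_
      have hi : i ≤ v.length := by simpa [Nat.lt_succ_iff] using hi
      have hu : u ≠ [] := by rintro rfl; simp at h1
      have hnu : LZ.negOne ∉ u := fun h => hneg (by simp [h])
      have hnv : LZ.negOne ∉ v.drop i := fun h => hneg (by simp [List.mem_of_mem_drop h])
      have hzv : LZ.z ∉ v.drop i := fun h => hv (List.mem_of_mem_drop h)
      have hhead : (v.take i).head? ≠ some .zero := by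
        rcases v with _ | ⟨a, v⟩
        · simp
        · rcases i with _ | i
          · simp
          · simpa using h0
      rw [List.take_append_of_le_length hi, List.drop_append_of_le_length hi, word_append,
        word_cons, map_mul regBar, map_mul regBar, pairing_sh hh.1, hwp' _ hhead,
        map_mul regBar, regBar_sh,
        regBar_word, if_neg hnv, regBar_word, if_neg hnu, regBar_word, if_neg (by simpa using hnv),
        List.map_reverse, map_barLetter hzv, List.reverse_replicate]
      have e1 : regBar (e .z) = e .one := by simp [regBar]
      rw [e1, pairing_delta_replicate_append hh, pairing_dist hh, List.length_drop,
        Algebra.smul_def]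
      · simp only [map_pow, map_neg, map_one]
        ring
      · obtain ⟨b, u', rfl⟩ := List.exists_cons_of_ne_nil hu
        rw [stripRight_cons, List.map_cons, constTerm_sh_cons, stripRight_leibniz,
          stripRight_word, ← List.map_cons, stripRight_word]
        · simp
        · rw [List.getLast?_map]
          rw [List.getLast?_append_of_ne_nil _ (by simp), List.getLast?_cons_cons] at h1
          intro hc
          obtain ⟨x, hx, hx'⟩ := Option.map_eq_some_iff.1 hc
          apply h1
          rw [hx]
          cases x <;> simp_all [barLetter]
        · intro hc
          have := List.mem_of_getLast? hc
          simp at this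
    · intro i _ hi
      have hi : v.length < i := by simpa using hi
      rw [eps_word, if_pos, map_zero, map_zero, zero_mul]
      right
      obtain ⟨j, rfl⟩ := Nat.exists_eq_add_of_lt hi
      rw [add_assoc, List.take_length_add_append]
      simp
  · have hd : w.dropWhile (· ≠ LZ.z) = [] := by
      rw [List.dropWhile_eq_nil_iff]
      intro x hx
      simp only [ne_eq, decide_eq_true_eq]
      rintro rfl
      exact hz hx
    have ht : w.takeWhile (· ≠ LZ.z) = w := by
      have := List.takeWhile_append_dropWhile (p := (· ≠ LZ.z)) (l := w)
      rwa [hd, List.append_nil] at this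
    rw [unshuffleZ, linExt_word]
    simp only [ht, hd, TensorProduct.map_tmul, TensorProduct.lift.tmul,
      LinearMap.compl₁₂_apply, AlgHom.toLinearMap_apply, map_one, sh_one_left]
    rw [hwp' _ h0, Finset.sum_eq_single w.length]
    · simp [word_nil, pairing_one, delta, hh.1.1]
    · intro i hi hne
      have hi : i ≤ w.length := by simpa [Nat.lt_succ_iff] using hi
      rw [regBar_word, if_neg (hneg'' i), map_barLetter fun h => hz (List.mem_of_mem_drop h),
        pairing_delta_replicate hh, mul_zero]
      rw [List.length_drop]
      omega
    · simp

end Connection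

/-! ### A solution of the relations by operators on triples of series -/

section OperatorTriples

variable {k : Type*} [CommRing k]

/-- Right multiplication by a letter. -/
def mulLetterRight {X : Type} [DecidableEq X] (b : X) : Module.End k (NCSeries k X) where
  toFun f l := mulLetter b (fun w => f w.reverse) l.reverse
  map_add' f g := by
    ext l
    exact congrFun (map_add (mulLetter b) (fun w => f w.reverse) fun w => g w.reverse) l.reverse
  map_smul' c f := by
    ext l
    exact congrFun (map_smul (mulLetter b) c fun w => f w.reverse) l.reverse

theorem mulLetterRight_nil {X : Type} [DecidableEq X] (b : X) (f : NCSeries k X) :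
    mulLetterRight b f [] = 0 := rfl

theorem mulLetterRight_snoc {X : Type} [DecidableEq X] (b x : X) (f : NCSeries k X) (l : List X) :
    mulLetterRight b f (l ++ [x]) = if x = b then f l else 0 := by
  change mulLetter b _ (l ++ [x]).reverse = _
  rw [List.reverse_append, List.reverse_singleton, List.singleton_append, mulLetter_cons,
    List.reverse_reverse]

theorem mulLetter_mulLetterRight {X : Type} [DecidableEq X] (a b : X) (f : NCSeries k X) :
    mulLetter a (mulLetterRight b f) = mulLetterRight b (mulLetter a f) := by
  funext l
  rcases l with _ | ⟨x, l⟩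
  · rfl
  rcases List.eq_nil_or_concat l with rfl | ⟨m, y, rfl⟩
  · rw [mulLetter_cons, mulLetterRight_nil, ← List.nil_append [x], mulLetterRight_snoc,
      mulLetter_nil]
    simp
  · rw [List.concat_eq_append, mulLetter_cons, mulLetterRight_snoc, ← List.cons_append,
      mulLetterRight_snoc, mulLetter_cons]
    split_ifs <;> rfl

theorem mulLetter_oneSeries_comm {X : Type} [DecidableEq X] (b : X) :
    mulLetterRight b (oneSeries k X) = mulLetter b (oneSeries k X) := by
  funext l
  rcases List.eq_nil_or_concat l with rfl | ⟨m, y, rfl⟩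
  · rfl
  · rw [List.concat_eq_append, mulLetterRight_snoc, mulLetter_oneSeries, oneSeries]
    rcases m with _ | ⟨x, m⟩ <;> simp

/-- The space `k⟨⟨e₀, e₁⟩⟩ × k⟨⟨e₀, e₁⟩⟩ × k`. -/
abbrev Triples (k : Type*) [CommRing k] : Type _ := NCSeries k L01 × NCSeries k L01 × k

/-- The operator `(v, a, c) ↦ (e₀ v, e₀ a, 0)`. -/
def opX0 (k : Type*) [CommRing k] : Module.End k (Triples k) :=
  (mulLetter L01.zero ∘ₗ LinearMap.fst k _ _).prod
    ((mulLetter L01.zero ∘ₗ LinearMap.fst k _ _ ∘ₗ LinearMap.snd k _ _).prod 0)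

/-- The operator `(v, a, c) ↦ (e₁ v, e₁ a + c, 0)`. -/
def opX1 (k : Type*) [CommRing k] : Module.End k (Triples k) :=
  (mulLetter L01.one ∘ₗ LinearMap.fst k _ _).prod
    ((mulLetter L01.one ∘ₗ LinearMap.fst k _ _ ∘ₗ LinearMap.snd k _ _
      + (LinearMap.toSpanSingleton k _ (oneSeries k L01)) ∘ₗ LinearMap.snd k _ _
        ∘ₗ LinearMap.snd k _ _).prod 0)

/-- The operator `(v, a, c) ↦ (c, 0, 0)`. -/
def opD (k : Type*) [CommRing k] : Module.End k (Triples k) :=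
  ((LinearMap.toSpanSingleton k _ (oneSeries k L01)) ∘ₗ LinearMap.snd k _ _
        ∘ₗ LinearMap.snd k _ _).prod 0

/-- The operator `(v, a, c) ↦ (v (e₀ + e₁), 0, 0)`. -/
def opY0 (k : Type*) [CommRing k] : Module.End k (Triples k) :=
  ((mulLetterRight L01.zero + mulLetterRight L01.one) ∘ₗ LinearMap.fst k _ _).prod 0

/-- The operator `(v, a, c) ↦ ((a - v) e₁, 0, 0)`. -/
def opY1 (k : Type*) [CommRing k] : Module.End k (Triples k) :=
  (mulLetterRight L01.one ∘ₗ (LinearMap.fst k _ _ ∘ₗ LinearMap.snd k _ _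
    - LinearMap.fst k _ _)).prod 0

theorem opX0_apply (m : Triples k) : opX0 k m
    = (mulLetter .zero m.1, mulLetter .zero m.2.1, 0) := rfl
theorem opX1_apply (m : Triples k) : opX1 k m
    = (mulLetter .one m.1, mulLetter .one m.2.1 + m.2.2 • oneSeries k L01, 0) := rfl
theorem opD_apply (m : Triples k) : opD k m = (m.2.2 • oneSeries k L01, 0, 0) := rfl
theorem opY0_apply (m : Triples k) : opY0 k m
    = (mulLetterRight .zero m.1 + mulLetterRight .one m.1, 0, 0) := rfl
theorem opY1_apply (m : Triples k) : opY1 k m = (mulLetterRight .one (m.2.1 - m.1), 0, 0) := rfl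

set_option linter.unusedSimpArgs false in
/-- The solution of the relations given by these operators. -/
def triplesRep (k : Type*) [CommRing k] : Rep (Module.End k (Triples k)) where
  t12 := opX0 k
  t13 := opY0 k - opX0 k - opX1 k
  t23 := opX1 k
  t24 := opD k
  t34 := opY1 k
  tri1 := LinearMap.ext fun m => by
    simp [opX0_apply, opX1_apply, opD_apply, opY0_apply, opY1_apply, mulLetter_mulLetterRight,
      mulLetter_oneSeries_comm, Prod.ext_iff]
    abel
  tri4 := LinearMap.ext fun m => by
    simp [opX0_apply, opX1_apply, opD_apply, opY0_apply, opY1_apply, mulLetter_mulLetterRight,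
      mulLetter_oneSeries_comm, Prod.ext_iff]
  tri5 := LinearMap.ext fun m => by
    simp [opX0_apply, opX1_apply, opD_apply, opY0_apply, opY1_apply, mulLetter_mulLetterRight,
      mulLetter_oneSeries_comm, Prod.ext_iff]
  tri9 := LinearMap.ext fun m => by
    simp [opX0_apply, opX1_apply, opD_apply, opY0_apply, opY1_apply, mulLetter_mulLetterRight,
      mulLetter_oneSeries_comm, Prod.ext_iff]
  cen1 := LinearMap.ext fun m => by
    simp [opX0_apply, opX1_apply, opD_apply, opY0_apply, opY1_apply, mulLetter_mulLetterRight,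
      mulLetter_oneSeries_comm, Prod.ext_iff]
    exact ⟨by abel, by abel⟩
  pole1 := LinearMap.ext fun m => by
    simp [opX0_apply, opX1_apply, opD_apply, opY0_apply, opY1_apply, mulLetter_mulLetterRight,
      mulLetter_oneSeries_comm, Prod.ext_iff]
  pole2 := LinearMap.ext fun m => by
    simp [opX0_apply, opX1_apply, opD_apply, opY0_apply, opY1_apply, mulLetter_mulLetterRight,
      mulLetter_oneSeries_comm, Prod.ext_iff]
    exact ⟨by abel, by abel⟩
  dis1 := LinearMap.ext fun m => by
    simp [opX0_apply, opX1_apply, opD_apply, opY0_apply, opY1_apply, mulLetter_mulLetterRight,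
      mulLetter_oneSeries_comm, Prod.ext_iff]
  dis3 := LinearMap.ext fun m => by
    simp [opX0_apply, opX1_apply, opD_apply, opY0_apply, opY1_apply, mulLetter_mulLetterRight,
      mulLetter_oneSeries_comm, Prod.ext_iff]

end OperatorTriples

/-! ### A relation among the coefficients of `δ(h)` -/

section StarRelation

variable {k : Type*} [CommRing k] {h : NCSeries k L3}

/-- The innermost letter of the words acts first. -/
theorem evc_snoc {R : Type*} [Ring R] [Algebra k R] {X : Type} [Fintype X] (A : X → R) (n : ℕ)
    (h : NCSeries k X) : evc A (n + 1) h = ∑ x, evc A n (fun w => h (w ++ [x])) * A x := by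
  induction n generalizing h with
  | zero => simp [evc, Algebra.commutes]
  | succ n ih =>
    conv_lhs => rw [evc]
    simp_rw [fun x => ih fun w => h (x :: w), Finset.mul_sum]
    rw [Finset.sum_comm]
    refine Finset.sum_congr rfl fun x _ => ?_
    rw [evc, Finset.sum_mul]
    exact Finset.sum_congr rfl fun y _ => (mul_assoc _ _ _).symm

/-- An equivariant linear map commutes with the action of series. -/
theorem evc_intertwine {M N : Type*} [AddCommGroup M] [Module k M] [AddCommGroup N] [Module k N]
    {X : Type} [Fintype X] {A : X → Module.End k M} {B : X → Module.End k N} (ι : N →ₗ[k] M)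
    (hAB : ∀ x v, A x (ι v) = ι (B x v)) (n : ℕ) (h : NCSeries k X) (v : N) :
    evc A n h (ι v) = ι (evc B n h v) := by
  induction n generalizing h with
  | zero => simp [evc, Algebra.algebraMap_eq_smul_one]
  | succ n ih =>
    simp only [evc, LinearMap.sum_apply, Module.End.mul_apply, ih, hAB, map_sum]

/-- The series in degree `n - 1` obtained from the part of `δ(h)` of degree `n` by keeping the words
which end with the letter `1` and removing this letter. -/
def tailSeries (h : NCSeries k L3) (n : ℕ) : NCSeries k L01 := fun l =>
  if l.length + 1 = n then delta h (l ++ [.one]) else 0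

/-- A series vanishes at the words which contain the letter `0`. -/
def OnlyOnes (f : NCSeries k L01) : Prop := ∀ l, L01.zero ∈ l → f l = 0

theorem OnlyOnes.add {f g : NCSeries k L01} (hf : OnlyOnes f) (hg : OnlyOnes g) :
    OnlyOnes (f + g) := fun l hl => by rw [Pi.add_apply, hf l hl, hg l hl, add_zero]

theorem OnlyOnes.smul {f : NCSeries k L01} (hf : OnlyOnes f) (c : k) :
    OnlyOnes (c • f) := fun l hl => by rw [Pi.smul_apply, hf l hl, smul_zero]

theorem OnlyOnes.mulLetter {f : NCSeries k L01} (hf : OnlyOnes f) :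
    OnlyOnes (mulLetter .one f) := by
  rintro (_ | ⟨x, l⟩) hl
  · rfl
  · rw [mulLetter_cons]
    split_ifs with hx
    · subst hx
      exact hf l (by simpa using hl)
    · rfl

theorem OnlyOnes.mulLetterRight {f : NCSeries k L01} (hf : OnlyOnes f) :
    OnlyOnes (mulLetterRight .one f) := by
  intro l hl
  rcases List.eq_nil_or_concat l with rfl | ⟨m, y, rfl⟩
  · rfl
  · rw [List.concat_eq_append] at hl ⊢
    rw [mulLetterRight_snoc]
    split_ifs with hx
    · subst hx
      exact hf m (by simpa using hl)
    · rfl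

theorem onlyOnes_oneSeries : OnlyOnes (oneSeries k L01) := by
  intro l hl
  rw [oneSeries, if_neg]
  rintro rfl
  simp at hl

/-- The submodule of the triples whose first two components vanish at the words containing `0`. -/
def onlyOnesTriples (k : Type*) [CommRing k] : Submodule k (Triples k) where
  carrier := {m | OnlyOnes m.1 ∧ OnlyOnes m.2.1}
  zero_mem' := ⟨fun _ _ => rfl, fun _ _ => rfl⟩
  add_mem' h₁ h₂ := ⟨h₁.1.add h₂.1, h₁.2.add h₂.2⟩
  smul_mem' c _ h := ⟨h.1.smul c, h.2.smul c⟩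

theorem opX1_mem {m : Triples k} (hm : m ∈ onlyOnesTriples k) : opX1 k m ∈ onlyOnesTriples k :=
  ⟨hm.1.mulLetter, hm.2.mulLetter.add (onlyOnes_oneSeries.smul _)⟩

theorem opY1_mem {m : Triples k} (hm : OnlyOnes (m.2.1 - m.1)) : opY1 k m ∈ onlyOnesTriples k :=
  ⟨hm.mulLetterRight, fun _ _ => rfl⟩

theorem onlyOnes_opX1_pow {m : Triples k} (hm : OnlyOnes (m.2.1 - m.1)) (n : ℕ) :
    OnlyOnes (((opX1 k ^ n) m).2.1 - ((opX1 k ^ n) m).1) := by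
  induction n with
  | zero => exact hm
  | succ n ih =>
    rw [pow_succ', Module.End.mul_apply]
    generalize (opX1 k ^ n) m = m' at ih
    rw [opX1_apply]
    dsimp only
    rw [add_sub_right_comm, ← map_sub]
    exact ih.mulLetter.add (onlyOnes_oneSeries.smul _)

/-- Up to triples supported on powers of `e₁`, only the words without `e⁰` matter in the action of
`h(Y₁, X₁)`; here `Y₁` and `X₁` are `opY1` and `opX1`. -/
theorem evc_opY1_opX1 {m : Triples k} (hm : OnlyOnes (m.2.1 - m.1)) (n : ℕ) (h : NCSeries k L3) :
    evc (trip (opY1 k) (opX1 k) 0) n h m - h (List.replicate n .one) • (opX1 k ^ n) m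
      ∈ onlyOnesTriples k := by
  induction n generalizing h with
  | zero => simp [evc, Algebra.algebraMap_eq_smul_one]
  | succ n ih =>
    have h0 := ih fun w => h (.zero :: w)
    have h1 := ih fun w => h (.one :: w)
    rw [evc, sum_L3]
    simp only [trip, LinearMap.add_apply, Module.End.mul_apply, LinearMap.zero_apply, add_zero]
    have e1 := opX1_mem h1
    have e0 : opX1 k ((opX1 k ^ n) m) = (opX1 k ^ (n + 1)) m := by
      rw [pow_succ', Module.End.mul_apply]
    rw [map_sub, map_smul, e0, ← List.replicate_succ] at e1
    rw [add_sub_assoc]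
    refine add_mem (opY1_mem ?_) e1
    have e2 := h0.2.add (h0.1.smul (-1))
    have e3 := (onlyOnes_opX1_pow hm n).smul (h (.zero :: List.replicate n .one))
    have := e2.add e3
    intro l hl
    have := this l hl
    simp only [Pi.add_apply, Pi.smul_apply, Pi.sub_apply, smul_eq_mul, Prod.fst_sub, Prod.snd_sub,
      Prod.smul_fst, Prod.smul_snd] at this ⊢
    linear_combination this

/-- The first component, with words read backwards. -/
def firstReversed (k : Type*) [CommRing k] : NCSeries k L01 →ₗ[k] Triples k :=
  (LinearMap.funLeft k k List.reverse).prod 0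

theorem firstReversed_apply (v : NCSeries k L01) :
    firstReversed k v = (fun w => v w.reverse, 0, 0) := rfl

theorem coeff_mul_apply {M : Type*} [AddCommGroup M] [Module k M]
    (P Q : PowerSeries (Module.End k M)) (n : ℕ) (m : M) : PowerSeries.coeff n (P * Q) m
      = ∑ i ∈ Finset.range (n + 1), PowerSeries.coeff i P (PowerSeries.coeff (n - i) Q m) := by
  rw [PowerSeries.coeff_mul, Finset.Nat.sum_antidiagonal_eq_sum_range_succ_mk, LinearMap.sum_apply]
  rfl

variable [Algebra ℚ k]

theorem evc_letters_oneSeries (n : ℕ) (h : NCSeries k L3) :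
    evc (trip (mulLetter L01.zero) (mulLetter L01.one) 0) n h (oneSeries k L01)
      = fun l => if l.length = n then delta h l else 0 := by
  funext l
  rw [evc_delta_mulLetter (fun
      | .zero, .zero => 1
      | .one, .one => 1
      | _, _ => 0) (by simp [sum_L01]) (by simp [sum_L01]) (AlgHom.id ℚ _)
    (by rintro (_ | _) <;> simp [sum_L01])]
  by_cases hl : l.length = n
  · subst hl
    simp [oneSeries, pairing_word]
  · rw [if_neg hl]
    split_ifs with h1
    · have : l.drop n ≠ [] := by
        rw [Ne, List.drop_eq_nil_iff]; omega
      simp [oneSeries, this]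
    · rfl

theorem evc_letters_snoc (n : ℕ) (h : NCSeries k L3) :
    evc (trip (mulLetter L01.zero) (mulLetter L01.one) 0) n (fun w => h (w ++ [.one]))
      (oneSeries k L01) = tailSeries h (n + 1) := by
  rw [evc_letters_oneSeries]
  funext l
  simp [tailSeries, delta, L01.toL3]

/-- The action of `h(X₀, X₁ + D)` on `(0, 0, 1)`, via the diagonal `v ↦ (v, v, 0)`. -/
theorem evc_diagonal (n : ℕ) (h : NCSeries k L3) :
    evc (trip (opX0 k) (opX1 k + opD k) 0) n h (0, 0, 1)
      = if n = 0 then h [] • (0, 0, 1) else (tailSeries h n, tailSeries h n, 0) := by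
  rcases n with _ | n
  · simp [evc, Algebra.algebraMap_eq_smul_one]
  · have e1 : (opX1 k + opD k) (0, 0, 1)
        = ((LinearMap.id : NCSeries k L01 →ₗ[k] NCSeries k L01).prod
        (LinearMap.id.prod (0 : NCSeries k L01 →ₗ[k] k))) (oneSeries k L01) := by
      simp [opX1_apply, opD_apply]
    have e0 : opX0 k (0, 0, 1) = 0 := by simp [opX0_apply]
    rw [evc_snoc, sum_L3]
    simp only [trip, LinearMap.add_apply, Module.End.mul_apply, LinearMap.zero_apply, map_zero,
      add_zero]
    rw [← LinearMap.add_apply, e1, evc_intertwine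
      (N := NCSeries k L01) (B := trip (mulLetter L01.zero) (mulLetter L01.one) 0),
          evc_letters_snoc]
    · rw [e0, map_zero, zero_add, if_neg (Nat.succ_ne_zero n)]
      rfl
    · rintro (_ | _ | _) v <;> simp [trip, opX0_apply, opX1_apply, opD_apply]
      rfl

/-- The action of `h(X₀, X₁)` on `(0, 0, 1)`, via the inclusion `a ↦ (0, a, 0)`. -/
theorem evc_second (n : ℕ) (h : NCSeries k L3) :
    evc (trip (opX0 k) (opX1 k) 0) n h (0, 0, 1)
      = if n = 0 then h [] • (0, 0, 1) else (0, tailSeries h n, 0) := by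
  rcases n with _ | n
  · simp [evc, Algebra.algebraMap_eq_smul_one]
  · have e1 : opX1 k (0, 0, 1) = ((0 : NCSeries k L01 →ₗ[k] NCSeries k L01).prod
        (LinearMap.id.prod (0 : NCSeries k L01 →ₗ[k] k))) (oneSeries k L01) := by
      simp [opX1_apply]
    have e0 : opX0 k (0, 0, 1) = 0 := by simp [opX0_apply]
    rw [evc_snoc, sum_L3]
    simp only [trip, LinearMap.add_apply, Module.End.mul_apply, LinearMap.zero_apply, map_zero,
      add_zero]
    rw [e1, evc_intertwine
      (N := NCSeries k L01) (B := trip (mulLetter L01.zero) (mulLetter L01.one) 0),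
          evc_letters_snoc]
    · rw [e0, map_zero, zero_add, if_neg (Nat.succ_ne_zero n)]
      rfl
    · rintro (_ | _ | _) v <;> simp [trip, opX0_apply, opX1_apply]
      rfl

/-- The homomorphism with `e₀ ↦ e₀` and `e₁ ↦ e₀ - e₁`. -/
def starSub : Alg L01 →ₐ[ℚ] Alg L01 :=
  FreeAlgebra.lift ℚ fun
    | .zero => e .zero
    | .one => e .zero - e .one

/-- The value of `δ(h)` at `e₁ w`, with `e₁` replaced by `e₀ - e₁` in `w`. -/
def starValue (h : NCSeries k L3) (w : List L01) : k :=
  pairing (delta h) (e .one * starSub (word w))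

theorem pairing_letter_mul {X : Type} (h : NCSeries k X) (p : Alg X) (x : X) :
    pairing h (e x * p) = pairing (fun w => h (w ++ [x])) p := by
  have : pairing h ∘ₗ LinearMap.mulLeft ℚ (e x) = pairing (fun w => h (w ++ [x])) :=
    ext_word fun w => by
      rw [LinearMap.comp_apply, LinearMap.mulLeft_apply, ← word_cons, pairing_word, pairing_word,
        List.reverse_cons]
  exact LinearMap.congr_fun this p

/-- The action of `h(Y₀, D + Y₁)` on `(0, a, c)`: the innermost letter maps the vector to the first
component, where `Y₀` and `D + Y₁` multiply by `e₀ + e₁` and `-e₁` from the right. -/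
theorem evc_first (n : ℕ) (h : NCSeries k L3) (a : NCSeries k L01) (c : k) (l : List L01) :
    (evc (trip (opY0 k) (opD k + opY1 k) 0) (n + 1) h (0, a, c)).1 l
      = if n ≤ l.length then starValue h (l.drop (l.length - n)) *
          (mulLetterRight .one a + c • oneSeries k L01) (l.take (l.length - n)) else 0 := by
  set F : NCSeries k L01 := mulLetterRight .one a + c • oneSeries k L01 with hF
  have e1 : (opD k + opY1 k) (0, a, c) = firstReversed k fun w => F w.reverse := by
    rw [LinearMap.add_apply, opD_apply, opY1_apply, firstReversed_apply]
    refine Prod.ext (funext fun w => ?_) (by simp)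
    simp [hF, add_comm]
  rw [evc_snoc, sum_L3]
  simp only [trip, LinearMap.add_apply, Module.End.mul_apply, LinearMap.zero_apply, map_zero,
    add_zero]
  rw [← LinearMap.add_apply, e1, evc_intertwine
    (N := NCSeries k L01)
    (B := trip (mulLetter L01.zero + mulLetter L01.one) (-mulLetter L01.one) 0)]
  · have e2 : opY0 k (0, a, c) = 0 := by simp [opY0_apply]
    rw [e2, map_zero, zero_add]
    change (evc (trip (mulLetter L01.zero + mulLetter L01.one) (-mulLetter L01.one)
      (0 : Module.End k (NCSeries k L01))) n (fun w => h (w ++ [.one])) fun w => F w.reverse)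
        l.reverse = _
    rw [evc_delta_mulLetter (fun
      | .zero, _ => 1
      | .one, .one => -1
      | _, _ => 0) ?_ ?_ starSub ?_, List.length_reverse]
    · refine if_congr Iff.rfl ?_ rfl
      rw [List.take_reverse, List.drop_reverse, List.reverse_reverse, List.reverse_reverse,
        starValue, pairing_letter_mul]
      congr 3
      funext w
      simp [delta, L01.toL3]
    · simp [sum_L01]
    · refine LinearMap.ext fun F => funext fun l => ?_
      simp [sum_L01]
    · rintro (_ | _) <;> simp [sum_L01, starSub, sub_eq_add_neg]
  · have e3 : ∀ (b : L01) (v : NCSeries k L01) (w : List L01),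
        mulLetterRight b (fun w => v w.reverse) w = mulLetter b v w.reverse := by
      intro b v w
      change mulLetter b (fun w => v w.reverse.reverse) w.reverse = _
      simp
    rintro (_ | _ | _) v
    · refine Prod.ext (funext fun w => ?_) rfl
      change (mulLetterRight _ _ + mulLetterRight _ _ : NCSeries k L01) w
        = (mulLetter _ _ + mulLetter _ _ : NCSeries k L01) w.reverse
      exact congrArg₂ (· + ·) (e3 _ v w) (e3 _ v w)
    · refine Prod.ext (funext fun w => ?_) (by simp [trip, opD_apply, opY1_apply,
        firstReversed_apply])
      have := e3 .one v w
      simp [trip, opD_apply, opY1_apply, firstReversed_apply, this]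
    · simp [trip]

/-- The pentagon equation for `triplesRep`, in coordinates. -/
theorem delta_snoc_one (hh : h ∈ PENT2 k) {l : List L01} (hl : L01.zero ∈ l) :
    delta h (l ++ [.one]) = ∑ j ∈ Finset.range (l.length + 1),
      (if (l.take j).getLast? = some .zero then 0 else delta h (l.take j))
        * starValue h (l.drop j) := by
  have key : hval hh (opX0 k) (opX1 k + opD k) 0 * hval hh (opY0 k - opX0 k) (opY1 k) 0
      = hval hh (opX1 k) (opY1 k) 0 * hval hh (opY0 k) (opD k + opY1 k) 0
        * hval hh (opX0 k) (opX1 k) 0 := by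
    convert (triplesRep k).pentagon hh using 3 <;> dsimp only [triplesRep] <;> abel_nf
  -- By duality `h(Y₁, X₁)` is inverse to `h(X₁, Y₁)`.
  have key2 : hval hh (opY1 k) (opX1 k) 0 * hval hh (opX0 k) (opX1 k + opD k) 0
        * hval hh (opY0 k - opX0 k) (opY1 k) 0
      = hval hh (opY0 k) (opD k + opY1 k) 0 * hval hh (opX0 k) (opX1 k) 0 := by
    rw [mul_assoc, key, ← mul_assoc, ← mul_assoc, hval_dual, one_mul]
  have key3 := congrArg (fun f : (PowerSeries (Module.End k (Triples k)))ˣ =>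
    (PowerSeries.coeff (l.length + 1) f.val (0, 0, 1)).1 l) key2
  simp only [Units.val_mul, val_hval] at key3
  -- The operators `Y₀ - X₀` and `Y₁` kill `(0, 0, 1)`.
  have hkill : ∀ n, evc (trip (opY0 k - opX0 k) (opY1 k) 0) n h (0, 0, 1)
      = if n = 0 then h [] • (0, 0, 1) else 0 := fun n => evc_apply_of_kills (by
    rintro (_ | _ | _) <;> simp [trip, opX0_apply, opY0_apply, opY1_apply]) n h
  -- On the left hand side, the terms of positive degree in `h(Y₁, X₁)` vanish at `l`,
  -- as `l` contains the letter `0` and the coefficients of `h` at the powers of `e¹` vanish.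
  have hL : (PowerSeries.coeff (l.length + 1) (ev h (trip (opY1 k) (opX1 k) 0)
      * ev h (trip (opX0 k) (opX1 k + opD k) 0) * ev h (trip (opY0 k - opX0 k) (opY1 k) 0))
        (0, 0, 1)).1 l = delta h (l ++ [.one]) := by
    rw [coeff_mul_apply, Finset.sum_eq_single (l.length + 1)]
    · rw [coeff_ev, hkill, Nat.sub_self, if_pos rfl, hh.1.1, one_smul, coeff_mul_apply,
        Prod.fst_sum, Finset.sum_apply, Finset.sum_eq_single 0]
      · simp only [coeff_ev]
        rw [evc_diagonal, Nat.sub_zero, if_neg (Nat.succ_ne_zero _)]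
        simp [evc, Algebra.algebraMap_eq_smul_one, hh.1.1, tailSeries]
      · intro i _ hi
        simp only [coeff_ev]
        have h0 : OnlyOnes
            ((evc (trip (opX0 k) (opX1 k + opD k) 0) (l.length + 1 - i) h (0, 0, 1)).2.1
            - (evc (trip (opX0 k) (opX1 k + opD k) 0) (l.length + 1 - i) h (0, 0, 1)).1) := by
          rw [evc_diagonal]
          split_ifs <;> intro w _ <;> simp
        have h1 := (evc_opY1_opX1 h0 i h).1 l hl
        rw [coeff_replicate_one hh hi, zero_smul, sub_zero] at h1
        exact h1
      · simp
    · intro i hi hne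
      have hi : i ≤ l.length + 1 := by simpa [Nat.lt_succ_iff] using hi
      rw [coeff_ev h (trip (opY0 k - opX0 k) (opY1 k) 0), hkill, if_neg (by omega), map_zero]
    · simp
  rw [hL, coeff_mul_apply, Prod.fst_sum, Finset.sum_apply, Finset.sum_range_succ'] at key3
  rw [key3, ← Finset.sum_range_reflect]
  -- On the right hand side, the constant term of `h(Y₀, D + Y₁)` does not see the first component.
  have h0 : (PowerSeries.coeff 0 (ev h (trip (opY0 k) (opD k + opY1 k) 0))
      (PowerSeries.coeff (l.length + 1 - 0) (ev h (trip (opX0 k) (opX1 k) 0))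
        (0, 0, 1))).1 l = 0 := by
    rw [coeff_ev, coeff_ev, evc_second, Nat.sub_zero, if_neg (Nat.succ_ne_zero _)]
    simp [evc, Algebra.algebraMap_eq_smul_one]
  rw [h0, add_zero]
  refine Finset.sum_congr rfl fun i hi => ?_
  have hi : i ≤ l.length := by simpa [Nat.lt_succ_iff] using hi
  rw [coeff_ev, coeff_ev, evc_second, show l.length + 1 - 1 - i = l.length - i by omega,
    show l.length + 1 - (l.length - i + 1) = i by omega]
  rcases Nat.eq_zero_or_pos i with rfl | hpos
  · rw [if_pos rfl, hh.1.1, one_smul, evc_first, if_pos (by omega), Nat.sub_zero, Nat.sub_self]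
    simp [oneSeries, delta, hh.1.1]
  · rw [if_neg hpos.ne', evc_first, if_pos (by omega), show l.length - (l.length - i) = i by omega,
      mul_comm]
    congr 1
    rcases List.eq_nil_or_concat (l.take i) with h2 | ⟨m, y, h2⟩
    · have := congrArg List.length h2
      rw [List.length_take, List.length_nil] at this
      omega
    · have hlen : m.length + 1 = i := by
        have := congrArg List.length h2
        rw [List.length_take, List.concat_eq_append, List.length_append,
            List.length_singleton] at this
        omega
      rw [h2, List.concat_eq_append, zero_smul, add_zero, mulLetterRight_snoc]
      cases y
      · simp
      · simp [tailSeries, hlen]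

end StarRelation

/-! ### Values at `e₁ (e₀ - e₁)^n`, convolution, and words of indices -/

section DepthGraded
theorem delta_snoc {k : Type*} (h : NCSeries k L3) :
    (delta fun w => h (w ++ [L3.one])) = fun w => delta h (w ++ [L01.one]) := by
  funext w
  simp [delta, L01.toL3]

variable {k : Type*} [CommRing k] {h : NCSeries k L3}

/-- The operator `(x, c) ↦ (x, 0)`. -/
def opA (k : Type*) [CommRing k] : Module.End k (k × k) := (LinearMap.fst k k k).prod 0

/-- The operator `(x, c) ↦ (c - x, 0)`. -/
def opB (k : Type*) [CommRing k] : Module.End k (k × k) :=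
  (LinearMap.snd k k k - LinearMap.fst k k k).prod 0

theorem opA_apply (m : k × k) : opA k m = (m.1, 0) := rfl
theorem opB_apply (m : k × k) : opB k m = (m.2 - m.1, 0) := rfl
theorem neg_opA_sub_opB_apply (m : k × k) : (-opA k - opB k) m = (-m.2, 0) := by
  simp [opA_apply, opB_apply]
  ring

/-- On the line of the vectors `(x, 0)`, operators which act there by scalars may be replaced by
these scalars. -/
theorem evc_scalar {X : Type} [Fintype X] {A : X → Module.End k (k × k)} {s : X → k}
    (hA : ∀ y x, A y (x, 0) = (s y * x, 0)) (n : ℕ) (h : NCSeries k X) (x : k) :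
    evc A n h (x, 0) = (evc s n h * x, 0) := by
  induction n generalizing h with
  | zero => simp [evc, Algebra.algebraMap_eq_smul_one]
  | succ n ih =>
    simp only [evc, LinearMap.sum_apply, Module.End.mul_apply, ih, hA, Finset.sum_mul, mul_assoc]
    refine Prod.ext (Prod.fst_sum.trans rfl) (Prod.snd_sum.trans (by simp))

theorem evc_scalar_single {A : L3 → Module.End k (k × k)} {s : k}
    (hA : ∀ y x, A y (x, 0) = (if y = .zero then s * x else 0, 0)) (n : ℕ) (h : NCSeries k L3)
    (x : k) : evc A n h (x, 0) = (h (List.replicate n .zero) * s ^ n * x, 0) := by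
  rw [evc_scalar (s := fun y => if y = .zero then s else 0), evc_single, smul_eq_mul]
  intro y x
  rw [hA]
  simp

variable [Algebra ℚ k]

theorem evc_one_neg_one (n : ℕ) (h : NCSeries k L3) : evc (trip (1 : k) (-1) 0) n h
    = pairing (delta h) (starSub (word (List.replicate n .one))) := by
  induction n generalizing h with
  | zero => simp [evc, word_nil, pairing_one, delta]
  | succ n ih =>
    have : starSub (e .one) = e .zero - e .one := by simp [starSub]
    rw [evc, sum_L3, List.replicate_succ', word_append, map_mul,
      show word [L01.one] = e .one by simp [word], this, mul_sub, map_sub, pairing_mul_letter,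
      pairing_mul_letter, ih, ih]
    simp only [trip]
    rw [one_mul, zero_mul, add_zero, neg_one_mul, sub_eq_add_neg]
    rfl

/-- The value at `e₁ (e₀ - e₁)^n`: apply `hval_pp` for the operators `A = opA` and `B = opB` to the
vector `(0, 1)`. The innermost letter maps it to the line of the vectors `(x, 0)`, on which `A`, `B`
and `-A - B` act by the scalars `1`, `-1` and `0`. -/
theorem starValue_replicate (hh : h ∈ PENT2 k) (n : ℕ) : starValue h (List.replicate n .one)
    = -((1 + (-1) ^ (n + 1)) * h (List.replicate n .zero ++ [.negOne])) := by
  have key := congrArg (fun f : (PowerSeries (Module.End k (k × k)))ˣ =>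
    (PowerSeries.coeff (n + 1) f.val (0, 1)).1) (hval_pp hh (opA k) (opB k))
  simp only [Units.val_mul, val_hval] at key
  have hA : ∀ y x, trip (opA k) 0 (-opA k - opB k) y (x, 0)
      = (if y = .zero then 1 * x else 0, 0) := by
    rintro (_ | _ | _) x <;> simp [trip, opA_apply, opB_apply] <;> rfl
  have hB : ∀ y x, trip (opB k) 0 (-opA k - opB k) y (x, 0)
      = (if y = .zero then -1 * x else 0, 0) := by
    rintro (_ | _ | _) x <;> simp [trip, opA_apply, opB_apply] <;> rfl
  have hAB : ∀ y x, trip (opA k) (opB k) 0 y (x, 0) = (trip (1 : k) (-1) 0 y * x, 0) := by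
    rintro (_ | _ | _) x <;> simp [trip, opA_apply, opB_apply] <;> rfl
  have e1 : evc (trip (opA k) 0 (-opA k - opB k)) (n + 1) h (0, 1)
      = (-h (List.replicate n .zero ++ [.negOne]), 0) := by
    rw [evc_snoc, sum_L3]
    simp only [trip, LinearMap.add_apply, Module.End.mul_apply, LinearMap.zero_apply, map_zero,
      add_zero, neg_opA_sub_opB_apply, opA_apply]
    rw [evc_scalar_single hA, evc_scalar_single hA]
    simp
  have e2 : evc (trip (opB k) 0 (-opA k - opB k)) (n + 1) h (0, 1)
      = ((-1) ^ (n + 1) * h (List.replicate n .zero ++ [.negOne]), 0) := by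
    rw [evc_snoc, sum_L3]
    simp only [trip, LinearMap.add_apply, Module.End.mul_apply, LinearMap.zero_apply, map_zero,
      add_zero, neg_opA_sub_opB_apply, opB_apply]
    rw [evc_scalar_single hB, evc_scalar_single hB, ← List.replicate_succ',
        coeff_replicate_zero hh (Nat.succ_ne_zero n)]
    simp only [Prod.mk_add_mk, Prod.mk.injEq, add_zero, and_true]
    ring
  have e3 : ∀ m, evc (trip (opA k) (opB k) 0) (m + 1) h (0, 1)
      = (starValue h (List.replicate m .one), 0) := by
    intro m
    rw [evc_snoc, sum_L3]
    simp only [trip, LinearMap.add_apply, Module.End.mul_apply, LinearMap.zero_apply, map_zero,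
      add_zero, opA_apply, opB_apply]
    rw [evc_scalar hAB, evc_scalar hAB, sub_zero, mul_zero, mul_one]
    have := evc_one_neg_one m fun w => h (w ++ [L3.one])
    rw [delta_snoc, ← pairing_letter_mul] at this
    rw [starValue, ← this]
    simp
  rw [coeff_mul_apply, Finset.sum_range_succ, Finset.sum_eq_single_of_mem 0 (by simp)] at key
  · simp only [coeff_ev] at key
    rw [Nat.sub_zero, Nat.sub_self, e3, e1, evc_scalar_single hB] at key
    have e4 : evc (trip (opA k) (opB k) 0) 0 h (0, 1) = (0, 1) := by
      simp [evc, Algebra.algebraMap_eq_smul_one, hh.1.1]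
    rw [e4, e2] at key
    simp [hh.1.1] at key
    linear_combination key
  · intro i hi hne
    obtain ⟨m, hm⟩ : ∃ m, n + 1 - i = m + 1 := ⟨n - i, by simp at hi; omega⟩
    simp only [coeff_ev]
    rw [hm, e3, evc_scalar_single hB, coeff_replicate_zero hh hne]
    simp

end DepthGraded

section Convolution

/-- If `Θ` is inverse to `Z` for the deconcatenation convolution and `Z * W = S`, then `W = Θ * S`.
The value of `Z` at the empty word is understood to be `1`. -/
theorem eq_convolution {k X : Type*} [CommRing k] {Z Θ S W : List X → k} (hΘ0 : Θ [] = 1)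
    (hW0 : W [] = S [])
    (hΘ : ∀ κ ≠ [], Θ κ = -∑ j ∈ Finset.range κ.length, Z (κ.take (j + 1)) * Θ (κ.drop (j + 1)))
    (hW : ∀ κ ≠ [], W κ = S κ
      - ∑ j ∈ Finset.range κ.length, Z (κ.take (j + 1)) * W (κ.drop (j + 1))) :
    ∀ κ, W κ = ∑ i ∈ Finset.range (κ.length + 1), Θ (κ.take i) * S (κ.drop i) := by
  have key : ∀ n, ∀ κ : List X, κ.length = n →
      W κ = ∑ i ∈ Finset.range (κ.length + 1), Θ (κ.take i) * S (κ.drop i) := by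
    intro n
    induction n using Nat.strong_induction_on with
    | _ n ih =>
      intro κ hn
      by_cases hκ : κ = []
      · subst hκ
        simp [hΘ0, hW0]
      have h1 : ∀ j ∈ Finset.range κ.length, Z (κ.take (j + 1)) * W (κ.drop (j + 1))
          = ∑ i ∈ Finset.Ico j κ.length, Z (κ.take (j + 1)) *
              (Θ ((κ.drop (j + 1)).take (i - j)) * S (κ.drop (i + 1))) := by
        intro j hj
        have hj : j < κ.length := by simpa using hj
        rw [ih _ _ _ rfl, Finset.sum_Ico_eq_sum_range, Finset.mul_sum]
        · refine Finset.sum_congr (by congr 1; simp; omega) fun i _ => ?_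
          rw [List.drop_drop, show j + i - j = i by omega, show j + 1 + i = j + i + 1 by omega]
        · simp; omega
      have h2 : ∀ i ∈ Finset.range κ.length, Θ (κ.take (i + 1)) * S (κ.drop (i + 1))
          = -∑ j ∈ Finset.range (i + 1), Z (κ.take (j + 1)) *
              (Θ ((κ.drop (j + 1)).take (i - j)) * S (κ.drop (i + 1))) := by
        intro i hi
        have hi : i < κ.length := by simpa using hi
        have hlen : (κ.take (i + 1)).length = i + 1 := by simp; omega
        rw [hΘ, hlen, neg_mul, Finset.sum_mul]
        · refine congrArg _ (Finset.sum_congr rfl fun j hj => ?_)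
          have hj : j ≤ i := by simpa [Nat.lt_succ_iff] using hj
          rw [List.take_take, min_eq_left (by omega), List.drop_take,
            show i + 1 - (j + 1) = i - j by omega, mul_assoc]
        · intro h0
          rw [h0] at hlen
          simp at hlen
      rw [hW κ hκ, Finset.sum_range_succ', Finset.sum_congr rfl h1, Finset.sum_congr rfl h2,
        Finset.sum_neg_distrib, Finset.sum_comm' (s' := fun i => Finset.range (i + 1))
          (t' := Finset.range κ.length)]
      · simp only [List.take_zero, List.drop_zero, hΘ0]
        ring
      · intro i j
        simp only [Finset.mem_range, Finset.mem_Ico]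
        omega
  exact fun κ => key _ κ rfl

end Convolution

section Indices

/-- The word `e₀^{k₁-1} e₁ ⋯ e₀^{k_d-1} e₁`. -/
def yWord (κ : List ℕ+) : List L01 :=
  κ.flatMap fun n => List.replicate (n - 1 : ℕ) L01.zero ++ [L01.one]

theorem yWord_cons (k : ℕ+) (ks : List ℕ+) :
    yWord (k :: ks) = List.replicate (k - 1 : ℕ) L01.zero ++ L01.one :: yWord ks := by
  simp [yWord]

theorem zWord_cons (k : ℕ+) (ks : List ℕ+) :
    zWord (k :: ks) = L01.one :: (List.replicate (k - 1 : ℕ) L01.zero ++ zWord ks) := by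
  simp [zWord]

theorem reverse_zWord_reverse (κ : List ℕ+) : (zWord κ.reverse).reverse = yWord κ := by
  induction κ with
  | nil => rfl
  | cons k ks ih =>
    rw [yWord_cons, ← ih]
    simp [zWord]

theorem zWord_append_one (κ : List ℕ+) : zWord κ ++ [L01.one] = L01.one :: yWord κ := by
  induction κ with
  | nil => rfl
  | cons k ks ih => rw [zWord_cons, yWord_cons, List.cons_append, List.append_assoc, ih]

theorem zWord_indexOfXY (l : List L01) : zWord (indexOfXY l) = L01.one :: l := by
  induction l with
  | nil => rfl
  | cons a w ih =>
    cases a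
    · rw [indexOfXY]
      rcases hk : indexOfXY w with _ | ⟨k, ks⟩
      · rw [hk] at ih
        simp [zWord] at ih
      · rw [hk, zWord_cons] at ih
        rw [List.modifyHead_cons, zWord_cons, ← (List.cons.inj ih).2]
        have := k.pos
        rw [show ((k + 1 : ℕ+) : ℕ) - 1 = (k - 1 : ℕ) + 1 by simp; omega, List.replicate_succ,
          List.cons_append]
    · rw [indexOfXY, zWord_cons, ih]
      simp

/-- The initial segments of the word of an index which do not end with `0` are those that correspond
to the initial segments of the index. -/
theorem sum_prefixes {k : Type*} [CommRing k] (f : List L01 → List L01 → k) (a : ℕ+)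
    (ks : List ℕ+) :
    (∑ i ∈ Finset.range ((zWord (a :: ks)).tail.length + 1),
      if ((zWord (a :: ks)).tail.take i).getLast? = some .zero then 0
      else f ((zWord (a :: ks)).tail.take i) ((zWord (a :: ks)).tail.drop i))
    = ∑ j ∈ Finset.range (ks.length + 1),
      f (yWord ((a :: ks).take j)) (zWord ((a :: ks).drop j)).tail := by
  induction ks generalizing a f with
  | nil =>
    have e0 : (zWord [a]).tail = List.replicate (a - 1 : ℕ) L01.zero := by
      rw [zWord_cons, List.tail_cons]
      exact List.append_nil _
    rw [Finset.sum_eq_single 0]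
    · simp [yWord]
    · intro i hi h0
      rw [if_pos]
      rw [e0] at hi ⊢
      rw [List.length_replicate, Finset.mem_range] at hi
      rw [List.take_replicate, List.getLast?_replicate, if_neg (by omega)]
    · simp
  | cons b ks ih =>
    have e1 : (zWord (a :: b :: ks)).tail
        = List.replicate (a - 1 : ℕ) L01.zero ++ [L01.one] ++ (zWord (b :: ks)).tail := by
      simp [zWord_cons]
    have e2 : (List.replicate (a - 1 : ℕ) L01.zero ++ [L01.one]).length = a := by
      have := a.pos
      simp; omega
    have e3 : (zWord (a :: b :: ks)).tail.length + 1
        = a + ((zWord (b :: ks)).tail.length + 1) := by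
      rw [e1, List.length_append, e2]; ring
    rw [e3, Finset.sum_range_add, List.length_cons, Finset.sum_range_succ' _ (ks.length + 1),
        add_comm]
    congr 1
    · have := ih (fun p s => f (List.replicate (a - 1 : ℕ) L01.zero ++ L01.one :: p) s) b
      simp only [List.take_succ_cons, List.drop_succ_cons, yWord_cons a]
      rw [← this]
      refine Finset.sum_congr rfl fun i _ => ?_
      generalize (zWord (b :: ks)).tail = l' at e1
      have e4 : ∀ A : List L01, A.length = a → (A ++ l').take (a + i) = A ++ l'.take i
          ∧ (A ++ l').drop (a + i) = l'.drop i := by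
        intro A hA
        rw [← hA, List.take_length_add_append, List.drop_length_add_append]
        exact ⟨rfl, rfl⟩
      rw [e1, (e4 _ e2).1, (e4 _ e2).2, List.append_assoc, List.singleton_append]
      refine if_congr ?_ rfl rfl
      rw [List.getLast?_append, List.getLast?_cons]
      cases (l'.take i).getLast? <;> simp
    · rw [Finset.sum_eq_single_of_mem 0 (by simp)]
      · simp [yWord]
      · intro i hi h0
        have hi : i < a := by simpa using hi
        rw [if_pos]
        rw [e1, List.append_assoc, List.take_append_of_le_length (by simp; omega),
          List.take_replicate, List.getLast?_replicate, if_neg (by omega)]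

end Indices

/-! ### The map `℘` -/

section WStar

variable {k : Type*} [CommRing k] {h : NCSeries k L3}

theorem yWord_replicate (n : ℕ) : yWord (List.replicate n 1) = List.replicate n .one := by
  induction n with
  | zero => rfl
  | succ n ih => rw [List.replicate_succ, yWord_cons, ih, List.replicate_succ]; rfl

theorem zWord_replicate (n : ℕ) : zWord (List.replicate n 1) = List.replicate n .one := by
  induction n with
  | zero => rfl
  | succ n ih => rw [List.replicate_succ, zWord_cons, ih, List.replicate_succ]; rfl

theorem zero_mem_zWord {κ : List ℕ+} (hκ : κ ≠ List.replicate κ.length 1) :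
    L01.zero ∈ zWord κ := by
  induction κ with
  | nil => simp at hκ
  | cons n κ ih =>
    rw [zWord_cons]
    by_cases hn : n = 1
    · subst hn
      have : κ ≠ List.replicate κ.length 1 := by
        intro h0
        apply hκ
        rw [List.length_cons, List.replicate_succ, ← h0]
      simp [ih this]
    · have h1 : (n : ℕ) ≠ 1 := fun h => hn (PNat.eq h)
      have := n.pos
      have : (n - 1 : ℕ) ≠ 0 := by omega
      simp [List.mem_replicate, this]

theorem sum_even {F : ℕ → k} (d : ℕ) (hF : ∀ n > d, F n = 0) :
    ∑ n ∈ Finset.range d, (1 + (-1) ^ (n + 1)) * F (n + 1)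
      = 2 * ∑ m ∈ Finset.Icc 1 d, F (2 * m) := by
  have key : ∀ D, ∑ n ∈ Finset.range (2 * D), (1 + (-1) ^ (n + 1)) * F (n + 1)
      = 2 * ∑ m ∈ Finset.Icc 1 D, F (2 * m) := by
    intro D
    induction D with
    | zero => simp
    | succ D ih =>
      rw [Finset.sum_Icc_succ_top (by omega), mul_add (2 : k), ← ih,
        show 2 * (D + 1) = 2 * D + 1 + 1 by ring,
        Finset.sum_range_succ, Finset.sum_range_succ]
      simp only [pow_succ, pow_mul]
      ring
  rw [← key]
  refine Finset.sum_subset (Finset.range_subset_range.2 (by omega)) fun n _ hn => ?_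
  rw [hF _ (by simpa [Nat.lt_succ_iff] using hn), mul_zero]

variable [Algebra ℚ k]

/-- The value `⟨δ(h), w⋆(κ)⟩`. -/
def wstarValue (h : NCSeries k L3) (κ : List ℕ+) : k :=
  if κ = [] then 1 else -starValue h (zWord κ).tail

theorem wstarValue_of_ne {κ : List ℕ+} (hκ : κ ≠ []) :
    wstarValue h κ = -starValue h (zWord κ).tail := if_neg hκ

/-- The values at the `w⋆(κ)` for `κ = (1, …, 1)`. -/
def onesValue (h : NCSeries k L3) (κ : List ℕ+) : k :=
  if κ = List.replicate κ.length 1 then wstarValue h κ else 0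

theorem delta_yWord (κ : List ℕ+) :
    delta h (yWord κ) = pairing (delta h) (word (zWord κ.reverse)) := by
  rw [pairing_word, reverse_zWord_reverse]

/-- The values `⟨δ(h), w⋆(κ)⟩` are determined recursively by those for `κ = (1, …, 1)`. -/
theorem wstarValue_recursion (hh : h ∈ PENT2 k) (κ : List ℕ+) (hκ : κ ≠ []) :
    wstarValue h κ = onesValue h κ - ∑ j ∈ Finset.range κ.length,
      delta h (yWord (κ.take (j + 1))) * wstarValue h (κ.drop (j + 1)) := by
  by_cases h1 : κ = List.replicate κ.length 1
  · rw [onesValue, if_pos h1, Finset.sum_eq_zero, sub_zero]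
    intro j hj
    have hj : j < κ.length := by simpa using hj
    have e1 : κ.take (j + 1) = List.replicate (j + 1) 1 := by
      rw [h1, List.take_replicate, min_eq_left (by omega)]
    rw [e1, yWord_replicate, delta_replicate_one hh (Nat.succ_ne_zero j), zero_mul]
  · obtain ⟨a, ks, rfl⟩ := List.exists_cons_of_ne_nil hκ
    have hz : L01.zero ∈ (zWord (a :: ks)).tail := by
      have := zero_mem_zWord h1
      rw [zWord_cons, List.mem_cons] at this
      rw [zWord_cons]
      exact this.resolve_left (by simp)
    have e1 : (zWord (a :: ks)).tail ++ [.one] = yWord (a :: ks) := by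
      have := zWord_append_one (a :: ks)
      rw [zWord_cons, List.cons_append] at this
      rw [zWord_cons]
      exact (List.cons.inj this).2
    have key := delta_snoc_one hh hz
    have := sum_prefixes (fun p s => delta h p * starValue h s) a ks
    simp only [ite_mul, zero_mul] at key
    rw [this, e1, Finset.sum_range_succ'] at key
    rw [onesValue, if_neg h1, wstarValue_of_ne hκ, List.length_cons, Finset.sum_range_succ]
    have e2 : ∀ j ∈ Finset.range ks.length,
        delta h (yWord ((a :: ks).take (j + 1))) * wstarValue h ((a :: ks).drop (j + 1))
        = -(delta h (yWord ((a :: ks).take (j + 1)))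
            * starValue h (zWord ((a :: ks).drop (j + 1))).tail) := by
      intro j hj
      have hj : j < ks.length := by simpa using hj
      rw [wstarValue_of_ne, mul_neg]
      rw [Ne, List.drop_eq_nil_iff, List.length_cons]
      omega
    rw [Finset.sum_congr rfl e2, Finset.sum_neg_distrib]
    have e3 : delta h (yWord []) = 1 := hh.1.1
    have e4 : wstarValue h [] = 1 := if_pos rfl
    rw [List.drop_succ_cons, List.drop_length, List.take_succ_cons, List.take_length, e4]
    rw [List.take_zero, List.drop_zero, e3] at key
    linear_combination key

/-- The definition of `θ`, in terms of values at `δ(h)`. -/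
theorem pairing_theta_recursion (hh : h ∈ PENT2 k) (κ : List ℕ+) (hκ : κ ≠ []) :
    pairing (delta h) (theta κ) = -∑ j ∈ Finset.range κ.length,
      delta h (yWord (κ.take (j + 1))) * pairing (delta h) (theta (κ.drop (j + 1))) := by
  obtain ⟨a, ks, rfl⟩ := List.exists_cons_of_ne_nil hκ
  rw [theta, map_neg, map_sum, List.length_cons, ← Fin.sum_univ_eq_sum_range
    (fun j => delta h (yWord ((a :: ks).take (j + 1)))
      * pairing (delta h) (theta ((a :: ks).drop (j + 1))))]
  refine congrArg _ (Finset.sum_congr rfl fun j _ => ?_)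
  rw [pairing_delta_sh hh, delta_yWord]

/-- The recursions for `θ` and `w⋆` differ by the inhomogeneous term `onesValue`. -/
theorem wstarValue_eq_convolution (hh : h ∈ PENT2 k) (κ : List ℕ+) : wstarValue h κ
    = ∑ i ∈ Finset.range (κ.length + 1),
      pairing (delta h) (theta (κ.take i)) * onesValue h (κ.drop i) := by
  refine eq_convolution (Z := fun κ => delta h (yWord κ))
    (Θ := fun κ => pairing (delta h) (theta κ)) ?_ ?_
    (pairing_theta_recursion hh) (wstarValue_recursion hh) κ
  · rw [theta, pairing_one]
    exact hh.1.1
  · simp [onesValue]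

theorem onesValue_replicate (hh : h ∈ PENT2 k) (n : ℕ) : onesValue h (List.replicate (n + 1) 1)
    = (1 + (-1) ^ (n + 1)) * h (List.replicate n .zero ++ [.negOne]) := by
  rw [onesValue, if_pos (by simp), wstarValue_of_ne (by simp [List.replicate_succ]),
    zWord_replicate, List.replicate_succ, List.tail_cons, starValue_replicate hh, neg_neg]

/-- The correction term in `θ₁` accounts for the values at `w⋆(1, …, 1)`. -/
theorem pairing_theta1 (hh : h ∈ PENT2 k) (κ : List ℕ+) :
    pairing h (theta1 κ) = wstarValue h κ := by
  have hθ : ∀ κ, pairing h (theta' κ) = pairing (delta h) (theta κ) := fun κ =>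
    pairing_dist_reg01 hh (theta κ)
  set F : ℕ → k := fun n => if κ = κ.take (κ.length - n) ++ List.replicate n 1 then
    h (List.replicate (n - 1) .zero ++ [.negOne])
      * pairing (delta h) (theta (κ.take (κ.length - n))) else 0 with hF
  have hF0 : ∀ n > κ.length, F n = 0 := by
    intro n hn
    rw [hF]
    dsimp only
    rw [if_neg]
    intro hc
    have := congrArg List.length hc
    simp at this
    omega
  have e1 : pairing h (theta1 κ) = pairing (delta h) (theta κ)
      + 2 * ∑ m ∈ Finset.Icc 1 κ.length, F (2 * m) := by
    rw [theta1, map_add, hθ, two_mul, two_mul, map_add, map_sum]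
    have : ∀ m, pairing h (if κ = κ.take (κ.length - 2 * m) ++ List.replicate (2 * m) 1 then
        sh (word (L3.negOne :: List.replicate (2 * m - 1) L3.zero))
          (theta' (κ.take (κ.length - 2 * m))) else 0) = F (2 * m) := by
      intro m
      rw [hF]
      dsimp only
      split_ifs
      · rw [pairing_sh hh.1, hθ, pairing_word, List.reverse_cons, List.reverse_replicate]
      · exact map_zero _
    simp only [this]
  rw [e1, ← sum_even _ hF0, wstarValue_eq_convolution hh,
      ← Finset.sum_range_reflect _ (κ.length + 1),
    Finset.sum_range_succ', add_comm]
  congr 1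
  · refine Finset.sum_congr rfl fun n hn => ?_
    have hn : n < κ.length := by simpa using hn
    rw [show κ.length + 1 - 1 - (n + 1) = κ.length - (n + 1) by omega, hF]
    dsimp only
    have hl : (κ.drop (κ.length - (n + 1))).length = n + 1 := by simp; omega
    by_cases hc : κ.drop (κ.length - (n + 1)) = List.replicate (n + 1) 1
    · rw [if_pos, hc, onesValue_replicate hh, Nat.add_sub_cancel]
      · ring
      · conv_lhs => rw [← List.take_append_drop (κ.length - (n + 1)) κ, hc]
    · rw [if_neg, onesValue, if_neg, mul_zero, mul_zero]
      · rwa [hl]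
      · intro h1
        apply hc
        conv_lhs at h1 => rw [← List.take_append_drop (κ.length - (n + 1)) κ]
        exact List.append_cancel_left h1
  · simp [onesValue, wstarValue]

theorem starSub_toXY (p : Alg L01) : starSub (toXY p) = varrho p := by
  have : starSub.comp toXY = varrho := by
    refine FreeAlgebra.hom_ext (funext fun x => ?_)
    cases x <;> simp [starSub, toXY, varrho]
  exact DFunLike.congr_fun this p

/-- The defining property of `℘`, in terms of values: `℘` at `h` is `ϱ` at `δ(h)`. -/
theorem pairing_wp (hh : h ∈ PENT2 k) (v : List L01) (hv : v.head? ≠ some .zero) :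
    pairing h (wp (word v)) = pairing (delta h) (varrho (word v)) := by
  rcases v with _ | ⟨_ | _, w⟩
  · have : wp (word []) = 1 := by rw [wp, linExt_word]
    rw [this, word_nil, map_one varrho, pairing_one, pairing_one]
    rfl
  · simp at hv
  · have h1 : varrho (e .one) = -e .one := by simp [varrho]
    rw [word_cons, wp_one_mul, map_mul, h1, ← starSub_toXY]
    have key : pairing h ∘ₗ linExt (fun v => theta1 (indexOfXY v))
        = -(pairing (delta h) ∘ₗ LinearMap.mulLeft ℚ (e .one) ∘ₗ starSub.toLinearMap) :=
      ext_word fun l => by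
        have hne : indexOfXY l ≠ [] := by
          intro h0
          have := zWord_indexOfXY l
          rw [h0] at this
          simp [zWord] at this
        rw [LinearMap.comp_apply, linExt_word, pairing_theta1 hh, wstarValue_of_ne hne,
          zWord_indexOfXY]
        rfl
    have := LinearMap.congr_fun key (toXY (word w))
    rw [neg_mul, map_neg]
    exact this

end WStar

end Confluence

end

theorem theorem1p5 {k : Type*} [CommRing k] [Algebra ℚ k]
    (h : Confluence.NCSeries k Confluence.L3) (hh : h ∈ Confluence.PENT2 k)
    (u : Confluence.Alg Confluence.L3) (hu : u ∈ Confluence.ICF) :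
    Confluence.pairing h u = 0 := by
  obtain ⟨x, hx, rfl⟩ := hu
  rw [map_sub, sub_eq_zero]
  symm
  induction hx using Submodule.span_induction with
  | zero => simp
  | add x y _ _ hx hy => simp only [map_add, hx, hy]
  | smul c x _ hx => simp only [map_smul, hx]
  | mem x hx =>
    obtain ⟨w, h0, h1, rfl⟩ := hx
    exact Confluence.pairing_phi hh (Confluence.pairing_reg3 hh)
      (fun u hu => Confluence.pairing_connectionSeries_eq hh (Confluence.pairing_wp hh) hu) w
      (Submodule.subset_span ⟨w, h0, h1, rfl⟩)
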